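/- **Setting.** Let $G$ be a Lie group with Lie algebra $\mathfrak g$ and a basis $(e_a)$ of $\mathfrak g$. Let $\pi: X\to S$ be a smooth fibre bundle with compact fibres of even dimension $n$, with a smooth horizontal distribution $H\subset TX$ (so $d\pi: H_x\to T_{\pi(x)}S$ is an isomorphism) and a smooth metric $g^{X/S}$ on the vertical bundle $T(X/S)=\ker d\pi$. Let $G$ act smoothly on $X$ and $S$ such that $\pi$ is equivariant and $H$, $g^{X/S}$ are preserved. Let $P: TX\to T(X/S)$ be the projection with kernel $H$, let $T(\eta,\zeta)=-P[\eta,\zeta]$ for sections $\eta,\zeta$ of $H$ be the Frobenius tensor (extended by $0$ to vertical vectors), and let $\nu^{X/S}\in\Omega^n_X$ be the vertical Riemannian volume form for an orientation of $T(X/S)$, extended by $0$ along $H$; suppose that it is $G$-invariant. The mean curvature form is the $1$-form $k\in\Omega^1_X$ vanishing on vertical vectors that is characterized by $$d\nu^{X/S}=k\wedge\nu^{X/S}+\sum_{i=1}^n\langle T,e_i\rangle\wedge\iota_{e_i}\nu^{X/S},$$ $(e_i)$ being an orthonormal basis of $T(X/S)$. Let $Q\to M$ be a principal $G$-bundle with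 connection form $\Phi=\phi^a e_a\in\Omega^1_Q(\mathfrak g)$ and $V=\ker\Phi$. For a $G$-manifold $Y$ put $Y_Q=Q\times_G Y=(Q\times Y)/G$, the quotient by $(q,y)\cdot g=(qg,g^{-1}y)$, with quotient map $q_Y: Q\times Y\to Y_Q$. Let $\iota_a$ be the contraction with the vector field on $Q\times Y$ generated by $e_a$ through this action. Let $\pi_Q: X_Q\to S_Q$ be the family induced by $\pi$, with horizontal distribution $H_Q=(q_X)_*(V\oplus H)$ and with the vertical metric $g_Q^{X/S}$ to which the pullback of $g^{X/S}$ to $Q\times X$ descends, and let $k_Q$ be its mean curvature form (defined as above from $\pi_Q,H_Q,g_Q^{X/S}$ and a vertical volume form of $X_Q\to S_Q$). **Proposition.** On $Q\times X$ one has $$q_X^*k_Q=k-\phi^a\iota_a k ,$$ where $k$ and $\phi^a$ are pulled back to $Q\times X$. Consequently, when a $1$-form on the total space of a family that vanishes on vertical vectors is regarded, through horizontal lifts, as a $1$-form on the base with values in the functions on the fibres, one has $$k_Q=k-\phi^a\iota_a k$$ as $1$-forms on $Q\times S$ with values in the functions on the fibres of $\pi$ (with $k_Q$ pulled back along $q_S$),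 and this form is basic, i.e. annihilated by all $\iota_a$ and $G$-invariant. -/

import Mathlib

open scoped Manifold ContDiff Topology
open MulOpposite

namespace Families

/-- The equivalence relation `(q, y) ~ (q g, g⁻¹ y)` on `Q × Y`, for a right action of `G` on `Q`
and a left action of `G` on `Y`. -/
def assocSetoid (G Q Y : Type*) [Group G] [MulAction Gᵐᵒᵖ Q] [MulAction G Y] : Setoid (Q × Y) where
  r z w := ∃ g : G, w = (op g • z.1, g⁻¹ • z.2)
  iseqv := by
    refine ⟨fun z => ⟨1, by simp⟩, ?_, ?_⟩
    · rintro z _ ⟨g, rfl⟩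
      exact ⟨g⁻¹, by simp [smul_smul]⟩
    · rintro z _ _ ⟨g, rfl⟩ ⟨h, rfl⟩
      exact ⟨g * h, by simp [smul_smul]⟩

section Principal

variable (EG EQ EM : Type*) (G : Type*) {Q M : Type*}
    [NormedAddCommGroup EG] [NormedSpace ℝ EG] [NormedAddCommGroup EQ] [NormedSpace ℝ EQ]
    [NormedAddCommGroup EM] [NormedSpace ℝ EM]
    [Group G] [TopologicalSpace G] [ChartedSpace EG G]
    [TopologicalSpace Q] [ChartedSpace EQ Q] [TopologicalSpace M] [ChartedSpace EM M]
    [MulAction Gᵐᵒᵖ Q]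

/-- An equivariant local trivialization of `proj : Q → M` over the open set `base`: the
diffeomorphism `q ↦ (proj q, fib q)` of `proj⁻¹(base)` onto `base × G`, whose inverse is
`(m, g) ↦ sec m · g`. -/
structure LocalTriv (proj : Q → M) where
  base : Set M
  fib : Q → G
  sec : M → Q
  isOpen_base : IsOpen base
  smooth_fib : ContMDiffOn 𝓘(ℝ, EQ) 𝓘(ℝ, EG) ∞ fib (proj ⁻¹' base)
  smooth_sec : ContMDiffOn 𝓘(ℝ, EM) 𝓘(ℝ, EQ) ∞ sec base
  right_inv : ∀ m ∈ base, ∀ g : G, proj (op g • sec m) = m ∧ fib (op g • sec m) = g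
  left_inv : ∀ q ∈ proj ⁻¹' base, op (fib q) • sec (proj q) = q

variable (Q M)

/-- A smooth principal `G`-bundle `proj : Q → M`, with its right action of `G` on `Q`. -/
structure PrincipalBundle where
  proj : Q → M
  contMDiff_proj : ContMDiff 𝓘(ℝ, EQ) 𝓘(ℝ, EM) ∞ proj
  contMDiff_act : ContMDiff (𝓘(ℝ, EQ).prod 𝓘(ℝ, EG)) 𝓘(ℝ, EQ) ∞
    (fun p : Q × G => op p.2 • p.1)
  proj_act : ∀ (g : G) (q : Q), proj (op g • q) = proj q
  locally_trivial : ∀ m : M, ∃ t : LocalTriv EG EQ EM G proj, m ∈ t.base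

end Principal

namespace PrincipalBundle

variable {EG EQ EM G Q M : Type*}
    [NormedAddCommGroup EG] [NormedSpace ℝ EG] [NormedAddCommGroup EQ] [NormedSpace ℝ EQ]
    [NormedAddCommGroup EM] [NormedSpace ℝ EM]
    [Group G] [TopologicalSpace G] [ChartedSpace EG G]
    [TopologicalSpace Q] [ChartedSpace EQ Q] [TopologicalSpace M] [ChartedSpace EM M]
    [MulAction Gᵐᵒᵖ Q]

/-- The total space of the associated bundle `Y_Q = Q ×_G Y`. -/
@[nolint unusedArguments]
def Assoc (_P : PrincipalBundle EG EQ EM G Q M) (Y : Type*) [MulAction G Y] : Type _ :=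
  Quotient (assocSetoid G Q Y)

variable (P : PrincipalBundle EG EQ EM G Q M)

section Set

variable {Y : Type*} [MulAction G Y]

/-- The quotient map `Q × Y → Y_Q`. -/
def assocMk (z : Q × Y) : P.Assoc Y := Quotient.mk (assocSetoid G Q Y) z

/-- A representative in `Q × Y` of a point of `Y_Q`. -/
noncomputable def assocOut (y : P.Assoc Y) : Q × Y := Quotient.out (s := assocSetoid G Q Y) y

theorem assocMk_out (y : P.Assoc Y) : P.assocMk (P.assocOut y) = y :=
  Quotient.out_eq (s := assocSetoid G Q Y) y

theorem assocMk_surjective : Function.Surjective (P.assocMk (Y := Y)) :=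
  fun y => ⟨_, P.assocMk_out y⟩

theorem assocMk_eq {z w : Q × Y} :
    P.assocMk z = P.assocMk w ↔ ∃ g : G, w = (op g • z.1, g⁻¹ • z.2) :=
  Quotient.eq (r := assocSetoid G Q Y)

/-- The bundle projection `Y_Q → M`. -/
def assocBase : P.Assoc Y → M :=
  Quotient.lift (s := assocSetoid G Q Y) (fun z => P.proj z.1) (by
    rintro z _ ⟨g, rfl⟩
    exact (P.proj_act g z.1).symm)

@[simp] theorem assocBase_mk (z : Q × Y) : P.assocBase (P.assocMk z) = P.proj z.1 := rfl

/-- The map `Y_Q → Z_Q` induced by an equivariant map `Y → Z`. -/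
def assocMap {Z : Type*} [MulAction G Z] (f : Y → Z) (hf : ∀ (g : G) (y : Y), f (g • y) = g • f y) :
    P.Assoc Y → P.Assoc Z :=
  Quotient.lift (s := assocSetoid G Q Y) (fun z => P.assocMk (z.1, f z.2)) (by
    rintro z _ ⟨g, rfl⟩
    exact P.assocMk_eq.2 ⟨g, by simp [hf]⟩)

@[simp] theorem assocMap_mk {Z : Type*} [MulAction G Z] (f : Y → Z)
    (hf : ∀ (g : G) (y : Y), f (g • y) = g • f y) (z : Q × Y) :
    P.assocMap f hf (P.assocMk z) = P.assocMk (z.1, f z.2) := rfl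

end Set

variable {P} in
theorem fib_act (t : LocalTriv EG EQ EM G P.proj) {q : Q} (hq : P.proj q ∈ t.base) (g : G) :
    t.fib (op g • q) = t.fib q * g := by
  have h := t.left_inv q hq
  conv_lhs => rw [← h, smul_smul, ← op_mul]
  exact (t.right_inv _ hq _).2

variable {P} in
theorem fib_sec (t : LocalTriv EG EQ EM G P.proj) {m : M} (hm : m ∈ t.base) :
    t.fib (t.sec m) = 1 := by
  simpa using (t.right_inv m hm 1).2

variable {P} in
theorem proj_sec (t : LocalTriv EG EQ EM G P.proj) {m : M} (hm : m ∈ t.base) :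
    P.proj (t.sec m) = m := by
  simpa using (t.right_inv m hm 1).1

instance {Y : Type*} [MulAction G Y] [TopologicalSpace Y] : TopologicalSpace (P.Assoc Y) :=
  inferInstanceAs (TopologicalSpace (Quotient (assocSetoid G Q Y)))

section Top

variable {Y : Type*} [MulAction G Y] [TopologicalSpace Y]

theorem isQuotientMap_assocMk : Topology.IsQuotientMap (P.assocMk (Y := Y)) :=
  isQuotientMap_quot_mk

theorem continuous_assocBase : Continuous (P.assocBase (Y := Y)) :=
  P.isQuotientMap_assocMk.continuous_iff.2 (P.contMDiff_proj.continuous.comp continuous_fst)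

end Top

variable {P}

/-- The map `[q, y] ↦ (proj q, fib q • y)` from `Y_Q` over `t.base` to `M × Y`. -/
noncomputable def assocFun (t : LocalTriv EG EQ EM G P.proj) {Y : Type*} [MulAction G Y]
    (y : P.Assoc Y) : M × Y :=
  (P.proj (P.assocOut y).1, t.fib (P.assocOut y).1 • (P.assocOut y).2)

theorem assocFun_mk (t : LocalTriv EG EQ EM G P.proj) {Y : Type*} [MulAction G Y] (z : Q × Y)
    (hz : P.proj z.1 ∈ t.base) :
    assocFun t (P.assocMk z) = (P.proj z.1, t.fib z.1 • z.2) := by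
  obtain ⟨g, hg⟩ := P.assocMk_eq.1 (P.assocMk_out (P.assocMk z)).symm
  unfold assocFun
  rw [hg]
  simp [P.proj_act, fib_act t hz, smul_smul]

/-- The homeomorphism `Y_Q|_U ≃ U × Y` given by a local trivialization over `U = t.base`. -/
noncomputable def assocHomeo (t : LocalTriv EG EQ EM G P.proj)
    (Y : Type*) [MulAction G Y] [TopologicalSpace Y] [ContinuousSMul G Y] :
    OpenPartialHomeomorph (P.Assoc Y) (M × Y) where
  toFun := assocFun t
  invFun p := P.assocMk (t.sec p.1, p.2)
  source := P.assocBase ⁻¹' t.base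
  target := t.base ×ˢ Set.univ
  map_source' := by
    intro y hy
    obtain ⟨z, rfl⟩ := P.assocMk_surjective y
    rw [assocFun_mk t z hy]
    exact ⟨hy, trivial⟩
  map_target' := by
    rintro ⟨m, y⟩ ⟨hm, -⟩
    simpa [proj_sec t hm] using hm
  left_inv' := by
    intro y hy
    obtain ⟨z, rfl⟩ := P.assocMk_surjective y
    rw [assocFun_mk t z hy]
    refine P.assocMk_eq.2 ⟨t.fib z.1, ?_⟩
    simp [t.left_inv z.1 hy]
  right_inv' := by
    rintro ⟨m, y⟩ ⟨hm, -⟩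
    have hm' : m ∈ t.base := hm
    rw [assocFun_mk t _ (by simpa [proj_sec t hm'] using hm')]
    simp [proj_sec t hm', fib_sec t hm']
  open_source := t.isOpen_base.preimage P.continuous_assocBase
  open_target := t.isOpen_base.prod isOpen_univ
  continuousOn_toFun := by
    refine (P.isQuotientMap_assocMk.continuousOn_isOpen_iff
      (t.isOpen_base.preimage P.continuous_assocBase)).2 ?_
    have h1 : ContinuousOn (fun z : Q × Y => (P.proj z.1, t.fib z.1 • z.2))
        (P.assocMk ⁻¹' (P.assocBase ⁻¹' t.base)) := by
      refine ContinuousOn.prodMk (P.contMDiff_proj.continuous.comp continuous_fst).continuousOn ?_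
      refine ContinuousOn.smul ?_ continuous_snd.continuousOn
      exact t.smooth_fib.continuousOn.comp continuous_fst.continuousOn (fun z hz => hz)
    exact h1.congr (fun z hz => assocFun_mk t z hz)
  continuousOn_invFun := by
    refine P.isQuotientMap_assocMk.continuous.comp_continuousOn ?_
    refine ContinuousOn.prodMk ?_ continuous_snd.continuousOn
    exact t.smooth_sec.continuousOn.comp continuous_fst.continuousOn (fun z hz => hz.1)

/-- `Y_Q` is locally homeomorphic to `M × Y`, through the local trivializations of `Q → M`. -/
@[reducible] noncomputable def assocChartedProd (P : PrincipalBundle EG EQ EM G Q M) (Y : Type*)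
    [MulAction G Y] [TopologicalSpace Y] [ContinuousSMul G Y] :
    ChartedSpace (M × Y) (P.Assoc Y) where
  atlas := Set.range fun t : LocalTriv EG EQ EM G P.proj => assocHomeo t Y
  chartAt y := assocHomeo (P.locally_trivial (P.assocBase y)).choose Y
  mem_chart_source y := (P.locally_trivial (P.assocBase y)).choose_spec
  chart_mem_atlas _ := ⟨_, rfl⟩

/-- The manifold structure of `Y_Q`: its charts are the local trivializations `Y_Q|_U ≃ U × Y`
followed by the product charts of `M × Y`. -/
noncomputable instance assocChartedSpace (P : PrincipalBundle EG EQ EM G Q M) (Y : Type*)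
    [MulAction G Y] [TopologicalSpace Y] [ContinuousSMul G Y] {EY : Type*} [NormedAddCommGroup EY]
    [ChartedSpace EY Y] : ChartedSpace (ModelProd EM EY) (P.Assoc Y) :=
  letI := P.assocChartedProd Y
  ChartedSpace.comp (ModelProd EM EY) (M × Y) (P.Assoc Y)

section Smooth

variable {Y EY : Type*} [MulAction G Y] [TopologicalSpace Y] [ContinuousSMul G Y]
    [NormedAddCommGroup EY] [NormedSpace ℝ EY] [ChartedSpace EY Y]
    [ContMDiffSMul 𝓘(ℝ, EG) 𝓘(ℝ, EY) ∞ G Y]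

theorem smooth_change (t t' : LocalTriv EG EQ EM G P.proj) :
    ContMDiffOn (𝓘(ℝ, EM).prod 𝓘(ℝ, EY)) (𝓘(ℝ, EM).prod 𝓘(ℝ, EY)) ∞
      (assocHomeo t' Y ∘ (assocHomeo t Y).symm) ((t.base ∩ t'.base) ×ˢ Set.univ) := by
  have h : ContMDiffOn (𝓘(ℝ, EM).prod 𝓘(ℝ, EY)) (𝓘(ℝ, EM).prod 𝓘(ℝ, EY)) ∞
      (fun p : M × Y => (p.1, t'.fib (t.sec p.1) • p.2)) ((t.base ∩ t'.base) ×ˢ Set.univ) := by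
    refine contMDiffOn_fst.prodMk ?_
    have h1 : ContMDiffOn (𝓘(ℝ, EM).prod 𝓘(ℝ, EY)) 𝓘(ℝ, EG) ∞
        (fun p : M × Y => t'.fib (t.sec p.1)) ((t.base ∩ t'.base) ×ˢ Set.univ) := by
      refine t'.smooth_fib.comp (t.smooth_sec.comp contMDiffOn_fst fun p hp => hp.1.1) ?_
      intro p hp
      simpa [proj_sec t hp.1.1] using hp.1.2
    exact (contMDiff_smul (I := 𝓘(ℝ, EG)) (I' := 𝓘(ℝ, EY)) (n := ∞)
      (G := G) (M := Y)).comp_contMDiffOn (h1.prodMk contMDiffOn_snd)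
  refine h.congr fun p hp => ?_
  change assocFun t' (P.assocMk (t.sec p.1, p.2)) = _
  rw [assocFun_mk t' _ (by simpa [proj_sec t hp.1.1] using hp.1.2)]
  simp [proj_sec t hp.1.1]

/-- `Y_Q` is a smooth manifold. -/
instance [IsManifold 𝓘(ℝ, EM) ∞ M] [IsManifold 𝓘(ℝ, EY) ∞ Y] :
    IsManifold (𝓘(ℝ, EM).prod 𝓘(ℝ, EY)) ∞ (P.Assoc Y) := by
  refine isManifold_of_contDiffOn _ _ _ ?_
  intro e e' he he'
  obtain ⟨_, ⟨t, rfl⟩, c, hc, rfl⟩ := he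
  obtain ⟨_, ⟨t', rfl⟩, c', hc', rfl⟩ := he'
  rw [← contMDiffOn_iff_contDiffOn]
  have hc1 := contMDiffOn_symm_of_mem_maximalAtlas (I := 𝓘(ℝ, EM).prod 𝓘(ℝ, EY)) (n := ∞)
    (IsManifold.subset_maximalAtlas hc)
  have hc2 := contMDiffOn_of_mem_maximalAtlas (I := 𝓘(ℝ, EM).prod 𝓘(ℝ, EY)) (n := ∞)
    (IsManifold.subset_maximalAtlas hc')
  have h1 := (hc2.comp' ((smooth_change (EY := EY) (Y := Y) t t').comp' hc1)).comp'
    (ModelWithCorners.contMDiffOn_symm (I := 𝓘(ℝ, EM).prod 𝓘(ℝ, EY)) (n := ∞))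
  have h2 := (ModelWithCorners.contMDiff (I := 𝓘(ℝ, EM).prod 𝓘(ℝ, EY)) (n := ∞)).comp_contMDiffOn h1
  refine h2.mono ?_
  rintro x ⟨hx, hxr⟩
  refine ⟨hxr, ?_⟩
  simp only [OpenPartialHomeomorph.symm_source, OpenPartialHomeomorph.trans_source,
    Set.mem_preimage, Set.mem_inter_iff, OpenPartialHomeomorph.trans_symm_eq_symm_trans_symm,
    OpenPartialHomeomorph.coe_trans, Function.comp_apply] at hx ⊢
  obtain ⟨⟨ha, hb⟩, hc, hd⟩ := hx
  have hb' := hb.1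
  have hc' : P.proj (t.sec (c.symm ((𝓘(ℝ, EM).prod 𝓘(ℝ, EY)).symm x)).1) ∈ t'.base := hc
  rw [proj_sec t hb'] at hc'
  exact ⟨⟨ha, ⟨hb', hc'⟩, trivial⟩, hd⟩

end Smooth

end PrincipalBundle
/-! ### Differential forms -/

section Forms

/-- Differential `n`-forms on `X`, not assumed smooth. -/
abbrev Form {E H : Type*} [NormedAddCommGroup E] [NormedSpace ℝ E] [TopologicalSpace H]
    (I : ModelWithCorners ℝ E H) (X : Type*) [TopologicalSpace X] [ChartedSpace H X] (n : ℕ) :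
    Type _ :=
  ∀ x : X, TangentSpace I x [⋀^Fin n]→L[ℝ] ℝ

/-- Differential `1`-forms on `X`, not assumed smooth. -/
abbrev OneForm {E H : Type*} [NormedAddCommGroup E] [NormedSpace ℝ E] [TopologicalSpace H]
    (I : ModelWithCorners ℝ E H) (X : Type*) [TopologicalSpace X] [ChartedSpace H X] : Type _ :=
  ∀ x : X, TangentSpace I x →L[ℝ] ℝ

variable {E H X : Type*} [NormedAddCommGroup E] [NormedSpace ℝ E] [TopologicalSpace H]
    (I : ModelWithCorners ℝ E H) [TopologicalSpace X] [ChartedSpace H X]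

/-- The differential of the inverse of the preferred chart at `x₀`, at the point `y` of the model
space. -/
noncomputable def chartSymmDeriv (x₀ : X) (y : E) :
    E →L[ℝ] TangentSpace I ((extChartAt I x₀).symm y) :=
  mfderivWithin 𝓘(ℝ, E) I (extChartAt I x₀).symm (Set.range I) y

variable {I}

/-- The expression of a form in the preferred chart at `x₀`: its pullback by the inverse chart. -/
noncomputable def Form.inChart {n : ℕ} (η : Form I X n) (x₀ : X) (y : E) : E [⋀^Fin n]→L[ℝ] ℝ :=
  (η ((extChartAt I x₀).symm y)).compContinuousLinearMap (chartSymmDeriv I x₀ y)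

/-- The expression of a `1`-form in the preferred chart at `x₀`. -/
noncomputable def OneForm.inChart (α : OneForm I X) (x₀ : X) (y : E) : E →L[ℝ] ℝ :=
  (α ((extChartAt I x₀).symm y)).comp (chartSymmDeriv I x₀ y)

/-- A form is smooth if its expressions in the charts are smooth. -/
def Form.Smooth {n : ℕ} (η : Form I X n) : Prop :=
  ∀ x₀ : X, ContDiffOn ℝ ∞ (Form.inChart η x₀) (extChartAt I x₀).target

/-- A `1`-form is smooth if its expressions in the charts are smooth. -/
def OneForm.Smooth (α : OneForm I X) : Prop :=
  ∀ x₀ : X, ContDiffOn ℝ ∞ (OneForm.inChart α x₀) (extChartAt I x₀).target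

/-- The exterior derivative of a form, computed in the preferred chart at each point. -/
noncomputable def Form.d {n : ℕ} (η : Form I X n) : Form I X (n + 1) := fun x =>
  (extDerivWithin (Form.inChart η x) (Set.range I)
    (extChartAt I x x)).compContinuousLinearMap (mfderiv I 𝓘(ℝ, E) (extChartAt I x) x)

end Forms

section Wedge

variable {T : Type*} [AddCommGroup T] [Module ℝ T]

/-- The value `(α ∧ η)(v₀, …, vₙ) = ∑ᵢ (-1)ⁱ α(vᵢ) η(v₀, …, v̂ᵢ, …, vₙ)` of the exterior product of
a covector and an `n`-covector. -/
def wedgeOne {n : ℕ} (α : T → ℝ) (η : T [⋀^Fin n]→ₗ[ℝ] ℝ) (v : Fin (n + 1) → T) : ℝ :=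
  ∑ i : Fin (n + 1), (-1) ^ (i : ℕ) * (α (v i) * η (i.removeNth v))

/-- The value `(β ∧ η)(v₀, …, v_{m+1})` of the exterior product of a `2`-covector `β` and an
`m`-covector `η`: the sum over the pairs `a < b` of `(-1)^(a+b+1) β(v_a, v_b) η(…, v̂_a, …, v̂_b, …)`,
written as one half of the sum over all ordered pairs of distinct indices. The first index is `i`,
the second vector is the `j`-th of those left after the removal of `v i`. -/
noncomputable def wedgeTwo {m : ℕ} (β : T → T → ℝ) (η : T [⋀^Fin m]→ₗ[ℝ] ℝ)
    (v : Fin (m + 2) → T) : ℝ :=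
  (1 / 2) * ∑ i : Fin (m + 2), ∑ j : Fin (m + 1),
    (-1) ^ ((i : ℕ) + (j : ℕ)) * (β (v i) (i.removeNth v j) * η (j.removeNth (i.removeNth v)))

/-- The value of `β ∧ ι_e η` for a `2`-covector `β`, a vector `e` and an `n`-covector `η`; here
`ι_e η = η(e, ·)`, which is `0` when `n = 0`. -/
noncomputable def wedgeTwoContract (β : T → T → ℝ) (e : T) :
    {n : ℕ} → (T [⋀^Fin n]→ₗ[ℝ] ℝ) → (Fin (n + 1) → T) → ℝ
  | 0, _, _ => 0
  | _ + 1, η, v => wedgeTwo β (η.curryLeft e) v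

end Wedge

/-! ### Geometric families -/

section Family

/-- The vertical tangent space `T(X/S)_x = ker (dπ_x)`. -/
noncomputable def vertical {E H E' H' X S : Type*} [NormedAddCommGroup E] [NormedSpace ℝ E]
    [TopologicalSpace H] (I : ModelWithCorners ℝ E H) [TopologicalSpace X] [ChartedSpace H X]
    [NormedAddCommGroup E'] [NormedSpace ℝ E'] [TopologicalSpace H'] (J : ModelWithCorners ℝ E' H')
    [TopologicalSpace S] [ChartedSpace H' S] (π : X → S) (x : X) :
    Submodule ℝ (TangentSpace I x) :=
  LinearMap.ker (mfderiv I J π x).toLinearMap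

/-- The data `(π : X → S, H, g^{X/S})` underlying a geometric family: a map, a subspace of each
tangent space of `X`, and a pairing on each vertical tangent space. -/
structure FamilyData {E H E' H' : Type*} [NormedAddCommGroup E] [NormedSpace ℝ E]
    [TopologicalSpace H] (I : ModelWithCorners ℝ E H)
    [NormedAddCommGroup E'] [NormedSpace ℝ E'] [TopologicalSpace H'] (J : ModelWithCorners ℝ E' H')
    (X S : Type*) [TopologicalSpace X] [ChartedSpace H X]
    [TopologicalSpace S] [ChartedSpace H' S] where
  proj : X → S
  hor : ∀ x : X, Submodule ℝ (TangentSpace I x)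
  metric : ∀ x : X, vertical I J proj x → vertical I J proj x → ℝ

namespace FamilyData

variable {E H E' H' X S : Type*} [NormedAddCommGroup E] [NormedSpace ℝ E]
    [TopologicalSpace H] {I : ModelWithCorners ℝ E H} [TopologicalSpace X] [ChartedSpace H X]
    [NormedAddCommGroup E'] [NormedSpace ℝ E'] [TopologicalSpace H'] {J : ModelWithCorners ℝ E' H'}
    [TopologicalSpace S] [ChartedSpace H' S] (D : FamilyData I J X S)

/-- The vertical tangent space `T(X/S)_x`. -/
noncomputable abbrev vert (x : X) : Submodule ℝ (TangentSpace I x) := vertical I J D.proj x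

open Classical in
/-- The projection `P` of `T_x X` onto `T(X/S)_x` with kernel `H_x`. -/
noncomputable def vertProj (x : X) : TangentSpace I x →ₗ[ℝ] D.vert x :=
  if h : IsCompl (D.vert x) (D.hor x) then Submodule.projectionOnto _ _ h else 0

/-- The projection of `T_x X` onto `H_x` with kernel `T(X/S)_x`. -/
noncomputable def horProj (x : X) : TangentSpace I x →ₗ[ℝ] TangentSpace I x :=
  LinearMap.id - (D.vert x).subtype ∘ₗ D.vertProj x

/-- The horizontal lift of a tangent vector of `S` to `H_x`. -/
noncomputable def horLift (x : X) (w : TangentSpace J (D.proj x)) : TangentSpace I x :=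
  (Function.invFun (fun h : D.hor x => mfderiv I J D.proj x (h : TangentSpace I x)) w : D.hor x)

/-- A horizontal vector field with value `horProj u` at `x₀`: the horizontal part of the vector
field that is constant with value `u` in the preferred chart at `x₀`. -/
noncomputable def horExtend (x₀ : X) (u : TangentSpace I x₀) (x : X) : TangentSpace I x :=
  D.horProj x ((mfderiv I 𝓘(ℝ, E) (extChartAt I x₀) x).inverse
    (mfderiv I 𝓘(ℝ, E) (extChartAt I x₀) x₀ u))

/-- The Frobenius tensor `T(η, ζ) = -P[η, ζ]` for horizontal vector fields `η`, `ζ`, extended by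
zero to vertical vectors. Only the values of `η` and `ζ` at the point matter, so that they may be
taken to be the fields `horExtend`. -/
noncomputable def frobenius (x : X) (u v : TangentSpace I x) : D.vert x :=
  -D.vertProj x (VectorField.mlieBracket I (D.horExtend x u) (D.horExtend x v) x)

/-- Orthonormal `n`-tuples of vertical vectors at `x`. -/
def IsOrthonormal {n : ℕ} (x : X) (e : Fin n → D.vert x) : Prop :=
  ∀ i j, D.metric x (e i) (e j) = if i = j then 1 else 0

/-- `ν` is a vertical Riemannian volume form (for one of the orientations of `T(X/S)`), regarded as
an `n`-form on `X` by means of the horizontal distribution. -/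
structure IsVolumeForm {n : ℕ} (ν : Form I X n) : Prop where
  smooth : Form.Smooth ν
  horizontal : ∀ (x : X) (v : Fin n → TangentSpace I x), (∃ i, v i ∈ D.hor x) → ν x v = 0
  orthonormal : ∀ (x : X) (e : Fin n → D.vert x), D.IsOrthonormal x e →
    ν x (fun i => (e i : TangentSpace I x)) = 1 ∨ ν x (fun i => (e i : TangentSpace I x)) = -1

/-- `k` is the mean curvature form: a section of `H^*`, regarded as a `1`-form on `X` which vanishes
on vertical vectors, such that `dν = k ∧ ν + ∑ᵢ ⟨T, eᵢ⟩ ∧ ι_{eᵢ} ν` for the vertical volume form `ν`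
and the orthonormal bases `(eᵢ)` of the vertical tangent spaces. -/
structure IsMeanCurvature {n : ℕ} (ν : Form I X n) (k : OneForm I X) : Prop where
  smooth : OneForm.Smooth k
  vertical : ∀ (x : X), ∀ v ∈ D.vert x, k x v = 0
  eqn : ∀ (x : X) (e : Fin n → D.vert x), D.IsOrthonormal x e →
    ∀ v : Fin (n + 1) → TangentSpace I x,
      Form.d ν x v = wedgeOne (k x) (ν x).toAlternatingMap v +
        ∑ i, wedgeTwoContract (fun u w => D.metric x (D.frobenius x u w) (e i))
          (e i : TangentSpace I x) (ν x).toAlternatingMap v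

/-- The `1`-form on `S` with values in the bundle of functions on the fibres, given by a `1`-form on
`X` that vanishes on vertical vectors: at `s`, it sends `w ∈ T_s S` to the function
`x ↦ α(horizontal lift of w to x)` on the fibre over `s`. -/
noncomputable def toBase (α : OneForm I X) (x : X) (w : TangentSpace J (D.proj x)) : ℝ :=
  α x (D.horLift x w)

/-- `D` is a geometric family with fibres diffeomorphic to `F`, of dimension `n`: a smooth fibre
bundle with compact even-dimensional fibres, with a smooth horizontal distribution and a smooth
metric on the vertical tangent bundle. -/
structure IsGeometricFamily [IsManifold I ∞ X] (n : ℕ) (F : Type*) [TopologicalSpace F]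
    [ChartedSpace (EuclideanSpace ℝ (Fin n)) F] : Prop where
  compact_fibre : CompactSpace F
  even : Even n
  contMDiff_proj : ContMDiff I J ∞ D.proj
  /-- Local triviality: `x ↦ (π x, fib x)` is a diffeomorphism `π⁻¹(U) ≃ U × F` with inverse
  `inv`. -/
  locally_trivial : ∀ s : S, ∃ (U : Set S) (fib : X → F) (inv : S × F → X), IsOpen U ∧ s ∈ U ∧
    ContMDiffOn I (𝓡 n) ∞ fib (D.proj ⁻¹' U) ∧
    ContMDiffOn (J.prod (𝓡 n)) I ∞ inv (U ×ˢ Set.univ) ∧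
    (∀ s' ∈ U, ∀ f : F, D.proj (inv (s', f)) = s' ∧ fib (inv (s', f)) = f) ∧
    (∀ x ∈ D.proj ⁻¹' U, inv (D.proj x, fib x) = x)
  hor_bijective : ∀ x : X,
    Function.Bijective (fun h : D.hor x => mfderiv I J D.proj x (h : TangentSpace I x))
  /-- Smoothness of the horizontal distribution: the vertical part of a smooth vector field is
  smooth. -/
  smooth_hor : ∀ (x₀ : X) (V : ∀ x : X, TangentSpace I x),
    ContMDiffAt I I.tangent ∞ (fun x => (⟨x, V x⟩ : TangentBundle I X)) x₀ →
    ContMDiffAt I I.tangent ∞ (fun x => (⟨x, D.vertProj x (V x)⟩ : TangentBundle I X)) x₀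
  metric_add : ∀ (x : X) (u v w : D.vert x),
    D.metric x (u + v) w = D.metric x u w + D.metric x v w
  metric_smul : ∀ (x : X) (c : ℝ) (u v : D.vert x), D.metric x (c • u) v = c * D.metric x u v
  metric_symm : ∀ (x : X) (u v : D.vert x), D.metric x u v = D.metric x v u
  metric_pos : ∀ (x : X) (u : D.vert x), u ≠ 0 → 0 < D.metric x u u
  /-- Smoothness of the metric: the pairing of the vertical parts of smooth vector fields is
  smooth. -/
  smooth_metric : ∀ (x₀ : X) (V W : ∀ x : X, TangentSpace I x),
    ContMDiffAt I I.tangent ∞ (fun x => (⟨x, V x⟩ : TangentBundle I X)) x₀ →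
    ContMDiffAt I I.tangent ∞ (fun x => (⟨x, W x⟩ : TangentBundle I X)) x₀ →
    ContMDiffAt I 𝓘(ℝ, ℝ) ∞ (fun x => D.metric x (D.vertProj x (V x)) (D.vertProj x (W x))) x₀

variable (G : Type*) [Group G] [MulAction G X] [MulAction G S]

/-- The actions of `G` on `X` and `S` preserve the data. -/
structure IsInvariant : Prop where
  proj_smul : ∀ (g : G) (x : X), D.proj (g • x) = g • D.proj x
  hor_smul : ∀ (g : G) (x : X),
    (D.hor x).map (mfderiv I I (fun x => g • x) x).toLinearMap = D.hor (g • x)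
  metric_smul : ∀ (g : G) (x : X) (u v : D.vert x) (u' v' : D.vert (g • x)),
    (u' : TangentSpace I (g • x)) = mfderiv I I (fun x => g • x) x u →
    (v' : TangentSpace I (g • x)) = mfderiv I I (fun x => g • x) x v →
    D.metric (g • x) u' v' = D.metric x u v

end FamilyData

end Family

/-- The action of `G` on `X` preserves the form `ν`. -/
def Form.IsInvariant {E H X : Type*} [NormedAddCommGroup E] [NormedSpace ℝ E] [TopologicalSpace H]
    {I : ModelWithCorners ℝ E H} [TopologicalSpace X] [ChartedSpace H X] (G : Type*) [Group G]
    [MulAction G X] {n : ℕ} (ν : Form I X n) : Prop :=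
  ∀ (g : G) (x : X) (v : Fin n → TangentSpace I x),
    ν (g • x) (fun i => mfderiv I I (fun x => g • x) x (v i)) = ν x v

/-! ### Connections and the associated family -/

namespace PrincipalBundle

variable {EG EQ EM G Q M : Type*}
    [NormedAddCommGroup EG] [NormedSpace ℝ EG] [NormedAddCommGroup EQ] [NormedSpace ℝ EQ]
    [NormedAddCommGroup EM] [NormedSpace ℝ EM]
    [Group G] [TopologicalSpace G] [ChartedSpace EG G]
    [TopologicalSpace Q] [ChartedSpace EQ Q] [TopologicalSpace M] [ChartedSpace EM M]
    [MulAction Gᵐᵒᵖ Q] (P : PrincipalBundle EG EQ EM G Q M)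

/-- A connection on `Q → M`, given by its connection form `Φ ∈ Ω¹(Q; 𝔤)`. -/
structure Connection (P : PrincipalBundle EG EQ EM G Q M) where
  form : ∀ q : Q, TangentSpace 𝓘(ℝ, EQ) q →L[ℝ] GroupLieAlgebra 𝓘(ℝ, EG) G
  smooth : ∀ l : GroupLieAlgebra 𝓘(ℝ, EG) G →L[ℝ] ℝ,
    OneForm.Smooth (fun q : Q => l.comp (form q))
  /-- `Φ` sends the vector field generated by `v ∈ 𝔤` to `v`. -/
  form_generator : ∀ (q : Q) (v : GroupLieAlgebra 𝓘(ℝ, EG) G),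
    form q (mfderiv 𝓘(ℝ, EG) 𝓘(ℝ, EQ) (fun g : G => op g • q) 1 v : EQ) = v
  /-- `R_g^* Φ = Ad(g⁻¹) Φ`. -/
  equivariant : ∀ (g : G) (q : Q) (u : TangentSpace 𝓘(ℝ, EQ) q),
    form (op g • q) (mfderiv 𝓘(ℝ, EQ) 𝓘(ℝ, EQ) (fun q => op g • q) q u) =
      (mfderiv 𝓘(ℝ, EG) 𝓘(ℝ, EG) (fun h : G => g⁻¹ * h * g) 1 (form q u) : EG)

/-- The horizontal distribution `V = ker Φ` of a connection. -/
noncomputable def Connection.hor {P : PrincipalBundle EG EQ EM G Q M} (Φ : P.Connection) (q : Q) :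
    Submodule ℝ (TangentSpace 𝓘(ℝ, EQ) q) :=
  LinearMap.ker (Φ.form q).toLinearMap

/-- The tangent vector at `z = (q, y)` of the vector field on `Q × Y` generated by `v ∈ 𝔤` through
the action `(q, y) · g = (q g, g⁻¹ y)`. -/
noncomputable def generator (EQ : Type*) [NormedAddCommGroup EQ] [NormedSpace ℝ EQ]
    [ChartedSpace EQ Q] {EY Y : Type*} [NormedAddCommGroup EY] [NormedSpace ℝ EY]
    [TopologicalSpace Y] [ChartedSpace EY Y] [MulAction G Y]
    (v : GroupLieAlgebra 𝓘(ℝ, EG) G) (z : Q × Y) : TangentSpace (𝓘(ℝ, EQ).prod 𝓘(ℝ, EY)) z :=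
  (mfderiv 𝓘(ℝ, EG) (𝓘(ℝ, EQ).prod 𝓘(ℝ, EY)) (fun g : G => ((op g • z.1, g⁻¹ • z.2) : Q × Y)) 1 v :
    EQ × EY)

/-- The value at `z` of `α - φᵃ ι_a α` for a `1`-form `α` on `Q × Y`, where `Φ = φᵃ e_a` in a basis
`(e_a)` of `𝔤` and `ι_a` is the contraction with the vector field generated by `e_a`. -/
noncomputable def Connection.subContract {P : PrincipalBundle EG EQ EM G Q M} (Φ : P.Connection)
    {ι : Type*} [Fintype ι] (e : Module.Basis ι ℝ (GroupLieAlgebra 𝓘(ℝ, EG) G))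
    {EY Y : Type*} [NormedAddCommGroup EY] [NormedSpace ℝ EY]
    [TopologicalSpace Y] [ChartedSpace EY Y] [MulAction G Y] (z : Q × Y)
    (α : TangentSpace (𝓘(ℝ, EQ).prod 𝓘(ℝ, EY)) z → ℝ)
    (w : TangentSpace (𝓘(ℝ, EQ).prod 𝓘(ℝ, EY)) z) : ℝ :=
  α w - ∑ a, e.coord a (Φ.form z.1
    (mfderiv (𝓘(ℝ, EQ).prod 𝓘(ℝ, EY)) 𝓘(ℝ, EQ) Prod.fst z w)) * α (generator EQ (e a) z)

section

variable {EX ES X S : Type*} [NormedAddCommGroup EX] [NormedSpace ℝ EX]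
    [NormedAddCommGroup ES] [NormedSpace ℝ ES]
    [TopologicalSpace X] [ChartedSpace EX X] [TopologicalSpace S] [ChartedSpace ES S]
    [MulAction G X] [ContinuousSMul G X] [MulAction G S] [ContinuousSMul G S]

/-- The differential at `z` of the quotient map `Q × Y → Y_Q`. -/
noncomputable def assocDeriv {EY Y : Type*} [NormedAddCommGroup EY] [NormedSpace ℝ EY]
    [TopologicalSpace Y] [ChartedSpace EY Y] [MulAction G Y] [ContinuousSMul G Y] (z : Q × Y) :
    TangentSpace (𝓘(ℝ, EQ).prod 𝓘(ℝ, EY)) z →L[ℝ]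
      TangentSpace (𝓘(ℝ, EM).prod 𝓘(ℝ, EY)) (P.assocMk z) :=
  mfderiv (𝓘(ℝ, EQ).prod 𝓘(ℝ, EY)) (𝓘(ℝ, EM).prod 𝓘(ℝ, EY)) P.assocMk z

/-- A `1`-form `β` on `Q × S` with values in the functions on the fibres of `π : X → S` (at `(q, s)`
it sends a tangent vector `w` to the function `x ↦ β (q, x) w` on the fibre over `s`) is basic if it
is horizontal, i.e. annihilated by the vector fields generated by `𝔤`, and `G`-invariant. -/
structure IsBasic (EG : Type*) [NormedAddCommGroup EG] [NormedSpace ℝ EG] [ChartedSpace EG G]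
    (π : X → S) (β : ∀ z : Q × X,
      TangentSpace (𝓘(ℝ, EQ).prod 𝓘(ℝ, ES)) ((z.1, π z.2) : Q × S) → ℝ) : Prop where
  horizontal : ∀ (z : Q × X) (v : GroupLieAlgebra 𝓘(ℝ, EG) G),
    β z (generator EQ v ((z.1, π z.2) : Q × S)) = 0
  invariant : ∀ (z : Q × X) (g : G) (w : EQ × ES),
    β (op g • z.1, g⁻¹ • z.2) (mfderiv (𝓘(ℝ, EQ).prod 𝓘(ℝ, ES)) (𝓘(ℝ, EQ).prod 𝓘(ℝ, ES))
      (fun p : Q × S => ((op g • p.1, g⁻¹ • p.2) : Q × S)) (z.1, π z.2) w : EQ × ES) = β z w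

variable {P}

/-- The data `(π_Q : X_Q → S_Q, H_Q, g_Q^{X/S})` of the associated family: `H_Q` is the image of
`V ⊕ H` in the tangent bundle of `X_Q`, and `g_Q` is the metric to which the pullback of `g` to
`Q × X` descends. By `G`-invariance these do not depend on the representatives in `Q × X`. -/
noncomputable def assocFamily (Φ : P.Connection) (D : FamilyData 𝓘(ℝ, EX) 𝓘(ℝ, ES) X S)
    (hD : D.IsInvariant G) :
    FamilyData (𝓘(ℝ, EM).prod 𝓘(ℝ, EX)) (𝓘(ℝ, EM).prod 𝓘(ℝ, ES)) (P.Assoc X) (P.Assoc S) where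
  proj := P.assocMap D.proj hD.proj_smul
  hor y := Submodule.map (P.assocDeriv (P.assocOut y)).toLinearMap
    ((Φ.hor (P.assocOut y).1).prod (D.hor (P.assocOut y).2))
  metric y u v :=
    let pre : EM × EX → D.vert (P.assocOut y).2 := Function.invFun
      fun w => P.assocDeriv (P.assocOut y) ((0, w.1) : EQ × EX)
    D.metric (P.assocOut y).2 (pre u.1) (pre v.1)

end

end PrincipalBundle

end Families

/-! Inserting one arbitrary vector h and an orthonormal vertical frame e₁, …, eₙ into the defining
equation of k leaves dν(h, e₁, …, eₙ) = k(h) ν(e₁, …, eₙ): any two distinct slots contain a vertical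
vector, and the Frobenius tensor kills those (`IsMeanCurvature.d_cons`). So k_Q is known once dν_Q
is known on such tuples.

The differential of q_X restricts to a bijection from ker Φ ⊕ TX onto the tangent space of X_Q. It
carries V ⊕ H to H_Q and T(X/S) isometrically to the vertical space of X_Q. Hence q_X^*ν_Q = ±ν on
tuples whose Q-components lie in ker Φ (`exists_sign_volumeForm`), and the sign is locally constant.

The crux (`meanCurvature_assocT`) is to pass from this partial equality to d on a tuple (a, h), (0,
e₁), …, (0, eₙ) with Φ(a) = 0. With vectors extended as constants in a product chart, d is an
alternating sum of directional derivatives (`extDeriv_prod_apply`). The derivative along (a, h) acts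
on the value at the vectors (0, eᵢ), where the two forms agree at all nearby points. The derivative
along (0, eⱼ) stays in the slice {q} × X, on which the constant vector a remains in ker Φ. So a
needs no horizontal extension, the curvature of Φ never enters, and k_Q(q_*(a, h)) = k(h).

For arbitrary (a, v), subtract the generator of Φ(a), which q_X kills: this turns k(h) into k - φᵃ
ι_a k. On the base, the horizontal lift of q_{S*}(a, s) with Φ(a) = 0 is q_{X*}(a, lift of s). The
resulting form is basic because it is pulled back from S_Q.

That T kills vertical vectors has to be proved, as `frobenius` is a bracket of the fields
`horExtend`. For vertical e this field is horizontal and vanishes at the point, so its derivative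
there is horizontal (`frobeniusVanishes_of_smooth`). In a chart of X_Q it is the corresponding field
of X with zero M-component (`assocFamily_frobeniusVanishes`). -/

set_option linter.unusedSectionVars false

namespace Families

namespace PrincipalBundle

/-! ### Smoothness of the quotient map and of its trivializations -/

section AssocManifold

variable {EG EQ EM G Q M : Type*}
    [NormedAddCommGroup EG] [NormedSpace ℝ EG] [NormedAddCommGroup EQ] [NormedSpace ℝ EQ]
    [NormedAddCommGroup EM] [NormedSpace ℝ EM]
    [Group G] [TopologicalSpace G] [ChartedSpace EG G]
    [TopologicalSpace Q] [ChartedSpace EQ Q] [TopologicalSpace M] [ChartedSpace EM M]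
    [MulAction Gᵐᵒᵖ Q] (P : PrincipalBundle EG EQ EM G Q M)
    {Y EY : Type*} [MulAction G Y] [TopologicalSpace Y] [ContinuousSMul G Y]
    [NormedAddCommGroup EY] [NormedSpace ℝ EY] [ChartedSpace EY Y]

/-- The local trivialization used by the preferred chart of `Y_Q` at `y₀`. -/
noncomputable def trivAt (y₀ : P.Assoc Y) : LocalTriv EG EQ EM G P.proj :=
  (P.locally_trivial (P.assocBase y₀)).choose

theorem assocBase_mem_trivAt (y₀ : P.Assoc Y) : P.assocBase y₀ ∈ (P.trivAt y₀).base :=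
  (P.locally_trivial (P.assocBase y₀)).choose_spec

theorem extChartAt_assoc_apply (y₀ y : P.Assoc Y) :
    extChartAt (𝓘(ℝ, EM).prod 𝓘(ℝ, EY)) y₀ y =
      extChartAt (𝓘(ℝ, EM).prod 𝓘(ℝ, EY)) (assocFun (P.trivAt y₀) y₀)
        (assocFun (P.trivAt y₀) y) := rfl

theorem extChartAt_assoc_symm_apply (y₀ : P.Assoc Y) (p : EM × EY) :
    (extChartAt (𝓘(ℝ, EM).prod 𝓘(ℝ, EY)) y₀).symm p =
      P.assocMk ((P.trivAt y₀).sec ((extChartAt 𝓘(ℝ, EM) (P.assocBase y₀)).symm p.1),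
        (extChartAt 𝓘(ℝ, EY) (assocFun (P.trivAt y₀) y₀).2).symm p.2) := by
  have h : (assocFun (P.trivAt y₀) y₀).1 = P.assocBase y₀ := by
    conv_rhs => rw [← P.assocMk_out y₀]
    rfl
  rw [← h]
  rfl

/-- This map is `assocMk` followed by the trivialization, so its smoothness is that of the quotient
map. -/
theorem contMDiffAt_localTriv [ContMDiffSMul 𝓘(ℝ, EG) 𝓘(ℝ, EY) ∞ G Y]
    (t : LocalTriv EG EQ EM G P.proj) {z : Q × Y} (hz : P.proj z.1 ∈ t.base) :
    ContMDiffAt (𝓘(ℝ, EQ).prod 𝓘(ℝ, EY)) (𝓘(ℝ, EM).prod 𝓘(ℝ, EY)) ∞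
      (fun z : Q × Y => (P.proj z.1, t.fib z.1 • z.2)) z := by
  refine (P.contMDiff_proj.contMDiffAt.comp z contMDiffAt_fst).prodMk ?_
  have hf : ContMDiffAt (𝓘(ℝ, EQ).prod 𝓘(ℝ, EY)) 𝓘(ℝ, EG) ∞ (fun z : Q × Y => t.fib z.1) z :=
    (t.smooth_fib.contMDiffAt
      ((t.isOpen_base.preimage P.contMDiff_proj.continuous).mem_nhds hz)).comp z contMDiffAt_fst
  exact (contMDiff_smul (I := 𝓘(ℝ, EG)) (I' := 𝓘(ℝ, EY)) (n := ∞)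
      (G := G) (M := Y)).contMDiffAt.comp z (hf.prodMk contMDiffAt_snd)

theorem eventually_assocBase_mem_trivAt (y₀ : P.Assoc Y) :
    ∀ᶠ y in 𝓝 y₀, P.assocBase y ∈ (P.trivAt y₀).base :=
  ((P.trivAt y₀).isOpen_base.preimage P.continuous_assocBase).mem_nhds (P.assocBase_mem_trivAt y₀)

variable [IsManifold 𝓘(ℝ, EM) ∞ M] [IsManifold 𝓘(ℝ, EY) ∞ Y]
    [ContMDiffSMul 𝓘(ℝ, EG) 𝓘(ℝ, EY) ∞ G Y]

/-- The quotient map `Q × Y → Y_Q` is smooth. -/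
theorem contMDiff_assocMk :
    ContMDiff (𝓘(ℝ, EQ).prod 𝓘(ℝ, EY)) (𝓘(ℝ, EM).prod 𝓘(ℝ, EY)) ∞ (P.assocMk (Y := Y)) := by
  intro z
  have hz : P.proj z.1 ∈ (P.trivAt (P.assocMk z)).base := P.assocBase_mem_trivAt (P.assocMk z)
  rw [contMDiffAt_iff_target]
  refine ⟨P.isQuotientMap_assocMk.continuous.continuousAt, ?_⟩
  have h1 := (contMDiffAt_extChartAt (I := 𝓘(ℝ, EM).prod 𝓘(ℝ, EY)) (n := ∞)
    (x := assocFun (P.trivAt (P.assocMk z)) (P.assocMk z)))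
  have h2 := P.contMDiffAt_localTriv (EY := EY) (Y := Y) (P.trivAt (P.assocMk z)) hz
  rw [assocFun_mk _ _ hz] at h1
  refine (h1.comp z h2).congr_of_eventuallyEq ?_
  filter_upwards [P.isQuotientMap_assocMk.continuous.continuousAt.eventually
    (P.eventually_assocBase_mem_trivAt (P.assocMk z))] with w hw
  simp only [Function.comp_apply, extChartAt_assoc_apply]
  rw [assocFun_mk _ _ hw, assocFun_mk _ _ hz]

/-- The chart of Y_Q at y₀ is by definition `assocFun` followed by a chart of M × Y, so after
composition with that chart the claim is the smoothness of a chart of Y_Q. -/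
theorem contMDiffAt_assocFun (y₀ : P.Assoc Y) :
    ContMDiffAt (𝓘(ℝ, EM).prod 𝓘(ℝ, EY)) (𝓘(ℝ, EM).prod 𝓘(ℝ, EY)) ∞
      (assocFun (P.trivAt y₀) (Y := Y)) y₀ := by
  have hc : ContinuousAt (assocFun (P.trivAt y₀) (Y := Y)) y₀ :=
    (assocHomeo (P.trivAt y₀) Y).continuousAt (P.assocBase_mem_trivAt y₀)
  rw [contMDiffAt_iff_target]
  exact ⟨hc, contMDiffAt_extChartAt⟩

/-- A local section of `Q × Y → Y_Q` near `y₀`. -/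
noncomputable def assocSec (y₀ y : P.Assoc Y) : Q × Y :=
  ((P.trivAt y₀).sec (assocFun (P.trivAt y₀) y).1, (assocFun (P.trivAt y₀) y).2)

end AssocManifold
end PrincipalBundle

/-! ### Differentials as linear maps between fixed model spaces -/

section TangentMap

variable {E H X E' H' X' E'' H'' X'' : Type*}
    [NormedAddCommGroup E] [NormedSpace ℝ E] [TopologicalSpace H] {I : ModelWithCorners ℝ E H}
    [TopologicalSpace X] [ChartedSpace H X]
    [NormedAddCommGroup E'] [NormedSpace ℝ E'] [TopologicalSpace H'] {I' : ModelWithCorners ℝ E' H'}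
    [TopologicalSpace X'] [ChartedSpace H' X']
    [NormedAddCommGroup E''] [NormedSpace ℝ E''] [TopologicalSpace H'']
    {I'' : ModelWithCorners ℝ E'' H''} [TopologicalSpace X''] [ChartedSpace H'' X'']

variable (I I') in
/-- The differential of `f` at `x` as a map between the model spaces. -/
noncomputable def tmap (f : X → X') (x : X) : E →L[ℝ] E' := mfderiv I I' f x

theorem tmap_comp {g : X' → X''} {f : X → X'} {x : X} (hg : MDifferentiableAt I' I'' g (f x))
    (hf : MDifferentiableAt I I' f x) :
    tmap I I'' (fun y => g (f y)) x = (tmap I' I'' g (f x)).comp (tmap I I' f x) :=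
  mfderiv_comp x hg hf

theorem tmap_congr {f g : X → X'} {x : X} (h : f =ᶠ[𝓝 x] g) : tmap I I' f x = tmap I I' g x :=
  h.mfderiv_eq

theorem tmap_id (x : X) : tmap I I (fun y => y) x = ContinuousLinearMap.id ℝ E := mfderiv_id

theorem mdifferentiableAt_self (x : X) : MDifferentiableAt I I (fun y : X => y) x :=
  mdifferentiableAt_id

theorem tmap_const (x : X) (c : X') : tmap I I' (fun _ => c) x = 0 := mfderiv_const

theorem tmap_prodMk {f : X → X'} {g : X → X''} {x : X} (hf : MDifferentiableAt I I' f x)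
    (hg : MDifferentiableAt I I'' g x) :
    tmap I (I'.prod I'') (fun y => (f y, g y)) x = (tmap I I' f x).prod (tmap I I'' g x) :=
  mfderiv_prodMk hf hg

theorem tmap_fst (z : X × X') :
    tmap (I.prod I') I (fun p => p.1) z = ContinuousLinearMap.fst ℝ E E' := mfderiv_fst

theorem tmap_snd (z : X × X') :
    tmap (I.prod I') I' (fun p => p.2) z = ContinuousLinearMap.snd ℝ E E' := mfderiv_snd

end TangentMap

/-! ### Translations and orbit maps of a smooth action -/

section SmoothAction

variable {EG G EY Y : Type*} [NormedAddCommGroup EG] [NormedSpace ℝ EG]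
    [Group G] [TopologicalSpace G] [ChartedSpace EG G]
    [MulAction G Y] [TopologicalSpace Y] [NormedAddCommGroup EY] [NormedSpace ℝ EY]
    [ChartedSpace EY Y] [ContMDiffSMul 𝓘(ℝ, EG) 𝓘(ℝ, EY) ∞ G Y]

theorem contMDiff_const_smul_right (EG : Type*) [NormedAddCommGroup EG] [NormedSpace ℝ EG]
    [ChartedSpace EG G] [ContMDiffSMul 𝓘(ℝ, EG) 𝓘(ℝ, EY) ∞ G Y] (g : G) :
    ContMDiff 𝓘(ℝ, EY) 𝓘(ℝ, EY) ∞ (fun y : Y => g • y) :=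
  (contMDiff_smul (I := 𝓘(ℝ, EG)) (I' := 𝓘(ℝ, EY)) (n := ∞) (G := G) (M := Y)).comp
    (contMDiff_const.prodMk contMDiff_id)

theorem contMDiff_inv_smul [LieGroup 𝓘(ℝ, EG) ∞ G] (y : Y) :
    ContMDiff 𝓘(ℝ, EG) 𝓘(ℝ, EY) ∞ (fun g : G => g⁻¹ • y) :=
  (contMDiff_smul (I := 𝓘(ℝ, EG)) (I' := 𝓘(ℝ, EY)) (n := ∞) (G := G) (M := Y)).comp
    ((contMDiff_inv 𝓘(ℝ, EG) ∞).prodMk contMDiff_const)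

/-- Translations act by isomorphisms on tangent spaces. -/
theorem tmap_smul_inv_smul (EG : Type*) [NormedAddCommGroup EG] [NormedSpace ℝ EG]
    [ChartedSpace EG G] [ContMDiffSMul 𝓘(ℝ, EG) 𝓘(ℝ, EY) ∞ G Y] (g : G) (y : Y) :
    (tmap 𝓘(ℝ, EY) 𝓘(ℝ, EY) (fun y : Y => g⁻¹ • y) (g • y)).comp
      (tmap 𝓘(ℝ, EY) 𝓘(ℝ, EY) (fun y : Y => g • y) y) = ContinuousLinearMap.id ℝ EY := by
  rw [← tmap_comp ((contMDiff_const_smul_right EG g⁻¹).mdifferentiable (by simp) _)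
    ((contMDiff_const_smul_right EG g).mdifferentiable (by simp) _)]
  simp [tmap_id]

end SmoothAction

namespace PrincipalBundle

/-! ### Kernel and image of the differential of Q × Y → Y_Q -/

section AssocDeriv

variable {EG EQ EM G Q M : Type*}
    [NormedAddCommGroup EG] [NormedSpace ℝ EG] [NormedAddCommGroup EQ] [NormedSpace ℝ EQ]
    [NormedAddCommGroup EM] [NormedSpace ℝ EM]
    [Group G] [TopologicalSpace G] [ChartedSpace EG G]
    [TopologicalSpace Q] [ChartedSpace EQ Q] [TopologicalSpace M] [ChartedSpace EM M]
    [IsManifold 𝓘(ℝ, EQ) ∞ Q] [IsManifold 𝓘(ℝ, EM) ∞ M]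
    [MulAction Gᵐᵒᵖ Q] (P : PrincipalBundle EG EQ EM G Q M)

theorem contMDiff_act_const (P : PrincipalBundle EG EQ EM G Q M) (g : G) :
    ContMDiff 𝓘(ℝ, EQ) 𝓘(ℝ, EQ) ∞ (fun q : Q => op g • q) :=
  P.contMDiff_act.comp (contMDiff_id.prodMk contMDiff_const)

theorem contMDiff_orbit (P : PrincipalBundle EG EQ EM G Q M) (q : Q) :
    ContMDiff 𝓘(ℝ, EG) 𝓘(ℝ, EQ) ∞ (fun g : G => op g • q) :=
  P.contMDiff_act.comp (contMDiff_const.prodMk contMDiff_id)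

/-- A vector of `Q` in the kernel of `Q → M` is the value of a generator. -/
theorem exists_tmap_orbit_eq [LieGroup 𝓘(ℝ, EG) ∞ G] (q : Q) (a : EQ)
    (ha : tmap 𝓘(ℝ, EQ) 𝓘(ℝ, EM) P.proj q a = 0) :
    ∃ v : EG, a = tmap 𝓘(ℝ, EG) 𝓘(ℝ, EQ) (fun g : G => op g • q) 1 v := by
  obtain ⟨t, ht⟩ := P.locally_trivial (P.proj q)
  have hU : P.proj ⁻¹' t.base ∈ 𝓝 q :=
    (t.isOpen_base.preimage P.contMDiff_proj.continuous).mem_nhds ht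
  have hf : MDifferentiableAt 𝓘(ℝ, EQ) 𝓘(ℝ, EG) t.fib q :=
    (t.smooth_fib.contMDiffAt hU).mdifferentiableAt (by simp)
  have hs : MDifferentiableAt 𝓘(ℝ, EM) 𝓘(ℝ, EQ) t.sec (P.proj q) :=
    (t.smooth_sec.contMDiffAt (t.isOpen_base.mem_nhds ht)).mdifferentiableAt (by simp)
  have hp : MDifferentiableAt 𝓘(ℝ, EQ) 𝓘(ℝ, EM) P.proj q :=
    P.contMDiff_proj.mdifferentiable (by simp) q
  have hA : MDifferentiable (𝓘(ℝ, EQ).prod 𝓘(ℝ, EG)) 𝓘(ℝ, EQ)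
    (fun p : Q × G => op p.2 • p.1) := P.contMDiff_act.mdifferentiable (by simp)
  have hsp : MDifferentiableAt 𝓘(ℝ, EQ) 𝓘(ℝ, EQ) (fun q => t.sec (P.proj q)) q := hs.comp q hp
  -- Differentiate q = sec (proj q) · fib q in the direction a: the contribution of sec vanishes
  -- because a is killed by the differential of proj, and only motion along the orbit remains.
  have h1 := tmap_comp (f := fun q => (t.sec (P.proj q), t.fib q)) (hA _) (hsp.prodMk hf)
  have h2 : (fun q => op (t.fib q) • t.sec (P.proj q)) =ᶠ[𝓝 q] fun q => q := by
    filter_upwards [hU] with q' hq'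
    exact t.left_inv q' hq'
  rw [tmap_congr h2, tmap_id, tmap_prodMk hsp hf, tmap_comp hs hp] at h1
  have h3 := DFunLike.congr_fun h1 a
  simp only [ContinuousLinearMap.coe_id', id_eq, ContinuousLinearMap.coe_comp,
    Function.comp_apply, ContinuousLinearMap.prod_apply, ha, map_zero] at h3
  -- the derivative along `G` at `fib q` is the derivative of the orbit map at `1`
  have hL : MDifferentiable 𝓘(ℝ, EG) 𝓘(ℝ, EG) (fun g : G => (t.fib q)⁻¹ * g) :=
    (contMDiff_mul_left (I := 𝓘(ℝ, EG)) (n := ∞) (a := (t.fib q)⁻¹)).mdifferentiable (by simp)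
  have hO : MDifferentiable 𝓘(ℝ, EG) 𝓘(ℝ, EQ) (fun g : G => op g • q) :=
    (P.contMDiff_orbit q).mdifferentiable (by simp)
  have h5 := tmap_comp (f := fun g : G => (t.fib q)⁻¹ * g) (x := t.fib q) (hO _) (hL _)
  have h6 := tmap_comp (g := fun p : Q × G => op p.2 • p.1)
    (f := fun g : G => (t.sec (P.proj q), g)) (x := t.fib q) (hA _)
    (mdifferentiableAt_const.prodMk (mdifferentiableAt_self _))
  have h7 : (fun g : G => op g • t.sec (P.proj q)) =
      fun g : G => op ((t.fib q)⁻¹ * g) • q := by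
    funext g
    have := t.left_inv q ht
    generalize t.fib q = c at this ⊢
    generalize t.sec (P.proj q) = r at this ⊢
    rw [← this, smul_smul, ← op_mul]
    simp
  rw [tmap_prodMk mdifferentiableAt_const (mdifferentiableAt_self _), tmap_const, tmap_id] at h6
  simp only at h6
  rw [h7, h5, inv_mul_cancel] at h6
  have h8 := DFunLike.congr_fun h6 (tmap 𝓘(ℝ, EQ) 𝓘(ℝ, EG) t.fib q a)
  exact ⟨_, h3.trans h8.symm⟩

variable {Y EY : Type*} [MulAction G Y] [TopologicalSpace Y] [ContinuousSMul G Y]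
    [NormedAddCommGroup EY] [NormedSpace ℝ EY] [ChartedSpace EY Y]
    [IsManifold 𝓘(ℝ, EY) ∞ Y] [ContMDiffSMul 𝓘(ℝ, EG) 𝓘(ℝ, EY) ∞ G Y]

theorem assocMk_assocSec (y₀ : P.Assoc Y) {y : P.Assoc Y}
    (hy : P.assocBase y ∈ (P.trivAt y₀).base) : P.assocMk (P.assocSec y₀ y) = y :=
  (assocHomeo (P.trivAt y₀) Y).left_inv hy

theorem contMDiffAt_assocSec (y₀ : P.Assoc Y) :
    ContMDiffAt (𝓘(ℝ, EM).prod 𝓘(ℝ, EY)) (𝓘(ℝ, EQ).prod 𝓘(ℝ, EY)) ∞ (P.assocSec y₀) y₀ := by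
  have h := P.contMDiffAt_assocFun (EY := EY) y₀
  have hb : (assocFun (P.trivAt y₀) y₀).1 ∈ (P.trivAt y₀).base :=
    ((assocHomeo (P.trivAt y₀) Y).map_source (P.assocBase_mem_trivAt y₀)).1
  exact (((P.trivAt y₀).smooth_sec.contMDiffAt
    ((P.trivAt y₀).isOpen_base.mem_nhds hb)).comp y₀ (contMDiffAt_fst.comp y₀ h)).prodMk
      (contMDiffAt_snd.comp y₀ h)

theorem mdifferentiableAt_assocMk (z : Q × Y) :
    MDifferentiableAt (𝓘(ℝ, EQ).prod 𝓘(ℝ, EY)) (𝓘(ℝ, EM).prod 𝓘(ℝ, EY)) P.assocMk z :=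
  (P.contMDiff_assocMk z).mdifferentiableAt (by simp)

/-- The differential of `Q × Y → Y_Q`, as a map between the model spaces. -/
noncomputable def assocT (z : Q × Y) : EQ × EY →L[ℝ] EM × EY :=
  tmap (𝓘(ℝ, EQ).prod 𝓘(ℝ, EY)) (𝓘(ℝ, EM).prod 𝓘(ℝ, EY)) P.assocMk z

theorem assocMk_act (g : G) (z : Q × Y) : P.assocMk (op g • z.1, g⁻¹ • z.2) = P.assocMk z :=
  (P.assocMk_eq.2 ⟨g, rfl⟩).symm

theorem mdifferentiableAt_act (P : PrincipalBundle EG EQ EM G Q M) (g : G) (z : Q × Y) :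
    MDifferentiableAt (𝓘(ℝ, EQ).prod 𝓘(ℝ, EY)) 𝓘(ℝ, EQ) (fun p : Q × Y => op g • p.1) z :=
  ((P.contMDiff_act_const g).mdifferentiable (by simp) _).comp z mdifferentiableAt_fst

theorem mdifferentiableAt_smul_snd (EG : Type*) [NormedAddCommGroup EG] [NormedSpace ℝ EG]
    [ChartedSpace EG G] [ContMDiffSMul 𝓘(ℝ, EG) 𝓘(ℝ, EY) ∞ G Y] (Q : Type*) [TopologicalSpace Q]
        [ChartedSpace EQ Q] (g : G) (z : Q × Y) :
    MDifferentiableAt (𝓘(ℝ, EQ).prod 𝓘(ℝ, EY)) 𝓘(ℝ, EY) (fun p : Q × Y => g • p.2) z :=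
  ((contMDiff_const_smul_right EG g).mdifferentiable (by simp) _).comp z mdifferentiableAt_snd

/-- The differential of the right translation by `g` on `Q × Y`. -/
theorem tmap_act (P : PrincipalBundle EG EQ EM G Q M) (g : G) (z : Q × Y) :
    tmap (𝓘(ℝ, EQ).prod 𝓘(ℝ, EY)) (𝓘(ℝ, EQ).prod 𝓘(ℝ, EY))
      (fun p : Q × Y => ((op g • p.1, g⁻¹ • p.2) : Q × Y)) z =
      (tmap 𝓘(ℝ, EQ) 𝓘(ℝ, EQ) (fun q : Q => op g • q) z.1).prodMap
        (tmap 𝓘(ℝ, EY) 𝓘(ℝ, EY) (fun y : Y => g⁻¹ • y) z.2) := by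
  rw [tmap_prodMk (P.mdifferentiableAt_act g z) (mdifferentiableAt_smul_snd EG Q g⁻¹ z),
    tmap_comp (g := fun q : Q => op g • q) ((P.contMDiff_act_const g).mdifferentiable (by simp) _)
      mdifferentiableAt_fst,
    tmap_comp (g := fun y : Y => g⁻¹ • y)
      ((contMDiff_const_smul_right EG g⁻¹).mdifferentiable (by simp) _)
      mdifferentiableAt_snd, tmap_fst, tmap_snd]
  rfl

/-- Differentiate [q g, g⁻¹ y] = [q, y] in (q, y). -/
theorem assocT_act (g : G) (z : Q × Y) (w : EQ × EY) :
    P.assocT (op g • z.1, g⁻¹ • z.2)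
      (tmap 𝓘(ℝ, EQ) 𝓘(ℝ, EQ) (fun q : Q => op g • q) z.1 w.1,
        tmap 𝓘(ℝ, EY) 𝓘(ℝ, EY) (fun y : Y => g⁻¹ • y) z.2 w.2) = P.assocT z w := by
  have h := tmap_comp (g := P.assocMk (Y := Y))
    (f := fun p : Q × Y => ((op g • p.1, g⁻¹ • p.2) : Q × Y)) (P.mdifferentiableAt_assocMk (EY :=
        EY) _)
    ((P.mdifferentiableAt_act g z).prodMk (mdifferentiableAt_smul_snd (EY := EY) EG Q g⁻¹ z))
  simp only [assocMk_act] at h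
  rw [P.tmap_act] at h
  exact (DFunLike.congr_fun h w).symm

theorem generator_eq (P : PrincipalBundle EG EQ EM G Q M) [LieGroup 𝓘(ℝ, EG) ∞ G] (v :
    GroupLieAlgebra 𝓘(ℝ, EG) G) (z : Q × Y) :
    (generator EQ v z : EQ × EY) =
      (tmap 𝓘(ℝ, EG) 𝓘(ℝ, EQ) (fun g : G => op g • z.1) 1 v,
        tmap 𝓘(ℝ, EG) 𝓘(ℝ, EY) (fun g : G => g⁻¹ • z.2) 1 v) :=
  DFunLike.congr_fun (tmap_prodMk ((P.contMDiff_orbit z.1).mdifferentiable (by simp) 1)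
    ((contMDiff_inv_smul (EG := EG) (EY := EY) z.2).mdifferentiable (by simp) 1)) v

/-- The quotient map is constant on orbits, so differentiating [q g, g⁻¹ y] = [q, y] in g gives
zero. -/
theorem assocT_generator [LieGroup 𝓘(ℝ, EG) ∞ G] (v : EG) (z : Q × Y) :
    P.assocT z (tmap 𝓘(ℝ, EG) 𝓘(ℝ, EQ) (fun g : G => op g • z.1) 1 v,
        tmap 𝓘(ℝ, EG) 𝓘(ℝ, EY) (fun g : G => g⁻¹ • z.2) 1 v) = 0 := by
  have h1 := (P.contMDiff_orbit z.1).mdifferentiable (by simp) 1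
  have h2 := (contMDiff_inv_smul (EG := EG) (EY := EY) z.2).mdifferentiable (by simp) (1 : G)
  have h := tmap_comp (g := P.assocMk (Y := Y)) (f := fun g : G => ((op g • z.1, g⁻¹ • z.2) : Q ×
      Y))
    (P.mdifferentiableAt_assocMk (EY := EY) _) (h1.prodMk h2)
  simp only [assocMk_act, tmap_const] at h
  rw [tmap_prodMk h1 h2] at h
  simpa [assocT] using (DFunLike.congr_fun h v).symm

/-- A local section differentiates to a right inverse. -/
theorem assocT_assocSec_surjective (y₀ : P.Assoc Y) :
    Function.Surjective (P.assocT (EY := EY) (P.assocSec y₀ y₀)) := by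
  intro w
  have h := tmap_comp (P.mdifferentiableAt_assocMk (EY := EY) _)
    ((P.contMDiffAt_assocSec (EY := EY) y₀).mdifferentiableAt (by simp))
  have h2 : (fun y => P.assocMk (P.assocSec y₀ y)) =ᶠ[𝓝 y₀] fun y => y := by
    filter_upwards [P.eventually_assocBase_mem_trivAt y₀] with y hy
    exact P.assocMk_assocSec y₀ hy
  rw [tmap_congr h2, tmap_id] at h
  exact ⟨_, (DFunLike.congr_fun h w).symm⟩

/-- The point of `Q × Y` over `assocMk z` chosen by the local section is a translate of `z`. -/
theorem exists_assocSec_eq (z : Q × Y) :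
    ∃ g : G, P.assocSec (P.assocMk z) (P.assocMk z) = (op g • z.1, g⁻¹ • z.2) :=
  P.assocMk_eq.1 (P.assocMk_assocSec _ (P.assocBase_mem_trivAt _)).symm

theorem tmap_act_surjective (P : PrincipalBundle EG EQ EM G Q M) (g : G) (q : Q) :
    Function.Surjective (tmap 𝓘(ℝ, EQ) 𝓘(ℝ, EQ) (fun q : Q => op g • q) q) := by
  have h := tmap_comp (f := fun q : Q => op g⁻¹ • q) (x := op g • q)
    ((P.contMDiff_act_const g).mdifferentiable (by simp) _)
    ((P.contMDiff_act_const g⁻¹).mdifferentiable (by simp) _)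
  simp only [smul_smul, ← op_mul] at h
  simp only [inv_mul_cancel, mul_inv_cancel, op_one, one_smul, tmap_id] at h
  exact fun w => ⟨_, (DFunLike.congr_fun h w).symm⟩

/-- Surjectivity is known at the point of the orbit chosen by the local section; translation by G
carries it to every other point. -/
theorem assocT_surjective (z : Q × Y) : Function.Surjective (P.assocT (EY := EY) z) := by
  intro w
  obtain ⟨g, hg⟩ := P.exists_assocSec_eq z
  obtain ⟨w', hw'⟩ := P.assocT_assocSec_surjective (EY := EY) (P.assocMk z) w
  rw [hg] at hw'
  obtain ⟨a, ha⟩ := P.tmap_act_surjective g z.1 w'.1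
  refine ⟨(a, tmap 𝓘(ℝ, EY) 𝓘(ℝ, EY) (fun y : Y => g • y) (g⁻¹ • z.2) w'.2), ?_⟩
  rw [← P.assocT_act g z, ha]
  have := DFunLike.congr_fun (tmap_smul_inv_smul (EY := EY) EG g (g⁻¹ • z.2)) w'.2
  simp only [smul_inv_smul] at this
  erw [this]
  exact hw'

theorem mdifferentiableAt_assocBase (y₀ : P.Assoc Y) :
    MDifferentiableAt (𝓘(ℝ, EM).prod 𝓘(ℝ, EY)) 𝓘(ℝ, EM) P.assocBase y₀ := by
  have h : ContMDiffAt (𝓘(ℝ, EM).prod 𝓘(ℝ, EY)) 𝓘(ℝ, EM) ∞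
      (fun y => (assocFun (P.trivAt y₀) y).1) y₀ :=
    contMDiffAt_fst.comp y₀ (P.contMDiffAt_assocFun (EY := EY) y₀)
  have h2 : P.assocBase = fun y => (assocFun (P.trivAt y₀) (Y := Y) y).1 := by
    funext y
    conv_lhs => rw [← P.assocMk_out y]
    rfl
  rw [h2]
  exact h.mdifferentiableAt (by simp)

/-- The map (q, y) ↦ proj q factors through Y_Q, so its differential kills the kernel of that of the
quotient map. -/
theorem tmap_proj_eq_zero (z : Q × Y) (w : EQ × EY) (hw : P.assocT z w = 0) :
    tmap 𝓘(ℝ, EQ) 𝓘(ℝ, EM) P.proj z.1 w.1 = 0 := by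
  have h1 := tmap_comp (P.mdifferentiableAt_assocBase (EY := EY) (P.assocMk z))
    (P.mdifferentiableAt_assocMk z)
  have h2 := tmap_comp (x := z) (f := fun p : Q × Y => p.1)
    (P.contMDiff_proj.mdifferentiable (by simp) z.1) (mdifferentiableAt_fst (I' := 𝓘(ℝ, EY)))
  simp only [assocBase_mk] at h1
  rw [h1, tmap_fst] at h2
  have h3 := DFunLike.congr_fun h2 w
  simp only [ContinuousLinearMap.coe_comp, Function.comp_apply] at h3
  rw [← assocT, hw, map_zero] at h3
  exact h3.symm

/-- In a trivialization, y ↦ [q, y] becomes y ↦ (proj q, fib q • y), whose second component is a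
translation and hence has injective differential. -/
theorem assocT_snd_injective (z : Q × Y) (v : EY) (hv : P.assocT z ((0, v) : EQ × EY) = 0) :
    v = 0 := by
  set y₀ := P.assocMk z with hy₀
  have h0 := P.contMDiffAt_assocFun (EY := EY) y₀
  have hi : MDifferentiableAt 𝓘(ℝ, EY) (𝓘(ℝ, EQ).prod 𝓘(ℝ, EY)) (fun y : Y => (z.1, y)) z.2 :=
    mdifferentiableAt_const.prodMk (mdifferentiableAt_self _)
  have hq := P.mdifferentiableAt_assocMk (EY := EY) z
  have h1 := tmap_comp (g := P.assocMk (Y := Y)) (f := fun y : Y => (z.1, y)) hq hi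
  have h2 := tmap_comp (g := assocFun (P.trivAt y₀) (Y := Y)) (f := fun y : Y => P.assocMk (z.1, y))
    (h0.mdifferentiableAt (by simp)) (hq.comp (f := fun y : Y => (z.1, y)) z.2 hi)
  have hz := P.assocBase_mem_trivAt y₀
  have h3 : (fun y : Y => assocFun (P.trivAt y₀) (P.assocMk (z.1, y))) =
      fun y => (P.proj z.1, (P.trivAt y₀).fib z.1 • y) :=
    funext fun y => assocFun_mk _ _ hz
  have hm := (contMDiff_const_smul_right (EY := EY) (Y := Y) EG
    ((P.trivAt y₀).fib z.1)).mdifferentiable (by simp) z.2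
  rw [tmap_prodMk mdifferentiableAt_const (mdifferentiableAt_self _), tmap_const, tmap_id] at h1
  rw [h3, tmap_prodMk mdifferentiableAt_const hm, tmap_const, h1] at h2
  have h4 := congrArg Prod.snd (DFunLike.congr_fun h2 v)
  simp only [ContinuousLinearMap.coe_comp, Function.comp_apply,
    ContinuousLinearMap.prod_apply] at h4
  erw [hv, map_zero] at h4
  have h5 := DFunLike.congr_fun (tmap_smul_inv_smul (EY := EY) EG ((P.trivAt y₀).fib z.1) z.2) v
  simp only [ContinuousLinearMap.coe_comp, Function.comp_apply] at h5
  erw [h4, map_zero] at h5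
  exact h5.symm

end AssocDeriv
end PrincipalBundle

/-! ### The splitting into vertical and horizontal vectors -/

namespace FamilyData

variable {E H E' H' X S : Type*} [NormedAddCommGroup E] [NormedSpace ℝ E]
    [TopologicalSpace H] {I : ModelWithCorners ℝ E H} [TopologicalSpace X] [ChartedSpace H X]
    [NormedAddCommGroup E'] [NormedSpace ℝ E'] [TopologicalSpace H'] {J : ModelWithCorners ℝ E' H'}
    [TopologicalSpace S] [ChartedSpace H' S] (D : FamilyData I J X S)

/-- `dπ` maps `H_x` isomorphically onto `T_{π x} S`. -/
def HorBijectiveAt (x : X) : Prop :=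
  Function.Bijective (fun h : D.hor x => mfderiv I J D.proj x (h : TangentSpace I x))

variable {D}

theorem mem_vert {x : X} {v : TangentSpace I x} : v ∈ D.vert x ↔ tmap I J D.proj x v = 0 := Iff.rfl

theorem HorBijectiveAt.isCompl {x : X} (h : D.HorBijectiveAt x) :
    IsCompl (D.vert x) (D.hor x) := by
  refine ⟨Submodule.disjoint_def.2 fun v hv hv' => ?_,
    Submodule.codisjoint_iff_exists_add_eq.2 fun v => ?_⟩
  · exact congrArg Subtype.val (h.1 (a₁ := ⟨v, hv'⟩) (a₂ := 0)
      ((show mfderiv I J D.proj x v = 0 from hv).trans (map_zero (mfderiv I J D.proj x)).symm))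
  · obtain ⟨u, hu⟩ := h.2 (mfderiv I J D.proj x v)
    refine ⟨v - u, u, ?_, u.2, sub_add_cancel _ _⟩
    exact (map_sub (mfderiv I J D.proj x) v u).trans (sub_eq_zero.2 hu.symm)

theorem HorBijectiveAt.vertProj_of_mem_vert {x : X} (h : D.HorBijectiveAt x) {v : TangentSpace I x}
    (hv : v ∈ D.vert x) : (D.vertProj x v : TangentSpace I x) = v := by
  rw [vertProj, dif_pos h.isCompl]
  exact congrArg Subtype.val (Submodule.projectionOnto_apply_left h.isCompl ⟨v, hv⟩)

theorem HorBijectiveAt.vertProj_of_mem_hor {x : X} (h : D.HorBijectiveAt x) {v : TangentSpace I x}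
    (hv : v ∈ D.hor x) : D.vertProj x v = 0 := by
  rw [vertProj, dif_pos h.isCompl]
  exact Submodule.projectionOnto_apply_right h.isCompl ⟨v, hv⟩

theorem HorBijectiveAt.horProj_mem {x : X} (h : D.HorBijectiveAt x) (v : TangentSpace I x) :
    D.horProj x v ∈ D.hor x := by
  have h1 : D.vertProj x (D.horProj x v) = 0 := by
    refine (map_sub (D.vertProj x) v _).trans (sub_eq_zero.2 (Subtype.ext ?_))
    exact (h.vertProj_of_mem_vert (D.vertProj x v).2).symm
  rw [vertProj, dif_pos h.isCompl] at h1
  exact (Submodule.projectionOnto_apply_eq_zero_iff h.isCompl).1 h1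

theorem horProj_add_vertProj (x : X) (v : TangentSpace I x) :
    D.horProj x v + D.vertProj x v = v :=
  sub_add_cancel v (D.vertProj x v : TangentSpace I x)

theorem HorBijectiveAt.horLift_mem {x : X} (_h : D.HorBijectiveAt x) (w : TangentSpace J (D.proj
    x)) :
    D.horLift x w ∈ D.hor x := Subtype.property _

theorem HorBijectiveAt.tmap_horLift {x : X} (h : D.HorBijectiveAt x)
    (w : TangentSpace J (D.proj x)) : tmap I J D.proj x (D.horLift x w) = w :=
  Function.invFun_eq (h.2 w)

theorem HorBijectiveAt.horLift_eq {x : X} (h : D.HorBijectiveAt x) {u : TangentSpace I x}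
    (hu : u ∈ D.hor x) {w : TangentSpace J (D.proj x)} (huw : tmap I J D.proj x u = w) :
    D.horLift x w = u :=
  congrArg Subtype.val (h.1 (a₁ := ⟨_, h.horLift_mem w⟩) (a₂ := ⟨u, hu⟩)
    ((h.tmap_horLift w).trans huw.symm))

end FamilyData

namespace PrincipalBundle

/-! ### Vertical space, horizontal space and metric of the associated family -/

section AssocFamily

variable {EG EQ EM EX ES G Q M X S : Type*}
    [NormedAddCommGroup EG] [NormedSpace ℝ EG] [NormedAddCommGroup EQ] [NormedSpace ℝ EQ]
    [NormedAddCommGroup EM] [NormedSpace ℝ EM]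
    [NormedAddCommGroup EX] [NormedSpace ℝ EX] [NormedAddCommGroup ES] [NormedSpace ℝ ES]
    [Group G] [TopologicalSpace G] [ChartedSpace EG G] [LieGroup 𝓘(ℝ, EG) ∞ G]
    [TopologicalSpace Q] [ChartedSpace EQ Q] [TopologicalSpace M] [ChartedSpace EM M]
    [IsManifold 𝓘(ℝ, EQ) ∞ Q] [IsManifold 𝓘(ℝ, EM) ∞ M]
    [TopologicalSpace X] [ChartedSpace EX X] [IsManifold 𝓘(ℝ, EX) ∞ X]
    [TopologicalSpace S] [ChartedSpace ES S] [IsManifold 𝓘(ℝ, ES) ∞ S]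
    [MulAction G X] [ContinuousSMul G X] [ContMDiffSMul 𝓘(ℝ, EG) 𝓘(ℝ, EX) ∞ G X]
    [MulAction G S] [ContinuousSMul G S] [ContMDiffSMul 𝓘(ℝ, EG) 𝓘(ℝ, ES) ∞ G S]
    [MulAction Gᵐᵒᵖ Q] {P : PrincipalBundle EG EQ EM G Q M} (Φ : P.Connection)

/-- The connection form, as a map between the model spaces. -/
noncomputable def Connection.formT (q : Q) : EQ →L[ℝ] EG := Φ.form q

theorem Connection.formT_orbit (q : Q) (v : EG) :
    Φ.formT q (tmap 𝓘(ℝ, EG) 𝓘(ℝ, EQ) (fun g : G => op g • q) 1 v) = v := Φ.form_generator q v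

theorem Connection.formT_act_eq_zero (g : G) {q : Q} {a : EQ} (ha : Φ.formT q a = 0) :
    Φ.formT (op g • q) (tmap 𝓘(ℝ, EQ) 𝓘(ℝ, EQ) (fun q : Q => op g • q) q a) = 0 :=
  (Φ.equivariant g q a).trans
    ((congrArg (tmap 𝓘(ℝ, EG) 𝓘(ℝ, EG) (fun h : G => g⁻¹ * h * g) 1) ha).trans (map_zero _))

/-- A kernel vector projects to zero in M, so a generates an orbit direction c ∈ 𝔤; Φ reads off c,
which is therefore zero. What is left is injectivity on the second factor. -/
theorem Connection.eq_zero_of_assocT_eq_zero (z : Q × X) {a : EQ} {v : EX} (ha : Φ.formT z.1 a = 0)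
    (h : P.assocT z (a, v) = 0) : a = 0 ∧ v = 0 := by
  obtain ⟨c, hc⟩ := P.exists_tmap_orbit_eq z.1 a (P.tmap_proj_eq_zero z _ h)
  have h0 := Φ.formT_orbit z.1 c
  rw [← hc, ha] at h0
  rw [← h0, map_zero] at hc
  subst hc
  exact ⟨rfl, P.assocT_snd_injective z v h⟩

/-- Subtracting a generator makes the `Q`-component horizontal. -/
theorem Connection.assocT_eq (z : Q × X) (a : EQ) (v : EX) :
    P.assocT z (a, v) =
      P.assocT z (a - tmap 𝓘(ℝ, EG) 𝓘(ℝ, EQ) (fun g : G => op g • z.1) 1 (Φ.formT z.1 a),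
        v - tmap 𝓘(ℝ, EG) 𝓘(ℝ, EX) (fun g : G => g⁻¹ • z.2) 1 (Φ.formT z.1 a)) := by
  rw [← Prod.mk_sub_mk, map_sub, assocT_generator, sub_zero]

theorem Connection.formT_sub (q : Q) (a : EQ) :
    Φ.formT q (a - tmap 𝓘(ℝ, EG) 𝓘(ℝ, EQ) (fun g : G => op g • q) 1 (Φ.formT q a)) = 0 := by
  rw [map_sub, Φ.formT_orbit, sub_self]

/-- Any preimage can be corrected by a generator. Together with `eq_zero_of_assocT_eq_zero` this
makes ker Φ ⊕ TX a model for the tangent space of X_Q. -/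
theorem Connection.exists_assocT_eq (z : Q × X) (w : EM × EX) :
    ∃ (a : EQ) (v : EX), Φ.formT z.1 a = 0 ∧ P.assocT z (a, v) = w := by
  obtain ⟨⟨a, v⟩, rfl⟩ := P.assocT_surjective z w
  exact ⟨_, _, Φ.formT_sub _ _, (Φ.assocT_eq z a v).symm⟩

variable {D : FamilyData 𝓘(ℝ, EX) 𝓘(ℝ, ES) X S} (hG : D.IsInvariant G)

/-- Near y₀ the induced map is a local section of q_X, followed by id × π and by q_S. -/
theorem mdifferentiableAt_assocMap (hπ : ContMDiff 𝓘(ℝ, EX) 𝓘(ℝ, ES) ∞ D.proj) (y₀ : P.Assoc X) :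
    MDifferentiableAt (𝓘(ℝ, EM).prod 𝓘(ℝ, EX)) (𝓘(ℝ, EM).prod 𝓘(ℝ, ES))
      (P.assocMap D.proj hG.proj_smul) y₀ := by
  have hs := P.contMDiffAt_assocSec (EY := EX) y₀
  have h : ContMDiffAt (𝓘(ℝ, EM).prod 𝓘(ℝ, EX)) (𝓘(ℝ, EM).prod 𝓘(ℝ, ES)) ∞
      (fun y => P.assocMk ((P.assocSec y₀ y).1, D.proj (P.assocSec y₀ y).2)) y₀ :=
    (P.contMDiff_assocMk _).comp y₀
      ((contMDiffAt_fst.comp y₀ hs).prodMk (hπ.contMDiffAt.comp y₀ (contMDiffAt_snd.comp y₀ hs)))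
  refine (h.congr_of_eventuallyEq ?_).mdifferentiableAt (by simp)
  filter_upwards [P.eventually_assocBase_mem_trivAt y₀] with y hy
  conv_lhs => rw [← P.assocMk_assocSec y₀ hy]
  rfl

/-- The differential of π_Q ∘ q_X = q_S ∘ (id × π). -/
theorem tmap_assocMap (hπ : ContMDiff 𝓘(ℝ, EX) 𝓘(ℝ, ES) ∞ D.proj) (z : Q × X) (a : EQ) (v : EX) :
    tmap (𝓘(ℝ, EM).prod 𝓘(ℝ, EX)) (𝓘(ℝ, EM).prod 𝓘(ℝ, ES)) (P.assocMap D.proj hG.proj_smul)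
      (P.assocMk z) (P.assocT z (a, v)) =
      P.assocT (z.1, D.proj z.2) (a, tmap 𝓘(ℝ, EX) 𝓘(ℝ, ES) D.proj z.2 v) := by
  have h1 := tmap_comp (mdifferentiableAt_assocMap hG hπ (P.assocMk z))
    (P.mdifferentiableAt_assocMk (EY := EX) z)
  have hp : MDifferentiableAt 𝓘(ℝ, EX) 𝓘(ℝ, ES) D.proj z.2 := (hπ z.2).mdifferentiableAt (by simp)
  have hp2 : MDifferentiableAt (𝓘(ℝ, EQ).prod 𝓘(ℝ, EX)) 𝓘(ℝ, ES) (fun p : Q × X => D.proj p.2) z :=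
    hp.comp z mdifferentiableAt_snd
  have h2 := tmap_comp (g := P.assocMk (Y := S)) (f := fun p : Q × X => (p.1, D.proj p.2)) (x := z)
    (P.mdifferentiableAt_assocMk (EY := ES) _) (mdifferentiableAt_fst.prodMk hp2)
  rw [tmap_prodMk mdifferentiableAt_fst hp2, tmap_fst,
    tmap_comp (f := fun p : Q × X => p.2) hp mdifferentiableAt_snd, tmap_snd] at h2
  exact DFunLike.congr_fun (h1.symm.trans h2) (a, v)

theorem tmap_proj_smul (EG : Type*) [NormedAddCommGroup EG] [NormedSpace ℝ EG]
    [ChartedSpace EG G] [ContMDiffSMul 𝓘(ℝ, EG) 𝓘(ℝ, EX) ∞ G X]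
    [ContMDiffSMul 𝓘(ℝ, EG) 𝓘(ℝ, ES) ∞ G S] (hG : D.IsInvariant G)
    (hπ : ContMDiff 𝓘(ℝ, EX) 𝓘(ℝ, ES) ∞ D.proj) (g : G) (x : X) (v : EX) :
    tmap 𝓘(ℝ, EX) 𝓘(ℝ, ES) D.proj (g • x) (tmap 𝓘(ℝ, EX) 𝓘(ℝ, EX) (fun x : X => g • x) x v) =
      tmap 𝓘(ℝ, ES) 𝓘(ℝ, ES) (fun s : S => g • s) (D.proj x) (tmap 𝓘(ℝ, EX) 𝓘(ℝ, ES) D.proj x v) :=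
          by
  have hp : ∀ x, MDifferentiableAt 𝓘(ℝ, EX) 𝓘(ℝ, ES) D.proj x :=
    fun x => (hπ x).mdifferentiableAt (by simp)
  have h1 := tmap_comp (hp (g • x)) ((contMDiff_const_smul_right (EY := EX) EG g).mdifferentiable
      (by simp) x)
  have h2 := tmap_comp ((contMDiff_const_smul_right (EY := ES) EG g).mdifferentiable (by simp)
      (D.proj x))
    (hp x)
  simp only [hG.proj_smul] at h1
  exact DFunLike.congr_fun (h1.symm.trans h2) v

theorem smul_mem_vert (EG : Type*) [NormedAddCommGroup EG] [NormedSpace ℝ EG]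
    [ChartedSpace EG G] [ContMDiffSMul 𝓘(ℝ, EG) 𝓘(ℝ, EX) ∞ G X]
    [ContMDiffSMul 𝓘(ℝ, EG) 𝓘(ℝ, ES) ∞ G S] (hG : D.IsInvariant G)
    (hπ : ContMDiff 𝓘(ℝ, EX) 𝓘(ℝ, ES) ∞ D.proj) (g : G) {x : X} {v : EX}
    (hv : v ∈ D.vert x) : tmap 𝓘(ℝ, EX) 𝓘(ℝ, EX) (fun x : X => g • x) x v ∈ D.vert (g • x) :=
  FamilyData.mem_vert.2 ((tmap_proj_smul EG hG hπ g x v).trans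
    ((congrArg _ (FamilyData.mem_vert.1 hv)).trans (map_zero _)))

theorem smul_mem_hor (hG : D.IsInvariant G) (g : G) {x : X} {v : EX}
    (hv : v ∈ D.hor x) : tmap 𝓘(ℝ, EX) 𝓘(ℝ, EX) (fun x : X => g • x) x v ∈ D.hor (g • x) := by
  rw [← hG.hor_smul g x]
  exact ⟨v, hv, rfl⟩

variable {Φ hG}

/-- The image of `V ⊕ H` in `T X_Q` does not depend on the representative. -/
theorem exists_hor_act (hG : D.IsInvariant G) {z : Q × X} {w : EM × EX} (g : G)
    (h : ∃ (a : EQ) (v : EX), Φ.formT z.1 a = 0 ∧ v ∈ D.hor z.2 ∧ P.assocT z (a, v) = w) :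
    ∃ (a : EQ) (v : EX), Φ.formT (op g • z.1) a = 0 ∧ v ∈ D.hor (g⁻¹ • z.2) ∧
      P.assocT (op g • z.1, g⁻¹ • z.2) (a, v) = w := by
  obtain ⟨a, v, ha, hv, rfl⟩ := h
  exact ⟨_, _, Φ.formT_act_eq_zero g ha, smul_mem_hor hG g⁻¹ hv, P.assocT_act g z (a, v)⟩

/-- H_Q is defined through the representative `assocOut`; since ker Φ and H are G-invariant, any
representative z serves. -/
theorem mem_assocFamily_hor {z : Q × X} {w : EM × EX} :
    w ∈ (assocFamily Φ D hG).hor (P.assocMk z) ↔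
      ∃ (a : EQ) (v : EX), Φ.formT z.1 a = 0 ∧ v ∈ D.hor z.2 ∧ P.assocT z (a, v) = w := by
  obtain ⟨g, hg⟩ := P.assocMk_eq.1 (P.assocMk_out (P.assocMk z)).symm
  have h1 : w ∈ (assocFamily Φ D hG).hor (P.assocMk z) ↔
      ∃ (a : EQ) (v : EX), Φ.formT (P.assocOut (P.assocMk z)).1 a = 0 ∧ v ∈ D.hor (P.assocOut
          (P.assocMk z)).2 ∧
        P.assocT (P.assocOut (P.assocMk z)) (a, v) = w := by
    constructor
    · rintro ⟨⟨a, v⟩, ⟨ha, hv⟩, rfl⟩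
      exact ⟨a, v, ha, hv, rfl⟩
    · rintro ⟨a, v, ha, hv, rfl⟩
      exact ⟨(a, v), ⟨ha, hv⟩, rfl⟩
  rw [h1, hg]
  refine ⟨fun h => ?_, exists_hor_act hG g⟩
  have e : ((op g⁻¹ • (op g • z.1), g⁻¹⁻¹ • g⁻¹ • z.2) : Q × X) = z := by
    simp [smul_smul]
  -- Translating by g and then by g⁻¹ returns to z only up to a propositional equality; stating the
  -- claim as a predicate of the point allows the rewriting.
  have h2 : (fun z : Q × X => ∃ (a : EQ) (v : EX), Φ.formT z.1 a = 0 ∧ v ∈ D.hor z.2 ∧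
      P.assocT z (a, v) = w) (op g⁻¹ • (op g • z.1), g⁻¹⁻¹ • g⁻¹ • z.2) := exists_hor_act hG g⁻¹ h
  rw [e] at h2
  exact h2

/-- Lift w to (a, v) with Φ(a) = 0. Then dπ_Q(w) is the image of (a, dπ v) in S_Q, and injectivity
on ker Φ ⊕ TS forces a = 0 and dπ v = 0. -/
theorem mem_assocFamily_vert (hπ : ContMDiff 𝓘(ℝ, EX) 𝓘(ℝ, ES) ∞ D.proj) {z : Q × X}
    {w : EM × EX} :
    w ∈ (assocFamily Φ D hG).vert (P.assocMk z) ↔ ∃ v : EX, v ∈ D.vert z.2 ∧ P.assocT z (0, v) = w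
        := by
  constructor
  · intro hw
    obtain ⟨a, v, ha, rfl⟩ := Φ.exists_assocT_eq z w
    have h := (tmap_assocMap hG hπ z a v).symm.trans hw
    obtain ⟨rfl, h2⟩ := Φ.eq_zero_of_assocT_eq_zero (z.1, D.proj z.2) ha h
    exact ⟨v, h2, rfl⟩
  · rintro ⟨v, hv, rfl⟩
    refine (tmap_assocMap hG hπ z 0 v).trans ?_
    have : tmap 𝓘(ℝ, EX) 𝓘(ℝ, ES) D.proj z.2 v = 0 := hv
    rw [this]
    exact map_zero _

-- Under the identifications of H_Q with V ⊕ H and of the tangent space of S_Q with V ⊕ TS, the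
-- differential of π_Q becomes id ⊕ dπ.
variable (Φ hG) in
theorem assocFamily_horBijectiveAt (hπ : ContMDiff 𝓘(ℝ, EX) 𝓘(ℝ, ES) ∞ D.proj)
    (hb : ∀ x, D.HorBijectiveAt x) (y : P.Assoc X) : (assocFamily Φ D hG).HorBijectiveAt y := by
  obtain ⟨z, rfl⟩ := P.assocMk_surjective y
  constructor
  · rintro ⟨w, hw⟩ ⟨w', hw'⟩ h
    have hs := Submodule.sub_mem _ hw hw'
    refine Subtype.ext (sub_eq_zero.1 ?_)
    obtain ⟨a, v, ha, hv, hav⟩ := mem_assocFamily_hor.1 hs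
    rw [← hav]
    have h0 : tmap (𝓘(ℝ, EM).prod 𝓘(ℝ, EX)) (𝓘(ℝ, EM).prod 𝓘(ℝ, ES))
        (P.assocMap D.proj hG.proj_smul) (P.assocMk z) (P.assocT z (a, v)) = 0 := by
      rw [hav]
      exact (map_sub (tmap (𝓘(ℝ, EM).prod 𝓘(ℝ, EX)) (𝓘(ℝ, EM).prod 𝓘(ℝ, ES))
        (P.assocMap D.proj hG.proj_smul) (P.assocMk z)) w w').trans (sub_eq_zero.2 h)
    rw [tmap_assocMap hG hπ] at h0
    obtain ⟨rfl, h2⟩ := Φ.eq_zero_of_assocT_eq_zero (z.1, D.proj z.2) ha h0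
    have h3 : mfderiv 𝓘(ℝ, EX) 𝓘(ℝ, ES) D.proj z.2 v = 0 := h2
    have hv0 : v = 0 := congrArg Subtype.val ((hb z.2).1 (a₁ := ⟨v, hv⟩) (a₂ := 0)
      (h3.trans (map_zero (mfderiv 𝓘(ℝ, EX) 𝓘(ℝ, ES) D.proj z.2)).symm))
    rw [hv0]
    exact map_zero _
  · intro w
    obtain ⟨a, s, ha, hs⟩ := Φ.exists_assocT_eq (z.1, D.proj z.2) w
    obtain ⟨⟨v, hv⟩, rfl⟩ := (hb z.2).2 s
    exact ⟨⟨P.assocT z (a, v), mem_assocFamily_hor.2 ⟨a, v, ha, hv, rfl⟩⟩,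
      (tmap_assocMap hG hπ z a v).trans hs⟩

theorem assocT_add (z : Q × X) (a : EQ) {p h v : EX} (hv : p + h = v) :
    P.assocT z (a, v) = P.assocT z (0, p) + P.assocT z (a, h) := by
  rw [← map_add, Prod.mk_add_mk, zero_add, hv]

theorem assocT_sub (z : Q × X) (v w : EX) :
    P.assocT z (0, v - w) = P.assocT z (0, v) - P.assocT z (0, w) := by
  rw [← map_sub, Prod.mk_sub_mk, sub_zero]

theorem assocT_act_snd (g : G) (z : Q × X) (v : EX) :
    P.assocT (op g • z.1, g⁻¹ • z.2) (0, tmap 𝓘(ℝ, EX) 𝓘(ℝ, EX) (fun x : X => g⁻¹ • x) z.2 v) =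
      P.assocT z (0, v) := by
  have h := P.assocT_act g z (0, v)
  rwa [map_zero] at h

/-- Split (a, v) as (0, vertical part of v) + (a, horizontal part of v): the first summand becomes
vertical in X_Q, the second horizontal. -/
theorem assocFamily_vertProj (hπ : ContMDiff 𝓘(ℝ, EX) 𝓘(ℝ, ES) ∞ D.proj)
    (hb : ∀ x, D.HorBijectiveAt x) (z : Q × X) {a : EQ} (v : EX) (ha : Φ.formT z.1 a = 0) :
    ((assocFamily Φ D hG).vertProj (P.assocMk z) (P.assocT (EY := EX) z (a, v))).1 =
      P.assocT (EY := EX) z (0, (D.vertProj z.2 v).1) := by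
  have hQ := assocFamily_horBijectiveAt Φ hG hπ hb (P.assocMk z)
  have h1 : P.assocT (EY := EX) z (0, (D.vertProj z.2 v).1) ∈ (assocFamily Φ D hG).vert (P.assocMk
      z) :=
    (mem_assocFamily_vert hπ).2 ⟨_, (D.vertProj z.2 v).2, rfl⟩
  have h2 : P.assocT (EY := EX) z (a, (D.horProj z.2 v : EX)) ∈ (assocFamily Φ D hG).hor (P.assocMk
      z) :=
    mem_assocFamily_hor.2 ⟨a, _, ha, (hb z.2).horProj_mem v, rfl⟩
  have h3 : P.assocT (EY := EX) z (a, v) =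
      P.assocT (EY := EX) z (0, (D.vertProj z.2 v).1) + P.assocT (EY := EX) z (a, (D.horProj z.2 v
          : EX)) :=
    assocT_add z a ((add_comm _ _).trans (FamilyData.horProj_add_vertProj z.2 v))
  rw [h3]
  refine (congrArg Subtype.val (map_add ((assocFamily Φ D hG).vertProj (P.assocMk z)) _ _)).trans ?_
  have h4 := hQ.vertProj_of_mem_vert h1
  have h5 := hQ.vertProj_of_mem_hor h2
  refine (congrArg₂ (· + ·) h4 (congrArg Subtype.val h5)).trans ?_
  exact add_zero _

/-- The definition inverts v ↦ q_*(0, v) by `Function.invFun` at a chosen representative.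
Injectivity makes this a genuine inverse on the image, and invariance of the metric moves the result
to z. -/
theorem assocFamily_metric (hπ : ContMDiff 𝓘(ℝ, EX) 𝓘(ℝ, ES) ∞ D.proj) (z : Q × X)
    (u v : (assocFamily Φ D hG).vert (P.assocMk z)) (u' v' : D.vert z.2)
    (hu : P.assocT (EY := EX) z (0, u'.1) = u.1)
    (hv : P.assocT (EY := EX) z (0, v'.1) = v.1) :
    (assocFamily Φ D hG).metric (P.assocMk z) u v = D.metric z.2 u' v' := by
  obtain ⟨g, hg⟩ := P.assocMk_eq.1 (P.assocMk_out (P.assocMk z)).symm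
  have key : ∀ z' : Q × X, z' = (op g • z.1, g⁻¹ • z.2) →
      D.metric z'.2
        (Function.invFun (fun w : D.vert z'.2 => P.assocT (EY := EX) z' (0, w.1)) u.1)
        (Function.invFun (fun w : D.vert z'.2 => P.assocT (EY := EX) z' (0, w.1)) v.1) =
      D.metric z.2 u' v' := by
    rintro _ rfl
    have hinj : Function.Injective (fun w : D.vert (g⁻¹ • z.2) =>
        P.assocT (EY := EX) (op g • z.1, g⁻¹ • z.2) (0, w.1)) := by
      intro w w' h
      refine Subtype.ext (sub_eq_zero.1 (P.assocT_snd_injective (EY := EX) (op g • z.1, g⁻¹ • z.2)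
        (w.1 - w'.1) ?_))
      exact (assocT_sub _ _ _).trans (sub_eq_zero.2 h)
    have hinv : ∀ (u : EM × EX) (u' : D.vert z.2), P.assocT (EY := EX) z (0, u'.1) = u →
        Function.invFun (fun w : D.vert (g⁻¹ • z.2) =>
          P.assocT (EY := EX) (op g • z.1, g⁻¹ • z.2) (0, w.1)) u =
        ⟨_, smul_mem_vert EG hG hπ g⁻¹ u'.2⟩ := by
      rintro u u' rfl
      refine (congrArg (Function.invFun _) (assocT_act_snd (EX := EX) g z u'.1).symm).trans ?_
      exact Function.leftInverse_invFun hinj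
        (⟨_, smul_mem_vert EG hG hπ g⁻¹ u'.2⟩ : D.vert (g⁻¹ • z.2))
    have hm := hG.metric_smul g⁻¹ z.2 u' v' ⟨_, smul_mem_vert EG hG hπ g⁻¹ u'.2⟩
      ⟨_, smul_mem_vert EG hG hπ g⁻¹ v'.2⟩ rfl rfl
    refine Eq.trans ?_ hm
    exact congrArg₂ (D.metric (g⁻¹ • z.2)) (hinv _ u' hu) (hinv _ v' hv)
  exact key _ hg

end AssocFamily

end PrincipalBundle

/-! ### Pullback of forms and naturality of the exterior derivative -/

section Pullback

variable {E H X E' : Type*} [NormedAddCommGroup E] [NormedSpace ℝ E] [TopologicalSpace H]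
    {I : ModelWithCorners ℝ E H} [TopologicalSpace X] [ChartedSpace H X]
    [NormedAddCommGroup E'] [NormedSpace ℝ E']

/-- The value of a form on vectors of the model space. -/
def Form.val {n : ℕ} (η : Form I X n) (x : X) : E [⋀^Fin n]→L[ℝ] ℝ := η x

/-- The pullback of a form by a map from a vector space. -/
noncomputable def Form.pull {n : ℕ} (η : Form I X n) (f : E' → X) (y : E') : E' [⋀^Fin n]→L[ℝ] ℝ :=
  (η.val (f y)).compContinuousLinearMap (tmap 𝓘(ℝ, E') I f y)

theorem tmap_eq_fderiv {f : E' → E} {y : E'} : tmap 𝓘(ℝ, E') 𝓘(ℝ, E) f y = fderiv ℝ f y :=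
  mfderiv_eq_fderiv

variable [IsManifold I ∞ X] [I.Boundaryless]

theorem mdifferentiableAt_extChartAt_symm (x₀ : X) {y : E} (hy : y ∈ (extChartAt I x₀).target) :
    MDifferentiableAt 𝓘(ℝ, E) I (extChartAt I x₀).symm y :=
  ((contMDiffOn_extChartAt_symm (n := ∞) x₀).contMDiffAt
    ((isOpen_extChartAt_target x₀).mem_nhds hy)).mdifferentiableAt (by simp)

theorem chartSymmDeriv_eq (x₀ : X) (y : E) :
    (chartSymmDeriv I x₀ y : E →L[ℝ] E) = tmap 𝓘(ℝ, E) I (extChartAt I x₀).symm y := by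
  unfold chartSymmDeriv tmap
  rw [I.range_eq_univ]
  exact congrFun mfderivWithin_univ y

theorem Form.inChart_eq_pull {n : ℕ} (η : Form I X n) (x₀ : X) :
    η.inChart x₀ = η.pull (extChartAt I x₀).symm := by
  funext y
  unfold Form.pull
  rw [← chartSymmDeriv_eq]
  rfl

theorem contDiffAt_extChartAt_comp {f : E' → X} {y₀ : E'} (hf : ContMDiffAt 𝓘(ℝ, E') I ∞ f y₀) :
    ContDiffAt ℝ ∞ (fun y => extChartAt I (f y₀) (f y)) y₀ :=
  (contMDiffAt_extChartAt.comp y₀ hf).contDiffAt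

/-- Near y₀, f is the inverse chart at f y₀ composed with the chart expression of f, so pulling back
by f reduces to pulling back between vector spaces. -/
theorem Form.pull_eventuallyEq {n : ℕ} (η : Form I X n) {f : E' → X} {y₀ : E'}
    (hf : ContMDiffAt 𝓘(ℝ, E') I ∞ f y₀) :
    η.pull f =ᶠ[𝓝 y₀] fun y => (η.inChart (f y₀) (extChartAt I (f y₀) (f
        y))).compContinuousLinearMap
      (fderiv ℝ (fun y => extChartAt I (f y₀) (f y)) y) := by
  have hs : ∀ᶠ y in 𝓝 y₀, f y ∈ (extChartAt I (f y₀)).source :=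
    hf.continuousAt.eventually (extChartAt_source_mem_nhds (f y₀))
  have hd : ∀ᶠ y in 𝓝 y₀, ContMDiffAt 𝓘(ℝ, E') I 1 f y :=
    (contMDiffAt_iff_contMDiffAt_nhds (by simp)).1
      (hf.of_le (by exact_mod_cast le_top))
  filter_upwards [hs.eventually_nhds, hd] with y hy hdy
  have hy0 := hy.self_of_nhds
  have hτ : MDifferentiableAt 𝓘(ℝ, E') 𝓘(ℝ, E) (fun y => extChartAt I (f y₀) (f y)) y :=
    (mdifferentiableAt_extChartAt (by simpa using hy0)).comp y
      (hdy.mdifferentiableAt (by simp))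
  have h1 := tmap_comp (f := fun y => extChartAt I (f y₀) (f y))
    (mdifferentiableAt_extChartAt_symm (f y₀) ((extChartAt I (f y₀)).map_source hy0)) hτ
  have h2 : (fun y => (extChartAt I (f y₀)).symm (extChartAt I (f y₀) (f y))) =ᶠ[𝓝 y] f := by
    filter_upwards [hy] with y' hy'
    exact (extChartAt I (f y₀)).left_inv hy'
  rw [tmap_congr h2, tmap_eq_fderiv] at h1
  rw [Form.inChart_eq_pull]
  unfold Form.pull
  rw [h1, (extChartAt I (f y₀)).left_inv hy0]
  rfl

theorem Form.differentiableAt_inChart {n : ℕ} {η : Form I X n} (hη : η.Smooth) (x₀ : X) {y : E}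
    (hy : y ∈ (extChartAt I x₀).target) : DifferentiableAt ℝ (η.inChart x₀) y :=
  ((hη x₀).contDiffAt ((isOpen_extChartAt_target x₀).mem_nhds hy)).differentiableAt (by simp)

theorem Form.differentiableAt_pull {n : ℕ} {η : Form I X n} (hη : η.Smooth) {f : E' → X} {y₀ : E'}
    (hf : ContMDiffAt 𝓘(ℝ, E') I ∞ f y₀) : DifferentiableAt ℝ (η.pull f) y₀ := by
  have hτ := contDiffAt_extChartAt_comp hf
  refine DifferentiableAt.congr_of_eventuallyEq ?_ (η.pull_eventuallyEq hf)
  refine DifferentiableAt.continuousAlternatingMapCompContinuousLinearMap ?_ ?_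
  · exact (Form.differentiableAt_inChart hη (f y₀) (mem_extChartAt_target _)).comp
      (f := fun y => extChartAt I (f y₀) (f y)) y₀ (hτ.differentiableAt (by simp))
  · exact (hτ.fderiv_right (m := 1) (by norm_cast)).differentiableAt (by simp)

/-- `Form.d` at f y₀ is computed in the same chart in which `pull_eventuallyEq` reads f, so
naturality of d on vector spaces suffices. In particular no independence of the chart has to be
shown beforehand. -/
theorem Form.extDeriv_pull {n : ℕ} {η : Form I X n} (hη : η.Smooth) {f : E' → X} {y₀ : E'}
    (hf : ContMDiffAt 𝓘(ℝ, E') I ∞ f y₀) :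
    extDeriv (η.pull f) y₀ = (η.d.val (f y₀)).compContinuousLinearMap (tmap 𝓘(ℝ, E') I f y₀) := by
  have hτ := contDiffAt_extChartAt_comp hf
  have h1 := tmap_comp (mdifferentiableAt_extChartAt (I := I) (mem_chart_source H (f y₀)))
    (hf.mdifferentiableAt (by simp))
  rw [tmap_eq_fderiv] at h1
  rw [(η.pull_eventuallyEq hf).extDeriv_eq]
  have h2 := extDeriv_pullback (f := fun y => extChartAt I (f y₀) (f y))
    (Form.differentiableAt_inChart hη (f y₀) (mem_extChartAt_target _)) hτ
    (by rw [minSmoothness_of_isRCLikeNormedField]; exact WithTop.coe_le_coe.2 le_top)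
  rw [h2, h1]
  unfold Form.val Form.d
  rw [I.range_eq_univ, extDerivWithin_univ]
  rfl

end Pullback

/-! ### Exterior derivative of a partially known form on a product -/

section ExtDerivProd

variable {A B : Type*} [NormedAddCommGroup A] [NormedSpace ℝ A]
    [NormedAddCommGroup B] [NormedSpace ℝ B]

/-- The exterior derivative of a form on `A × B` which, in the directions that matter, is a multiple
of the pullback of a form on `B`. -/
theorem extDeriv_prod_apply {n : ℕ} {α : A × B → (A × B) [⋀^Fin n]→L[ℝ] ℝ}
    {β : B → B [⋀^Fin n]→L[ℝ] ℝ} {p₀ : A × B} (hα : DifferentiableAt ℝ α p₀)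
    (hβ : DifferentiableAt ℝ β p₀.2) {c : ℝ} {a : A}
    (h1 : ∀ᶠ p in 𝓝 p₀, ∀ v : Fin n → B, α p (fun i => (0, v i)) = c * β p.2 v)
    (h2 : ∀ᶠ x in 𝓝 p₀.2, ∀ (r : Fin n → ℝ) (v : Fin n → B),
      α (p₀.1, x) (fun i => (r i • a, v i)) = c * β x v) (h : B) (e : Fin n → B) :
    extDeriv α p₀ (Fin.cons (a, h) fun i => (0, e i)) = c * extDeriv β p₀.2 (Fin.cons h e) := by
  have hval : ∀ w : Fin n → B, DifferentiableAt ℝ (fun x => β x w) p₀.2 := fun w =>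
    ((ContinuousAlternatingMap.apply ℝ B ℝ w).differentiableAt).comp p₀.2 hβ
  have hval' : ∀ w : Fin n → A × B, DifferentiableAt ℝ (fun p => α p w) p₀ := fun w =>
    ((ContinuousAlternatingMap.apply ℝ (A × B) ℝ w).differentiableAt).comp p₀ hα
  rw [extDeriv_apply hα, extDeriv_apply hβ, Finset.mul_sum]
  refine Finset.sum_congr rfl fun i _ => ?_
  rw [mul_smul_comm]
  congr 1
  refine Fin.cases ?_ (fun j => ?_) i
  -- The derivative along (a, h) leaves the slice through p₀, so the comparison is needed on a full
  -- neighbourhood, but only on vectors with zero A-component.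
  · simp only [Fin.removeNth_zero, Fin.tail_cons, Fin.cons_zero]
    have e1 : (fun p => α p fun i => ((0 : A), e i)) =ᶠ[𝓝 p₀] fun p => c * β p.2 e := by
      filter_upwards [h1] with p hp using hp e
    rw [e1.fderiv_eq]
    have e2 : HasFDerivAt (fun p : A × B => c * β p.2 e) _ p₀ :=
      ((hval e).hasFDerivAt.comp p₀ hasFDerivAt_snd).const_mul c
    rw [e2.fderiv]
    rfl
  -- The derivative along (0, e j) stays in the slice, where the comparison is available for vectors
  -- whose A-components are multiples of a.
  · simp only [Fin.cons_succ]
    -- The coefficient of a in each remaining vector: 1 for (a, h) and 0 for the vectors (0, e i).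
    set r : Fin n → ℝ := (j.succ).removeNth (Fin.cons 1 (fun _ => 0) : Fin (n + 1) → ℝ) with hr
    set w : Fin n → B := (j.succ).removeNth (Fin.cons h e : Fin (n + 1) → B) with hw
    have e0 : (j.succ).removeNth (Fin.cons (a, h) fun i => ((0 : A), e i) : Fin (n + 1) → A × B) =
        fun i => (r i • a, w i) := by
      funext i
      simp only [hr, hw, Fin.removeNth]
      refine Fin.cases ?_ (fun k => ?_) (j.succ.succAbove i) <;> simp
    rw [e0]
    have e1 : (fun x => α (p₀.1, x) fun i => (r i • a, w i)) =ᶠ[𝓝 p₀.2] fun x => c * β x w := by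
      filter_upwards [h2] with x hx using hx r w
    have e2 := HasFDerivAt.comp (𝕜 := ℝ) (f := fun x : B => (p₀.1, x)) p₀.2
      (hval' fun i => (r i • a, w i)).hasFDerivAt (hasFDerivAt_prodMk_right p₀.1 p₀.2)
    simp only [Function.comp_def] at e2
    have e3 := e1.fderiv_eq (𝕜 := ℝ)
    rw [e2.fderiv, ((hval w).hasFDerivAt.const_mul c).fderiv] at e3
    simpa using DFunLike.congr_fun e3 (e j)

end ExtDerivProd

/-! ### Chart differentials and the Lie bracket at a zero of a field -/

section ChartMaps

variable {E H X : Type*} [NormedAddCommGroup E] [NormedSpace ℝ E] [TopologicalSpace H]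
    {I : ModelWithCorners ℝ E H} [TopologicalSpace X] [ChartedSpace H X]
    [IsManifold I ∞ X] [I.Boundaryless]

theorem tmap_extChartAt_comp_symm (x₀ : X) {y : E} (hy : y ∈ (extChartAt I x₀).target) :
    (tmap I 𝓘(ℝ, E) (extChartAt I x₀) ((extChartAt I x₀).symm y)).comp
      (tmap 𝓘(ℝ, E) I (extChartAt I x₀).symm y) = ContinuousLinearMap.id ℝ E := by
  rw [← chartSymmDeriv_eq]
  exact mfderiv_extChartAt_comp_mfderivWithin_extChartAt_symm hy

theorem tmap_extChartAt_symm_comp (x₀ : X) {y : E} (hy : y ∈ (extChartAt I x₀).target) :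
    (tmap 𝓘(ℝ, E) I (extChartAt I x₀).symm y).comp
      (tmap I 𝓘(ℝ, E) (extChartAt I x₀) ((extChartAt I x₀).symm y)) =
      ContinuousLinearMap.id ℝ E := by
  rw [← chartSymmDeriv_eq]
  exact mfderivWithin_extChartAt_symm_comp_mfderiv_extChartAt hy

theorem tmap_extChartAt_self (x₀ : X) :
    tmap I 𝓘(ℝ, E) (extChartAt I x₀) x₀ = ContinuousLinearMap.id ℝ E :=
  mfderiv_extChartAt_self

theorem tmap_extChartAt_symm_self (x₀ : X) :
    tmap 𝓘(ℝ, E) I (extChartAt I x₀).symm (extChartAt I x₀ x₀) = ContinuousLinearMap.id ℝ E := by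
  rw [← chartSymmDeriv_eq]
  exact mfderivWithin_range_extChartAt_symm

theorem inverse_mfderiv_extChartAt (x₀ : X) {y : E} (hy : y ∈ (extChartAt I x₀).target) :
    ((mfderiv I 𝓘(ℝ, E) (extChartAt I x₀) ((extChartAt I x₀).symm y)).inverse : E →L[ℝ] E) =
      tmap 𝓘(ℝ, E) I (extChartAt I x₀).symm y :=
  ContinuousLinearMap.inverse_eq (M := E) (M₂ := E) (tmap_extChartAt_comp_symm x₀ hy)
    (tmap_extChartAt_symm_comp x₀ hy)

theorem inverse_mfderivWithin_extChartAt_symm (x₀ : X) {y : E} (hy : y ∈ (extChartAt I x₀).target) :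
    ((mfderivWithin 𝓘(ℝ, E) I (extChartAt I x₀).symm (Set.range I) y).inverse : E →L[ℝ] E) =
      tmap I 𝓘(ℝ, E) (extChartAt I x₀) ((extChartAt I x₀).symm y) := by
  refine ContinuousLinearMap.inverse_eq (M := E) (M₂ := E) ?_ ?_
  · exact mfderivWithin_extChartAt_symm_comp_mfderiv_extChartAt hy
  · exact mfderiv_extChartAt_comp_mfderivWithin_extChartAt_symm hy

/-- The expression of a vector field in the preferred chart at `x₀`. -/
noncomputable def vectorInChart (W : ∀ x : X, TangentSpace I x) (x₀ : X) (y : E) : E :=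
  tmap I 𝓘(ℝ, E) (extChartAt I x₀) ((extChartAt I x₀).symm y) (W ((extChartAt I x₀).symm y))

/-- In a chart [V, W] = DW(V) - DV(W), and the second term vanishes with W. The vector b is the
value of V in the chart, left unspecified since later arguments treat all b alike. -/
theorem mlieBracket_of_eq_zero {V W : ∀ x : X, TangentSpace I x} {x₀ : X} (hW : W x₀ = 0) :
    ∃ b : E, (VectorField.mlieBracket I V W x₀ : E) =
      fderiv ℝ (vectorInChart W x₀) (extChartAt I x₀ x₀) b := by
  have hev : (VectorField.mpullbackWithin 𝓘(ℝ, E) I (extChartAt I x₀).symm W (Set.range I) : E → E)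
      =ᶠ[𝓝 (extChartAt I x₀ x₀)] vectorInChart W x₀ := by
    filter_upwards [(isOpen_extChartAt_target x₀).mem_nhds (mem_extChartAt_target (I := I) x₀)]
      with y hy
    exact DFunLike.congr_fun (inverse_mfderivWithin_extChartAt_symm x₀ hy) _
  have hW0 : vectorInChart W x₀ (extChartAt I x₀ x₀) = 0 := by
    have : ∀ x, x = x₀ → tmap I 𝓘(ℝ, E) (extChartAt I x₀) x (W x) = 0 := by
      rintro _ rfl
      exact (congrArg _ hW).trans (map_zero _)
    exact this _ (extChartAt_to_inv x₀)
  have h1 := VectorField.mlieBracketWithin_apply (I := I) (V := V) (W := W) (s := Set.univ) (x₀ :=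
      x₀)
  rw [I.range_eq_univ, Set.preimage_univ, Set.univ_inter] at h1
  rw [I.range_eq_univ] at hev
  refine ⟨VectorField.mpullbackWithin 𝓘(ℝ, E) I (extChartAt I x₀).symm V Set.univ
    (extChartAt I x₀ x₀), h1.trans ?_⟩
  have h2 : ((mfderiv I 𝓘(ℝ, E) (extChartAt I x₀) x₀).inverse : E →L[ℝ] E) =
      ContinuousLinearMap.id ℝ E := by
    rw [mfderiv_extChartAt_self]
    exact ContinuousLinearMap.inverse_id
  refine (DFunLike.congr_fun h2 _).trans ?_
  have h3 : ∀ V W : E → E, VectorField.lieBracketWithin ℝ V W Set.univ (extChartAt I x₀ x₀) =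
      fderiv ℝ W (extChartAt I x₀ x₀) (V (extChartAt I x₀ x₀)) -
        fderiv ℝ V (extChartAt I x₀ x₀) (W (extChartAt I x₀ x₀)) := fun V W => by
    rw [VectorField.lieBracketWithin_univ, VectorField.lieBracket]
  refine (h3 _ _).trans ?_
  refine (congrArg₂ (· - ·) (congrArg (fun L : E →L[ℝ] E => L _) hev.fderiv_eq)
    ((congrArg _ (hev.self_of_nhds.trans hW0)).trans (map_zero _))).trans ?_
  exact sub_zero _

end ChartMaps

/-- Because W vanishes at y₀, A kills the difference quotients of W along a line through y₀ at
nearby points; continuity of A then suffices for the limit. If W is not differentiable, its `fderiv`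
is zero by convention. -/
theorem clm_apply_fderiv_eq_zero {E F : Type*} [NormedAddCommGroup E] [NormedSpace ℝ E]
    [NormedAddCommGroup F] [NormedSpace ℝ F]
    {A : E → F →L[ℝ] F} {W : E → F} {y₀ : E} (hA : ContinuousAt A y₀) (hW : W y₀ = 0)
    (h : ∀ᶠ y in 𝓝 y₀, A y (W y) = 0) (b : E) : A y₀ (fderiv ℝ W y₀ b) = 0 := by
  by_cases hd : DifferentiableAt ℝ W y₀
  · have hl : HasDerivAt (fun t : ℝ => y₀ + t • b) b 0 := by
      simpa using ((hasDerivAt_id (0 : ℝ)).smul_const b).const_add y₀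
    have h0 : y₀ + (0 : ℝ) • b = y₀ := by simp
    have h1 : HasDerivAt (fun t : ℝ => W (y₀ + t • b)) (fderiv ℝ W y₀ b) 0 := by
      have := hd.hasFDerivAt
      rw [← h0] at this
      simpa [Function.comp_def] using this.comp_hasDerivAt (0 : ℝ) hl
    have h2 := (hasDerivAt_iff_tendsto_slope.1 h1)
    have hc : Filter.Tendsto (fun t : ℝ => y₀ + t • b) (𝓝[≠] 0) (𝓝 y₀) := by
      have := hl.continuousAt.tendsto
      rw [h0] at this
      exact this.mono_left nhdsWithin_le_nhds
    have h3 := ((isBoundedBilinearMap_apply (𝕜 := ℝ)).continuous.tendsto _).comp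
      ((hA.tendsto.comp hc).prodMk_nhds h2)
    refine tendsto_nhds_unique h3 (tendsto_const_nhds.congr' ?_)
    filter_upwards [hc.eventually h] with t ht
    simp [slope_def_module, hW, ht]
  · simp [fderiv_zero_of_not_differentiableAt hd]

/-! ### Vanishing of the Frobenius tensor on vertical vectors -/

namespace FamilyData

variable {E H E' H' X S : Type*} [NormedAddCommGroup E] [NormedSpace ℝ E]
    [TopologicalSpace H] {I : ModelWithCorners ℝ E H} [TopologicalSpace X] [ChartedSpace H X]
    [NormedAddCommGroup E'] [NormedSpace ℝ E'] [TopologicalSpace H'] {J : ModelWithCorners ℝ E' H'}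
    [TopologicalSpace S] [ChartedSpace H' S] {D : FamilyData I J X S}
    [IsManifold I ∞ X] [I.Boundaryless]

/-- The field `horExtend` in the preferred chart. -/
theorem horExtend_inChart (x₀ : X) (e : E) {y : E} (hy : y ∈ (extChartAt I x₀).target) :
    vectorInChart (D.horExtend x₀ e) x₀ y =
      tmap I 𝓘(ℝ, E) (extChartAt I x₀) ((extChartAt I x₀).symm y)
        (D.horProj ((extChartAt I x₀).symm y)
          (tmap 𝓘(ℝ, E) I (extChartAt I x₀).symm y e)) := by
  unfold vectorInChart horExtend
  refine congrArg (tmap I 𝓘(ℝ, E) (extChartAt I x₀) ((extChartAt I x₀).symm y))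
    (congrArg (D.horProj ((extChartAt I x₀).symm y)) ?_)
  refine (DFunLike.congr_fun (inverse_mfderiv_extChartAt x₀ hy) _).trans ?_
  exact congrArg _ (DFunLike.congr_fun (tmap_extChartAt_self x₀) e)

/-- The condition under which the Frobenius tensor annihilates the vertical vector `e`. -/
def FrobeniusVanishes (D : FamilyData I J X S) (x₀ : X) (e : TangentSpace I x₀) : Prop :=
  ∀ b : E, D.vertProj x₀
    (fderiv ℝ (vectorInChart (D.horExtend x₀ e) x₀) (extChartAt I x₀ x₀) b : E) = 0

theorem HorBijectiveAt.horExtend_self {x₀ : X} (hb : D.HorBijectiveAt x₀) {e : TangentSpace I x₀}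
    (he : e ∈ D.vert x₀) : D.horExtend x₀ e x₀ = 0 := by
  have h1 : D.horExtend x₀ e x₀ = D.horProj x₀ e := by
    unfold horExtend
    rw [mfderiv_extChartAt_self]
    refine congrArg (D.horProj x₀) ?_
    exact DFunLike.congr_fun (ContinuousLinearMap.inverse_id (R := ℝ) (M := E)) e
  rw [h1]
  exact sub_eq_zero.2 (hb.vertProj_of_mem_vert he).symm

/-- The extension of a vertical e vanishes at x₀, so the bracket is a derivative of that extension,
with no vertical part by assumption. Antisymmetry of the bracket settles the other slot. -/
theorem HorBijectiveAt.frobenius_eq_zero {x₀ : X} (hb : D.HorBijectiveAt x₀) {e : TangentSpace I x₀}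
    (he : e ∈ D.vert x₀) (h : D.FrobeniusVanishes x₀ e) (u : TangentSpace I x₀) :
    D.frobenius x₀ u e = 0 ∧ D.frobenius x₀ e u = 0 := by
  have h0 := hb.horExtend_self he
  have h1 : D.vertProj x₀ (VectorField.mlieBracket I (D.horExtend x₀ u) (D.horExtend x₀ e) x₀) = 0
      := by
    obtain ⟨b, hb⟩ := mlieBracket_of_eq_zero (V := D.horExtend x₀ u) h0
    exact (congrArg (D.vertProj x₀) hb).trans (h b)
  constructor
  · unfold frobenius
    rw [h1, neg_zero]
  · unfold frobenius
    rw [VectorField.mlieBracket_swap_apply, map_neg, h1, neg_zero, neg_zero]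

/-- The trivialization of the tangent bundle at x₀ is, over the chart domain, the differential of
the chart at x₀. -/
theorem contMDiffAt_vectorField_iff {x₀ : X} (V : ∀ x : X, TangentSpace I x) :
    ContMDiffAt I I.tangent ∞ (fun x => (⟨x, V x⟩ : TangentBundle I X)) x₀ ↔
      ContMDiffAt I 𝓘(ℝ, E) ∞ (fun x => tmap I 𝓘(ℝ, E) (extChartAt I x₀) x (V x)) x₀ := by
  refine (Bundle.contMDiffAt_section (IB := I) (F := E) (E := TangentSpace I) (s := V) x₀).trans ?_
  refine Filter.EventuallyEq.contMDiffAt_iff ?_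
  filter_upwards [chart_source_mem_nhds H x₀] with x hx
  have h1 := DFunLike.congr_fun (TangentBundle.continuousLinearMapAt_trivializationAt (I := I) hx)
    (V x)
  refine Eq.trans ?_ h1
  rw [Bundle.Trivialization.continuousLinearMapAt_apply,
    Bundle.Trivialization.coe_linearMapAt_of_mem]
  simpa using hx

variable (D) in
/-- The vertical projection in the preferred chart at `x₀`. -/
noncomputable def vertProjInChart [FiniteDimensional ℝ E] (x₀ : X) (y : E) : E →L[ℝ] E :=
  LinearMap.toContinuousLinearMap
    ((tmap I 𝓘(ℝ, E) (extChartAt I x₀) ((extChartAt I x₀).symm y)).toLinearMap ∘ₗ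
      ((D.vert ((extChartAt I x₀).symm y)).subtype ∘ₗ D.vertProj ((extChartAt I x₀).symm y) :
        E →ₗ[ℝ] E) ∘ₗ
      (tmap 𝓘(ℝ, E) I (extChartAt I x₀).symm y).toLinearMap)

theorem vertProjInChart_apply [FiniteDimensional ℝ E] (x₀ : X) (y w : E) :
    D.vertProjInChart x₀ y w =
      tmap I 𝓘(ℝ, E) (extChartAt I x₀) ((extChartAt I x₀).symm y)
        (D.vertProj ((extChartAt I x₀).symm y) (tmap 𝓘(ℝ, E) I (extChartAt I x₀).symm y w)).1 := rfl

/-- In finite dimension continuity can be tested on each vector w, and the vertical part of the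
field that is constantly w in the chart is smooth by `hs`. -/
theorem continuousAt_vertProjInChart [FiniteDimensional ℝ E]
    (hs : ∀ (x₀ : X) (V : ∀ x : X, TangentSpace I x),
    ContMDiffAt I I.tangent ∞ (fun x => (⟨x, V x⟩ : TangentBundle I X)) x₀ →
    ContMDiffAt I I.tangent ∞ (fun x => (⟨x, D.vertProj x (V x)⟩ : TangentBundle I X)) x₀) (x₀ : X)
        :
    ContinuousAt (D.vertProjInChart x₀) (extChartAt I x₀ x₀) := by
  rw [continuousAt_clm_apply]
  intro w
  have hV : ContMDiffAt I 𝓘(ℝ, E) ∞ (fun x => tmap I 𝓘(ℝ, E) (extChartAt I x₀) x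
      (tmap 𝓘(ℝ, E) I (extChartAt I x₀).symm (extChartAt I x₀ x) w)) x₀ := by
    refine (contMDiffAt_const (c := w)).congr_of_eventuallyEq ?_
    filter_upwards [extChartAt_source_mem_nhds (I := I) x₀] with x hx
    have h3 := DFunLike.congr_fun (tmap_extChartAt_comp_symm x₀ ((extChartAt I x₀).map_source hx)) w
    rw [(extChartAt I x₀).left_inv hx] at h3
    exact h3
  have h2 := ((contMDiffAt_vectorField_iff _).1 (hs x₀
    (fun x => (tmap 𝓘(ℝ, E) I (extChartAt I x₀).symm (extChartAt I x₀ x) w : E))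
    ((contMDiffAt_vectorField_iff _).2 hV))).continuousAt
  have h3 : ContinuousAt (extChartAt I x₀).symm (extChartAt I x₀ x₀) :=
    continuousAt_extChartAt_symm x₀
  have h4 := ContinuousAt.comp_of_eq h2 h3 (extChartAt_to_inv x₀)
  refine h4.congr ?_
  filter_upwards [(isOpen_extChartAt_target x₀).mem_nhds (mem_extChartAt_target (I := I) x₀)]
    with y hy
  simp only [Function.comp_apply]
  rw [(extChartAt I x₀).right_inv hy]
  rfl

/-- The chart expression of the extension vanishes at the centre and is killed everywhere nearby by
the vertical projection, which is continuous; so the derivative at the centre is killed too. -/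
theorem frobeniusVanishes_of_smooth [FiniteDimensional ℝ E] (hb : ∀ x, D.HorBijectiveAt x)
    (hs : ∀ (x₀ : X) (V : ∀ x : X, TangentSpace I x),
    ContMDiffAt I I.tangent ∞ (fun x => (⟨x, V x⟩ : TangentBundle I X)) x₀ →
    ContMDiffAt I I.tangent ∞ (fun x => (⟨x, D.vertProj x (V x)⟩ : TangentBundle I X)) x₀) {x₀ : X}
    {e : TangentSpace I x₀} (he : e ∈ D.vert x₀) : D.FrobeniusVanishes x₀ e := by
  intro b
  have h0 : vectorInChart (D.horExtend x₀ e) x₀ (extChartAt I x₀ x₀) = 0 := by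
    have : ∀ x, x = x₀ → tmap I 𝓘(ℝ, E) (extChartAt I x₀) x (D.horExtend x₀ e x) = 0 := by
      rintro _ rfl
      exact (congrArg _ ((hb _).horExtend_self he)).trans (map_zero _)
    exact this _ (extChartAt_to_inv x₀)
  have h1 : ∀ᶠ y in 𝓝 (extChartAt I x₀ x₀),
      D.vertProjInChart x₀ y (vectorInChart (D.horExtend x₀ e) x₀ y) = 0 := by
    filter_upwards [(isOpen_extChartAt_target x₀).mem_nhds (mem_extChartAt_target (I := I) x₀)]
      with y hy
    rw [horExtend_inChart (E := E) x₀ e hy, vertProjInChart_apply]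
    have h2 := DFunLike.congr_fun (tmap_extChartAt_symm_comp x₀ hy)
      (D.horProj ((extChartAt I x₀).symm y) (tmap 𝓘(ℝ, E) I (extChartAt I x₀).symm y e))
    refine (congrArg (tmap I 𝓘(ℝ, E) (extChartAt I x₀) ((extChartAt I x₀).symm y)) ?_).trans
      (map_zero _)
    refine (congrArg (fun v : E => (D.vertProj ((extChartAt I x₀).symm y) v).1) h2).trans ?_
    exact congrArg Subtype.val (HorBijectiveAt.vertProj_of_mem_hor (hb _)
      (HorBijectiveAt.horProj_mem (hb _) _))
  have h3 := clm_apply_fderiv_eq_zero (D.continuousAt_vertProjInChart hs x₀) h0 h1 b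
  rw [vertProjInChart_apply, tmap_extChartAt_symm_self] at h3
  have h4 : ∀ (x : X) (v : E), x = x₀ →
      tmap I 𝓘(ℝ, E) (extChartAt I x₀) x (D.vertProj x v).1 = (D.vertProj x₀ v).1 := by
    rintro _ v rfl
    rw [tmap_extChartAt_self]
    rfl
  exact Subtype.ext ((h4 _ _ (extChartAt_to_inv x₀)).symm.trans h3)

end FamilyData

/-- No differentiability of W is assumed: both sides take the default value zero when it fails. -/
theorem fderiv_zero_prodMk_comp_snd {A B F : Type*} [NormedAddCommGroup A] [NormedSpace ℝ A]
    [NormedAddCommGroup B] [NormedSpace ℝ B] [NormedAddCommGroup F] [NormedSpace ℝ F]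
    (W : B → F) (p b : A × B) :
    fderiv ℝ (fun p : A × B => ((0 : A), W p.2)) p b = (0, fderiv ℝ W p.2 b.2) := by
  by_cases hd : DifferentiableAt ℝ W p.2
  · have h : HasFDerivAt (fun p : A × B => ((0 : A), W p.2)) _ p :=
      (hasFDerivAt_const (0 : A) p).prodMk (hd.hasFDerivAt.comp p hasFDerivAt_snd)
    rw [h.fderiv]
    rfl
  · have hd' : ¬ DifferentiableAt ℝ (fun p : A × B => ((0 : A), W p.2)) p := fun h => hd
      (h.snd.comp (f := fun x : B => (p.1, x)) p.2
        (hasFDerivAt_prodMk_right p.1 p.2).differentiableAt)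
    rw [fderiv_zero_of_not_differentiableAt hd, fderiv_zero_of_not_differentiableAt hd']
    rfl

namespace PrincipalBundle

/-! ### The Frobenius tensor of the associated family on vertical vectors -/

section AssocFrobenius

variable {EG EQ EM EX ES G Q M X S : Type*}
    [NormedAddCommGroup EG] [NormedSpace ℝ EG] [NormedAddCommGroup EQ] [NormedSpace ℝ EQ]
    [NormedAddCommGroup EM] [NormedSpace ℝ EM]
    [NormedAddCommGroup EX] [NormedSpace ℝ EX] [NormedAddCommGroup ES] [NormedSpace ℝ ES]
    [Group G] [TopologicalSpace G] [ChartedSpace EG G] [LieGroup 𝓘(ℝ, EG) ∞ G]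
    [TopologicalSpace Q] [ChartedSpace EQ Q] [TopologicalSpace M] [ChartedSpace EM M]
    [IsManifold 𝓘(ℝ, EQ) ∞ Q] [IsManifold 𝓘(ℝ, EM) ∞ M]
    [TopologicalSpace X] [ChartedSpace EX X] [IsManifold 𝓘(ℝ, EX) ∞ X]
    [TopologicalSpace S] [ChartedSpace ES S] [IsManifold 𝓘(ℝ, ES) ∞ S]
    [MulAction G X] [ContinuousSMul G X] [ContMDiffSMul 𝓘(ℝ, EG) 𝓘(ℝ, EX) ∞ G X]
    [MulAction G S] [ContinuousSMul G S] [ContMDiffSMul 𝓘(ℝ, EG) 𝓘(ℝ, ES) ∞ G S]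
    [MulAction Gᵐᵒᵖ Q] {P : PrincipalBundle EG EQ EM G Q M}

/-- The differential of `(a, x) ↦ [s a, x]`, with `x` read in a chart. -/
theorem tmap_assocMk_prod {A : Type*} [NormedAddCommGroup A] [NormedSpace ℝ A] (s : A → Q) (x₀ : X)
    {p : A × EX} (hs : MDifferentiableAt 𝓘(ℝ, A) 𝓘(ℝ, EQ) s p.1)
    (hp : p.2 ∈ (extChartAt 𝓘(ℝ, EX) x₀).target) (w : A × EX) :
    tmap 𝓘(ℝ, A × EX) (𝓘(ℝ, EM).prod 𝓘(ℝ, EX))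
      (fun p => P.assocMk (s p.1, (extChartAt 𝓘(ℝ, EX) x₀).symm p.2)) p w =
    P.assocT (s p.1, (extChartAt 𝓘(ℝ, EX) x₀).symm p.2)
      (tmap 𝓘(ℝ, A) 𝓘(ℝ, EQ) s p.1 w.1,
        tmap 𝓘(ℝ, EX) 𝓘(ℝ, EX) (extChartAt 𝓘(ℝ, EX) x₀).symm p.2 w.2) := by
  have h1 : MDifferentiableAt 𝓘(ℝ, A × EX) 𝓘(ℝ, A) (fun p : A × EX => p.1) p :=
    differentiableAt_fst.mdifferentiableAt
  have h2 : MDifferentiableAt 𝓘(ℝ, A × EX) 𝓘(ℝ, EX) (fun p : A × EX => p.2) p :=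
    differentiableAt_snd.mdifferentiableAt
  have hc := mdifferentiableAt_extChartAt_symm (I := 𝓘(ℝ, EX)) x₀ hp
  have h3 : MDifferentiableAt 𝓘(ℝ, A × EX) 𝓘(ℝ, EQ) (fun p : A × EX => s p.1) p := hs.comp p h1
  have h4 : MDifferentiableAt 𝓘(ℝ, A × EX) 𝓘(ℝ, EX)
    (fun p : A × EX => (extChartAt 𝓘(ℝ, EX) x₀).symm p.2) p := hc.comp p h2
  have h5 := tmap_comp (g := P.assocMk (Y := X))
    (f := fun p : A × EX => (s p.1, (extChartAt 𝓘(ℝ, EX) x₀).symm p.2))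
    (P.mdifferentiableAt_assocMk (EY := EX) _) (h3.prodMk h4)
  rw [h5, tmap_prodMk h3 h4, tmap_comp (f := fun p : A × EX => p.1) hs h1,
    tmap_comp (f := fun p : A × EX => p.2) hc h2, tmap_eq_fderiv, tmap_eq_fderiv, fderiv_fst,
    fderiv_snd]
  rfl

variable {Φ : P.Connection} {D : FamilyData 𝓘(ℝ, EX) 𝓘(ℝ, ES) X S} {hG : D.IsInvariant G}

theorem assocFamily_horProj (hπ : ContMDiff 𝓘(ℝ, EX) 𝓘(ℝ, ES) ∞ D.proj)
    (hb : ∀ x, D.HorBijectiveAt x) (z : Q × X) (v : EX) :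
    ((assocFamily Φ D hG).horProj (P.assocMk z) (P.assocT z (0, v)) : EM × EX) =
      P.assocT (EY := EX) z (0, D.horProj z.2 v) := by
  have h := assocFamily_vertProj (Φ := Φ) (hG := hG) hπ hb z v (map_zero _)
  refine (congrArg (fun w : EM × EX => P.assocT z (0, v) - w) h).trans ?_
  exact (assocT_sub z v _).symm

/-- In the preferred chart of X_Q the extension of a vertical vector (0, e') is (0, extension of e'
in the chart of X), so the condition is inherited from X. This avoids proving that H_Q is a smooth
distribution. -/
theorem assocFamily_frobeniusVanishes (hπ : ContMDiff 𝓘(ℝ, EX) 𝓘(ℝ, ES) ∞ D.proj)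
    (hb : ∀ x, D.HorBijectiveAt x)
    (hF : ∀ (x : X) (e : TangentSpace 𝓘(ℝ, EX) x), e ∈ D.vert x → D.FrobeniusVanishes x e)
    (y₀ : P.Assoc X) {e : EM × EX} (he : e ∈ (assocFamily Φ D hG).vert y₀) :
    (assocFamily Φ D hG).FrobeniusVanishes y₀ e := by
  set t := P.trivAt y₀ with ht
  set x₀ : X := (assocFun t y₀).2 with hx₀
  set m₀ : M := P.assocBase y₀ with hm₀
  set cX := extChartAt 𝓘(ℝ, EX) x₀ with hcX
  set cM := extChartAt 𝓘(ℝ, EM) m₀ with hcM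
  set c := extChartAt (𝓘(ℝ, EM).prod 𝓘(ℝ, EX)) y₀ with hc
  have hsymm : (c.symm : EM × EX → P.Assoc X) =
      fun p => P.assocMk (t.sec (cM.symm p.1), cX.symm p.2) :=
    funext fun p => P.extChartAt_assoc_symm_apply y₀ p
  have hm1 : (assocFun t y₀).1 = m₀ := by
    conv_rhs => rw [hm₀, ← P.assocMk_out y₀]
    rfl
  have hc1 : (c y₀).1 = cM m₀ := by
    have h1 : (c y₀).1 = extChartAt 𝓘(ℝ, EM) (assocFun t y₀).1 (assocFun t y₀).1 := rfl
    rw [h1, hm1]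
  have hc2 : (c y₀).2 = cX x₀ := rfl
  have hmb : m₀ ∈ t.base := P.assocBase_mem_trivAt y₀
  -- the points close to the centre of the chart
  have hgood : ∀ᶠ p in 𝓝 (c y₀), p ∈ c.target ∧ p.2 ∈ cX.target ∧
      MDifferentiableAt 𝓘(ℝ, EM) 𝓘(ℝ, EQ) (fun m => t.sec (cM.symm m)) p.1 := by
    have hM : ∀ᶠ m in 𝓝 (cM m₀), m ∈ cM.target ∧ cM.symm m ∈ t.base := by
      refine ((isOpen_extChartAt_target m₀).eventually_mem (mem_extChartAt_target m₀)).and ?_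
      refine (continuousAt_extChartAt_symm m₀).eventually ?_
      rw [extChartAt_to_inv]
      exact t.isOpen_base.mem_nhds hmb
    have hX : ∀ᶠ x in 𝓝 (cX x₀), x ∈ cX.target :=
      (isOpen_extChartAt_target x₀).eventually_mem (mem_extChartAt_target x₀)
    rw [← hc1] at hM
    rw [← hc2] at hX
    filter_upwards [(isOpen_extChartAt_target y₀).eventually_mem (mem_extChartAt_target y₀),
      continuousAt_fst.eventually hM, continuousAt_snd.eventually hX] with p hp1 hp2 hp3
    refine ⟨hp1, hp3, ?_⟩
    exact ((t.smooth_sec.contMDiffAt (t.isOpen_base.mem_nhds hp2.2)).mdifferentiableAt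
      (by simp)).comp p.1 (mdifferentiableAt_extChartAt_symm m₀ hp2.1)
  -- The inverse chart is (m, x) ↦ [sec m, x] in charts, so a vector without M-component is the
  -- image under q_X of a vector without Q-component.
  have hder : ∀ p : EM × EX, p.2 ∈ cX.target →
      MDifferentiableAt 𝓘(ℝ, EM) 𝓘(ℝ, EQ) (fun m => t.sec (cM.symm m)) p.1 → ∀ b : EX,
      tmap 𝓘(ℝ, EM × EX) (𝓘(ℝ, EM).prod 𝓘(ℝ, EX)) c.symm p (0, b) =
        P.assocT (t.sec (cM.symm p.1), cX.symm p.2)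
          (0, tmap 𝓘(ℝ, EX) 𝓘(ℝ, EX) cX.symm p.2 b) := by
    intro p hp hs b
    rw [hsymm]
    exact (tmap_assocMk_prod (fun m => t.sec (cM.symm m)) x₀ hs hp (0, b)).trans (by rw [map_zero])
  -- the differential of the chart at its centre is the identity
  have hid : ∀ b : EX, P.assocT (t.sec m₀, x₀) (0, b) = (0, b) := by
    intro b
    have h1 := hder (c y₀) hgood.self_of_nhds.2.1 hgood.self_of_nhds.2.2 b
    rw [hc1, hc2, hcM, hcX, extChartAt_to_inv, extChartAt_to_inv, tmap_extChartAt_symm_self,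
      tmap_extChartAt_symm_self] at h1
    exact h1.symm
  have hy₀ : y₀ = P.assocMk (t.sec m₀, x₀) := by
    rw [← hm1]
    exact (P.assocMk_assocSec y₀ hmb).symm
  obtain ⟨e', he', rfl⟩ : ∃ e' : EX, e' ∈ D.vert x₀ ∧ (0, e') = e := by
    rw [hy₀] at he
    obtain ⟨e', h1, h2⟩ := (mem_assocFamily_vert (Φ := Φ) (hG := hG) hπ).1 he
    exact ⟨e', h1, (hid e').symm.trans h2⟩
  -- An equality on a neighbourhood, since it is about to be differentiated. It holds because the
  -- horizontal projections of X_Q and X correspond under v ↦ q_*(0, v).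
  have hW : vectorInChart ((assocFamily Φ D hG).horExtend y₀ ((0, e') : EM × EX)) y₀
      =ᶠ[𝓝 (c y₀)] fun p => (0, vectorInChart (D.horExtend x₀ e') x₀ p.2) := by
    filter_upwards [hgood] with p hp
    obtain ⟨hpc, hpX, hps⟩ := hp
    rw [FamilyData.horExtend_inChart (E := EM × EX) y₀ (0, e') hpc,
      FamilyData.horExtend_inChart (E := EX) x₀ e' hpX]
    have h1 : ∀ (y : P.Assoc X) (z : Q × X) (w : EM × EX) (v : EX), y = P.assocMk z →
        w = P.assocT z (0, v) →
        ((assocFamily Φ D hG).horProj y w : EM × EX) = P.assocT (EY := EX) z (0, D.horProj z.2 v)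
            := by
      rintro _ z _ v rfl rfl
      exact assocFamily_horProj hπ hb z v
    have h2 := h1 _ _ _ _ (P.extChartAt_assoc_symm_apply y₀ p) (hder p hpX hps e')
    refine (congrArg (tmap (𝓘(ℝ, EM).prod 𝓘(ℝ, EX)) 𝓘(ℝ, EM × EX) c (c.symm p)) h2).trans ?_
    have h3 := DFunLike.congr_fun (tmap_extChartAt_symm_comp x₀ hpX)
      (D.horProj (cX.symm p.2) (tmap 𝓘(ℝ, EX) 𝓘(ℝ, EX) cX.symm p.2 e'))
    have h4 := hder p hpX hps (tmap 𝓘(ℝ, EX) 𝓘(ℝ, EX) cX (cX.symm p.2)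
      (D.horProj (cX.symm p.2) (tmap 𝓘(ℝ, EX) 𝓘(ℝ, EX) cX.symm p.2 e')))
    have h5 := h4.trans (congrArg (fun v : EX => P.assocT (t.sec (cM.symm p.1), cX.symm p.2) (0,
        v)) h3)
    refine (congrArg (tmap (𝓘(ℝ, EM).prod 𝓘(ℝ, EX)) 𝓘(ℝ, EM × EX) c (c.symm p)) h5.symm).trans ?_
    exact DFunLike.congr_fun (tmap_extChartAt_comp_symm y₀ hpc) _
  intro b
  have hd : fderiv ℝ (vectorInChart ((assocFamily Φ D hG).horExtend y₀ ((0, e') : EM × EX)) y₀)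
      (c y₀) b = P.assocT (t.sec m₀, x₀)
        (0, fderiv ℝ (vectorInChart (D.horExtend x₀ e') x₀) (cX x₀) b.2) := by
    rw [hid, hW.fderiv_eq, fderiv_zero_prodMk_comp_snd]
    rfl
  have h1 : ∀ (y : P.Assoc X) (w : EM × EX) (v : EX), y = P.assocMk (t.sec m₀, x₀) →
      w = P.assocT (t.sec m₀, x₀) (0, v) →
      ((assocFamily Φ D hG).vertProj y w).1 = P.assocT (EY := EX) (t.sec m₀, x₀)
        (0, (D.vertProj x₀ v).1) := by
    rintro _ _ v rfl rfl
    exact assocFamily_vertProj hπ hb (t.sec m₀, x₀) v (map_zero _)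
  refine Subtype.ext ((h1 _ _ _ hy₀ hd).trans ?_)
  refine (congrArg (fun v : D.vert x₀ => P.assocT (EY := EX) (t.sec m₀, x₀) (0, v.1))
    (hF x₀ e' he' b.2)).trans ?_
  exact map_zero _

end AssocFrobenius

end PrincipalBundle

/-! ### Orthonormal bases and alternating forms -/

section LinearAlgebra

variable {V : Type*} [AddCommGroup V] [Module ℝ V]

theorem exists_orthonormal_basis [FiniteDimensional ℝ V] {n : ℕ} (hn : Module.finrank ℝ V = n)
    (g : V → V → ℝ) (hadd : ∀ u v w, g (u + v) w = g u w + g v w)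
    (hsmul : ∀ (c : ℝ) u v, g (c • u) v = c * g u v) (hsymm : ∀ u v, g u v = g v u)
    (hpos : ∀ u, u ≠ 0 → 0 < g u u) :
    ∃ e : Module.Basis (Fin n) ℝ V, ∀ i j, g (e i) (e j) = if i = j then 1 else 0 := by
  have h0 : ∀ w, g 0 w = 0 := fun w => by simpa using hsmul 0 0 w
  let core : InnerProductSpace.Core ℝ V :=
    { inner := g
      conj_inner_symm := fun u v => hsymm v u
      re_inner_nonneg := fun u => by
        rcases eq_or_ne u 0 with rfl | hu
        · exact (h0 0).ge
        · exact (hpos u hu).le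
      add_left := hadd
      smul_left := fun u v c => hsmul c u v
      definite := fun u hu => by
        by_contra h
        exact (hpos u h).ne' hu }
  let _ : NormedAddCommGroup V := core.toNormedAddCommGroup
  let _ : InnerProductSpace ℝ V := InnerProductSpace.ofCore core.toCore
  subst hn
  refine ⟨(stdOrthonormalBasis ℝ V).toBasis, fun i j => ?_⟩
  have h := orthonormal_iff_ite.1 (stdOrthonormalBasis ℝ V).orthonormal i j
  rw [OrthonormalBasis.coe_toBasis]
  exact h

/-- A multilinear map which vanishes as soon as one of its arguments lies in `H` only depends on its
arguments modulo `H`. -/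
theorem multilinear_add_of_mem {n : ℕ} (f : MultilinearMap ℝ (fun _ : Fin n => V) ℝ)
    (H : Submodule ℝ V) (hf : ∀ v : Fin n → V, (∃ i, v i ∈ H) → f v = 0) (u w : Fin n → V)
    (hw : ∀ i, w i ∈ H) : f (fun i => u i + w i) = f u := by
  refine (f.map_add_univ u w).trans ?_
  -- The expansion runs over the sets s of slots filled by u; every s other than the full set leaves
  -- a slot filled by w, in H.
  rw [Finset.sum_eq_single Finset.univ, Finset.piecewise_univ]
  · intro s _ hs
    obtain ⟨i, hi⟩ : ∃ i, i ∉ s := by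
      by_contra! h
      exact hs (Finset.eq_univ_iff_forall.2 h)
    refine hf _ ⟨i, ?_⟩
    rw [Finset.piecewise_eq_of_notMem _ _ _ hi]
    exact hw i
  · exact fun h => (h (Finset.mem_univ _)).elim

/-- In top degree every alternating form is a multiple of the determinant of the basis. -/
theorem alternating_eq_mul {n : ℕ} (b : Module.Basis (Fin n) ℝ V) (f g : V [⋀^Fin n]→ₗ[ℝ] ℝ) {c : ℝ}
    (h : f b = c * g b) (v : Fin n → V) : f v = c * g v := by
  rw [f.eq_smul_basis_det b, g.eq_smul_basis_det b]
  simp only [AlternatingMap.smul_apply, smul_eq_mul, h]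
  ring

theorem wedgeTwoContract_eq_zero (β : V → V → ℝ) (e : V) {n : ℕ} (η : V [⋀^Fin n]→ₗ[ℝ] ℝ)
    (v : Fin (n + 1) → V) (h : ∀ i j, i ≠ j → β (v i) (v j) = 0) :
    wedgeTwoContract β e η v = 0 := by
  cases n with
  | zero => rfl
  | succ n =>
    simp only [wedgeTwoContract, wedgeTwo]
    rw [Finset.sum_eq_zero, mul_zero]
    refine fun i _ => Finset.sum_eq_zero fun j _ => ?_
    rw [Fin.removeNth_apply, h i (i.succAbove j) (Fin.succAbove_ne i j).symm]
    ring

theorem wedgeOne_cons {n : ℕ} (α : V → ℝ) (η : V [⋀^Fin n]→ₗ[ℝ] ℝ) (h : V) (e : Fin n → V)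
    (he : ∀ i, α (e i) = 0) : wedgeOne α η (Fin.cons h e : Fin (n + 1) → V) = α h * η e := by
  simp [wedgeOne, Fin.sum_univ_succ, he, Fin.removeNth_zero]

end LinearAlgebra

/-! ### Reading the mean curvature off dν, and the rank of the vertical bundle -/

namespace FamilyData

variable {E H E' H' X S : Type*} [NormedAddCommGroup E] [NormedSpace ℝ E]
    [TopologicalSpace H] {I : ModelWithCorners ℝ E H} [TopologicalSpace X] [ChartedSpace H X]
    [NormedAddCommGroup E'] [NormedSpace ℝ E'] [TopologicalSpace H'] {J : ModelWithCorners ℝ E' H'}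
    [TopologicalSpace S] [ChartedSpace H' S] {D : FamilyData I J X S}

/-- The mean curvature form is determined by `dν(h, e₁, …, eₙ) = k(h) ν(e₁, …, eₙ)`. -/
theorem IsMeanCurvature.d_cons [IsManifold I ∞ X] [I.Boundaryless] {n : ℕ} {ν : Form I X n} {k :
    OneForm I X}
    (hk : D.IsMeanCurvature ν k) {x : X} (hb : D.HorBijectiveAt x)
    (hF : ∀ e : TangentSpace I x, e ∈ D.vert x → D.FrobeniusVanishes x e)
    (hm : ∀ w, D.metric x 0 w = 0) {e : Fin n → D.vert x} (he : D.IsOrthonormal x e)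
    (h : TangentSpace I x) :
    Form.d ν x (Fin.cons h fun i => (e i : TangentSpace I x)) =
      k x h * ν x fun i => (e i : TangentSpace I x) := by
  rw [hk.eqn x e he, wedgeOne_cons _ _ _ _ fun i => hk.vertical x _ (e i).2,
    Finset.sum_eq_zero, add_zero]
  · rfl
  intro i _
  refine wedgeTwoContract_eq_zero _ _ _ _ fun j l hjl => ?_
  -- Only slot 0 can hold a non-vertical vector, so of two distinct slots at least one is vertical.
  have hz : D.frobenius x ((Fin.cons h fun i => (e i : TangentSpace I x) :
      Fin (n + 1) → TangentSpace I x) j) ((Fin.cons h fun i => (e i : TangentSpace I x) :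
      Fin (n + 1) → TangentSpace I x) l) = 0 := by
    refine Fin.cases (fun hjl => ?_) (fun l' _ => ?_) l hjl
    · obtain ⟨j', rfl⟩ := Fin.exists_succ_eq.2 hjl
      exact (hb.frobenius_eq_zero (e j').2 (hF _ (e j').2) _).2
    · exact (hb.frobenius_eq_zero (e l').2 (hF _ (e l').2) _).1
  simp only [hz, hm]

theorem IsGeometricFamily.horBijectiveAt [IsManifold I ∞ X] {n : ℕ} {F : Type*} [TopologicalSpace F]
    [ChartedSpace (EuclideanSpace ℝ (Fin n)) F] (hD : D.IsGeometricFamily n F) (x : X) :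
    D.HorBijectiveAt x := hD.hor_bijective x

theorem IsGeometricFamily.metric_zero [IsManifold I ∞ X] {n : ℕ} {F : Type*} [TopologicalSpace F]
    [ChartedSpace (EuclideanSpace ℝ (Fin n)) F] (hD : D.IsGeometricFamily n F) (x : X)
    (w : D.vert x) : D.metric x 0 w = 0 := by
  simpa using hD.metric_smul x 0 0 w

/-- The differential of fib identifies the vertical space with ℝⁿ. It is injective there because
(dπ, d fib) has the left inverse d inv, and surjective because f ↦ inv (π x, f) is a right inverse
of fib with vertical differential. -/
theorem IsGeometricFamily.finrank_vert [IsManifold I ∞ X] {n : ℕ} {F : Type*} [TopologicalSpace F]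
    [ChartedSpace (EuclideanSpace ℝ (Fin n)) F] (hD : D.IsGeometricFamily n F) (x : X) :
    Module.finrank ℝ (D.vert x) = n := by
  obtain ⟨U, fib, inv, hU, hs, hfib, hinv, h1, h2⟩ := hD.locally_trivial (D.proj x)
  have hU' : D.proj ⁻¹' U ∈ 𝓝 x := (hU.preimage hD.contMDiff_proj.continuous).mem_nhds hs
  have hf : MDifferentiableAt I (𝓡 n) fib x :=
    (hfib.contMDiffAt hU').mdifferentiableAt (by simp)
  have hp : MDifferentiableAt I J D.proj x := hD.contMDiff_proj.mdifferentiable (by simp) x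
  have hi : MDifferentiableAt (J.prod (𝓡 n)) I inv (D.proj x, fib x) :=
    (hinv.contMDiffAt ((hU.prod isOpen_univ).mem_nhds ⟨hs, trivial⟩)).mdifferentiableAt (by simp)
  have hx : inv (D.proj x, fib x) = x := h2 x hs
  have hid : (fun y => inv (D.proj y, fib y)) =ᶠ[𝓝 x] fun y => y := by
    filter_upwards [hU'] with y hy using h2 y hy
  have e1 := tmap_comp (g := inv) (f := fun y => (D.proj y, fib y)) hi (hp.prodMk hf)
  rw [tmap_congr hid, tmap_id, tmap_prodMk hp hf] at e1
  have hj : MDifferentiableAt (𝓡 n) (J.prod (𝓡 n)) (fun f : F => (D.proj x, f)) (fib x) :=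
    mdifferentiableAt_const.prodMk (mdifferentiableAt_self _)
  have hij : MDifferentiableAt (𝓡 n) I (fun f : F => inv (D.proj x, f)) (fib x) :=
    hi.comp (f := fun f : F => (D.proj x, f)) (fib x) hj
  have e2 : tmap (𝓡 n) (𝓡 n) (fun f : F => fib (inv (D.proj x, f))) (fib x) = _ :=
    tmap_comp (g := fib) (f := fun f : F => inv (D.proj x, f)) (by rw [hx]; exact hf) hij
  have e3 : tmap (𝓡 n) J (fun f : F => D.proj (inv (D.proj x, f))) (fib x) = _ :=
    tmap_comp (g := D.proj) (f := fun f : F => inv (D.proj x, f)) (by rw [hx]; exact hp) hij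
  have g2 : (fun f : F => fib (inv (D.proj x, f))) = fun f => f := funext fun f => (h1 _ hs f).2
  have g3 : (fun f : F => D.proj (inv (D.proj x, f))) = fun _ => D.proj x :=
    funext fun f => (h1 _ hs f).1
  rw [g2, tmap_id, hx] at e2
  rw [g3, tmap_const, hx] at e3
  let L : D.vert x →ₗ[ℝ] EuclideanSpace ℝ (Fin n) :=
    (tmap I (𝓡 n) fib x).toLinearMap ∘ₗ ((D.vert x).subtype : D.vert x →ₗ[ℝ] E)
  have hL : Function.Bijective L := by
    constructor
    · refine (injective_iff_map_eq_zero L).2 fun v hv => Subtype.ext ?_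
      have h3 := DFunLike.congr_fun e1 v.1
      have h4 : ((tmap I J D.proj x).prod (tmap I (𝓡 n) fib x)) v.1 = 0 :=
        Prod.ext (mem_vert.1 v.2) hv
      exact h3.trans ((congrArg (tmap (J.prod (𝓡 n)) I inv (D.proj x, fib x)) h4).trans (map_zero
          _))
    · intro w
      exact ⟨⟨tmap (𝓡 n) I (fun f : F => inv (D.proj x, f)) (fib x) w,
        (DFunLike.congr_fun e3 w).symm⟩, (DFunLike.congr_fun e2 w).symm⟩
  rw [(LinearEquiv.ofBijective L hL).finrank_eq, finrank_euclideanSpace_fin]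

theorem IsGeometricFamily.exists_orthonormal_basis [IsManifold I ∞ X] [FiniteDimensional ℝ E] {n :
    ℕ}
    {F : Type*} [TopologicalSpace F] [ChartedSpace (EuclideanSpace ℝ (Fin n)) F]
    (hD : D.IsGeometricFamily n F) (x : X) :
    ∃ e : Module.Basis (Fin n) ℝ (D.vert x), D.IsOrthonormal x e := by
  have : FiniteDimensional ℝ (TangentSpace I x) := inferInstanceAs (FiniteDimensional ℝ E)
  exact Families.exists_orthonormal_basis (hD.finrank_vert x) (D.metric x) (hD.metric_add x)
    (hD.metric_smul x) (hD.metric_symm x) (hD.metric_pos x)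

end FamilyData

namespace PrincipalBundle

/-! ### Comparison of the volume forms and of the mean curvatures -/

section AssocCurvature

variable {EG EQ EM EX ES G Q M X S F : Type*}
    [NormedAddCommGroup EG] [NormedSpace ℝ EG] [NormedAddCommGroup EQ] [NormedSpace ℝ EQ]
    [NormedAddCommGroup EM] [NormedSpace ℝ EM]
    [NormedAddCommGroup EX] [NormedSpace ℝ EX] [FiniteDimensional ℝ EX]
    [NormedAddCommGroup ES] [NormedSpace ℝ ES]
    [Group G] [TopologicalSpace G] [ChartedSpace EG G] [LieGroup 𝓘(ℝ, EG) ∞ G]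
    [TopologicalSpace Q] [ChartedSpace EQ Q] [TopologicalSpace M] [ChartedSpace EM M]
    [IsManifold 𝓘(ℝ, EQ) ∞ Q] [IsManifold 𝓘(ℝ, EM) ∞ M]
    [TopologicalSpace X] [ChartedSpace EX X] [IsManifold 𝓘(ℝ, EX) ∞ X]
    [TopologicalSpace S] [ChartedSpace ES S] [IsManifold 𝓘(ℝ, ES) ∞ S]
    [MulAction G X] [ContinuousSMul G X] [ContMDiffSMul 𝓘(ℝ, EG) 𝓘(ℝ, EX) ∞ G X]
    [MulAction G S] [ContinuousSMul G S] [ContMDiffSMul 𝓘(ℝ, EG) 𝓘(ℝ, ES) ∞ G S]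
    [MulAction Gᵐᵒᵖ Q] {P : PrincipalBundle EG EQ EM G Q M} {Φ : P.Connection}
    {n : ℕ} [TopologicalSpace F] [ChartedSpace (EuclideanSpace ℝ (Fin n)) F]
    {D : FamilyData 𝓘(ℝ, EX) 𝓘(ℝ, ES) X S} {hG : D.IsInvariant G}

/-- The vertical vector of `X_Q` given by a vertical vector of `X`. -/
noncomputable def assocVert (Φ : P.Connection) (hG : D.IsInvariant G)
    (hπ : ContMDiff 𝓘(ℝ, EX) 𝓘(ℝ, ES) ∞ D.proj) (z : Q × X)
    (e : D.vert z.2) : (assocFamily Φ D hG).vert (P.assocMk z) :=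
  ⟨P.assocT (EY := EX) z (0, e.1), (mem_assocFamily_vert hπ).2 ⟨e.1, e.2, rfl⟩⟩

theorem isOrthonormal_assocVert (hπ : ContMDiff 𝓘(ℝ, EX) 𝓘(ℝ, ES) ∞ D.proj) {z : Q × X}
    {e : Fin n → D.vert z.2} (he : D.IsOrthonormal z.2 e) :
    (assocFamily Φ D hG).IsOrthonormal (P.assocMk z) (fun i => assocVert Φ hG hπ z (e i)) :=
  fun i j => (assocFamily_metric hπ z _ _ (e i) (e j) rfl rfl).trans (he i j)

theorem assocFamily_metric_zero (hD : D.IsGeometricFamily n F) (z : Q × X)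
    (w : (assocFamily Φ D hG).vert (P.assocMk z)) :
    (assocFamily Φ D hG).metric (P.assocMk z) 0 w = 0 := by
  obtain ⟨v, hv, hw⟩ := (mem_assocFamily_vert hD.contMDiff_proj).1 w.2
  exact (assocFamily_metric hD.contMDiff_proj z 0 w 0 ⟨v, hv⟩ (map_zero _) hw).trans
    (hD.metric_zero z.2 _)

/-- On the vectors with horizontal `Q`-component, the pullback of the volume form of `X_Q` is, up to
a sign, that of `X`. -/
theorem exists_sign_volumeForm (hD : D.IsGeometricFamily n F)
    {ν : Form 𝓘(ℝ, EX) X n} (hν : D.IsVolumeForm ν)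
    {νQ : Form (𝓘(ℝ, EM).prod 𝓘(ℝ, EX)) (P.Assoc X) n}
    (hνQ : (assocFamily Φ D hG).IsVolumeForm νQ) (z : Q × X) :
    ∃ c : ℝ, (c = 1 ∨ c = -1) ∧ ∀ (a : Fin n → EQ) (v : Fin n → EX), (∀ i, Φ.formT z.1 (a i) = 0) →
      νQ.val (P.assocMk z) (fun i => P.assocT z (a i, v i)) = c * ν.val z.2 v := by
  obtain ⟨e, he⟩ := hD.exists_orthonormal_basis z.2
  have hπ := hD.contMDiff_proj
  have hb := hD.horBijectiveAt
  let T : D.vert z.2 →ₗ[ℝ] EM × EX := (P.assocT (EY := EX) z).toLinearMap ∘ₗ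
    (LinearMap.inr ℝ EQ EX) ∘ₗ ((D.vert z.2).subtype : D.vert z.2 →ₗ[ℝ] EX)
  have h1 := hν.orthonormal z.2 e he
  have h2 : νQ.val (P.assocMk z) (fun i => T (e i)) = 1 ∨ νQ.val (P.assocMk z) (fun i => T (e i)) =
      -1 :=
    hνQ.orthonormal (P.assocMk z) _ (isOrthonormal_assocVert (Φ := Φ) (hG := hG) hπ he)
  -- The sign is the ratio of the values ±1 of the two forms on corresponding orthonormal frames.
  obtain ⟨c, hc, hce⟩ : ∃ c : ℝ, (c = 1 ∨ c = -1) ∧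
      νQ.val (P.assocMk z) (fun i => T (e i)) = c * ν z.2 (fun i => (e i).1) := by
    rcases h1 with h1 | h1 <;> rcases h2 with h2 | h2 <;> rw [h1, h2]
    exacts [⟨1, by simp⟩, ⟨-1, by simp⟩, ⟨-1, by simp⟩, ⟨1, by simp⟩]
  refine ⟨c, hc, fun a v ha => ?_⟩
  have h3 := alternating_eq_mul e ((νQ.val (P.assocMk z)).toAlternatingMap.compLinearMap T)
    ((ν.val z.2).toAlternatingMap.compLinearMap ((D.vert z.2).subtype : D.vert z.2 →ₗ[ℝ] EX)) hce
    (fun i => D.vertProj z.2 (v i))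
  -- Both forms see vertical parts only: ν kills H, and ν_Q kills H_Q, which contains q_*(a,
  -- horizontal part of v) as soon as Φ(a) = 0.
  have h4 : ν.val z.2 v = ν.val z.2 (fun i => (D.vertProj z.2 (v i)).1) := by
    have := multilinear_add_of_mem (V := EX) (ν.val z.2).toMultilinearMap (D.hor z.2)
      (hν.horizontal z.2) (fun i => (D.vertProj z.2 (v i)).1) (fun i => D.horProj z.2 (v i))
      (fun i => (hb z.2).horProj_mem (v i))
    refine Eq.trans (congrArg (ν.val z.2) (funext fun i => ?_)) this
    exact ((add_comm _ _).trans (FamilyData.horProj_add_vertProj z.2 (v i))).symm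
  have h5 : νQ.val (P.assocMk z) (fun i => P.assocT z (a i, v i)) =
      νQ.val (P.assocMk z) (fun i => T (D.vertProj z.2 (v i))) := by
    have := multilinear_add_of_mem (V := EM × EX) (νQ.val (P.assocMk z)).toMultilinearMap
      ((assocFamily Φ D hG).hor (P.assocMk z)) (hνQ.horizontal (P.assocMk z))
      (fun i => T (D.vertProj z.2 (v i))) (fun i => P.assocT (EY := EX) z (a i, (D.horProj z.2 (v
          i) : EX)))
      (fun i => mem_assocFamily_hor.2 ⟨a i, _, ha i, (hb z.2).horProj_mem (v i), rfl⟩)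
    refine Eq.trans (congrArg (νQ.val (P.assocMk z)) (funext fun i => ?_)) this
    exact assocT_add z (a i) ((add_comm _ _).trans (FamilyData.horProj_add_vertProj z.2 (v i)))
  rw [h4, h5]
  exact h3

/-- On the vectors with horizontal `Q`-component, the mean curvature form of `X_Q` pulls back to
    that
of `X`. -/
theorem meanCurvature_assocT (hD : D.IsGeometricFamily n F)
    {ν : Form 𝓘(ℝ, EX) X n} (hν : D.IsVolumeForm ν) {k : OneForm 𝓘(ℝ, EX) X}
    (hk : D.IsMeanCurvature ν k)
    {νQ : Form (𝓘(ℝ, EM).prod 𝓘(ℝ, EX)) (P.Assoc X) n}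
    (hνQ : (assocFamily Φ D hG).IsVolumeForm νQ) {kQ : OneForm (𝓘(ℝ, EM).prod 𝓘(ℝ, EX)) (P.Assoc X)}
    (hkQ : (assocFamily Φ D hG).IsMeanCurvature νQ kQ) (q₀ : Q) (x₀ : X) {a : EQ} (h : EX)
    (ha : Φ.formT q₀ a = 0) :
    kQ (P.assocMk (q₀, x₀)) (P.assocT (q₀, x₀) (a, h) : EM × EX) = k x₀ h := by
  have hπ := hD.contMDiff_proj
  have hb := hD.horBijectiveAt
  have hF : ∀ (x : X) (e : TangentSpace 𝓘(ℝ, EX) x), e ∈ D.vert x → D.FrobeniusVanishes x e :=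
    fun x e he => FamilyData.frobeniusVanishes_of_smooth hb hD.smooth_hor he
  obtain ⟨e, he⟩ := hD.exists_orthonormal_basis x₀
  choose c hc hcν using exists_sign_volumeForm (Φ := Φ) (hG := hG) hD hν hνQ
  set cQ := extChartAt 𝓘(ℝ, EQ) q₀ with hcQ
  set cX := extChartAt 𝓘(ℝ, EX) x₀ with hcX
  set p₀ : EQ × EX := (cQ q₀, cX x₀) with hp₀
  -- The quotient map in product charts: ν_Q is compared with ν after pulling back to a vector
  -- space, where vectors extend as constants.
  set f : EQ × EX → P.Assoc X := fun p => P.assocMk (cQ.symm p.1, cX.symm p.2) with hf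
  set α := νQ.pull f with hα
  set β := ν.inChart x₀ with hβ
  have hQ0 : cQ.symm (cQ q₀) = q₀ := extChartAt_to_inv q₀
  have hX0 : cX.symm (cX x₀) = x₀ := extChartAt_to_inv x₀
  have hf0 : f p₀ = P.assocMk (q₀, x₀) := by simp only [hf, hp₀, hQ0, hX0]
  have hfs : ContMDiffAt 𝓘(ℝ, EQ × EX) (𝓘(ℝ, EM).prod 𝓘(ℝ, EX)) ∞ f p₀ := by
    have h1 : ContMDiffAt 𝓘(ℝ, EQ) 𝓘(ℝ, EQ) ∞ cQ.symm p₀.1 :=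
      (contMDiffOn_extChartAt_symm q₀).contMDiffAt
        ((isOpen_extChartAt_target q₀).mem_nhds (mem_extChartAt_target q₀))
    have h2 : ContMDiffAt 𝓘(ℝ, EX) 𝓘(ℝ, EX) ∞ cX.symm p₀.2 :=
      (contMDiffOn_extChartAt_symm x₀).contMDiffAt
        ((isOpen_extChartAt_target x₀).mem_nhds (mem_extChartAt_target x₀))
    exact (P.contMDiff_assocMk _).comp p₀ ((h1.comp p₀ contDiffAt_fst.contMDiffAt).prodMk
      (h2.comp p₀ contDiffAt_snd.contMDiffAt))
  have hαd : DifferentiableAt ℝ α p₀ := Form.differentiableAt_pull hνQ.smooth hfs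
  have hβd : DifferentiableAt ℝ β p₀.2 :=
    Form.differentiableAt_inChart hν.smooth x₀ (mem_extChartAt_target x₀)
  -- the two forms in the charts
  have hT : ∀ p : EQ × EX, p.1 ∈ cQ.target → p.2 ∈ cX.target → ∀ w : EQ × EX,
      tmap 𝓘(ℝ, EQ × EX) (𝓘(ℝ, EM).prod 𝓘(ℝ, EX)) f p w =
      P.assocT (cQ.symm p.1, cX.symm p.2) (tmap 𝓘(ℝ, EQ) 𝓘(ℝ, EQ) cQ.symm p.1 w.1,
        tmap 𝓘(ℝ, EX) 𝓘(ℝ, EX) cX.symm p.2 w.2) := fun p h1 h2 w =>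
    tmap_assocMk_prod cQ.symm x₀ (mdifferentiableAt_extChartAt_symm q₀ h1) h2 w
  have hαβ : ∀ p : EQ × EX, p.1 ∈ cQ.target → p.2 ∈ cX.target → ∀ (a : Fin n → EQ) (v : Fin n → EX),
      (∀ i, Φ.formT (cQ.symm p.1) (tmap 𝓘(ℝ, EQ) 𝓘(ℝ, EQ) cQ.symm p.1 (a i)) = 0) →
      α p (fun i => (a i, v i)) = c (cQ.symm p.1, cX.symm p.2) * β p.2 v := by
    intro p h1 h2 a v hav
    have h3 := hcν (cQ.symm p.1, cX.symm p.2) _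
      (fun i => tmap 𝓘(ℝ, EX) 𝓘(ℝ, EX) cX.symm p.2 (v i)) hav
    rw [hβ, Form.inChart_eq_pull]
    refine Eq.trans (congrArg (νQ.val (f p)) (funext fun i => ?_)) h3
    exact hT p h1 h2 (a i, v i)
  have hQt : ∀ᶠ q in 𝓝 (cQ q₀), q ∈ cQ.target :=
    (isOpen_extChartAt_target q₀).eventually_mem (mem_extChartAt_target q₀)
  have hXt : ∀ᶠ x in 𝓝 (cX x₀), x ∈ cX.target :=
    (isOpen_extChartAt_target x₀).eventually_mem (mem_extChartAt_target x₀)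
  have ht : ∀ᶠ p in 𝓝 p₀, p.1 ∈ cQ.target ∧ p.2 ∈ cX.target := 
    (continuousAt_fst.eventually hQt).and (continuousAt_snd.eventually hXt)
  have hβ0 : ∀ v : Fin n → EX, β (cX x₀) v = ν.val x₀ v := by
    intro v
    rw [hβ, Form.inChart_eq_pull]
    unfold Form.pull
    rw [tmap_extChartAt_symm_self, extChartAt_to_inv]
    rfl
  set ev : Fin n → EX := fun i => (e i).1 with hev
  have hν0 : ν.val x₀ ev ≠ 0 := by
    rcases hν.orthonormal x₀ e he with h1 | h1
    · exact (h1.trans_ne one_ne_zero)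
    · exact (h1.trans_ne (by norm_num))
  -- the sign is locally constant
  have hsign : ∀ᶠ p in 𝓝 p₀, c (cQ.symm p.1, cX.symm p.2) = c (q₀, x₀) := by
    have h1 : ContinuousAt (fun p : EQ × EX => β p.2 ev) p₀ :=
      (((ContinuousAlternatingMap.apply ℝ EX ℝ ev).differentiableAt.comp p₀.2
          hβd).continuousAt).comp
        continuousAt_snd
    have h2 : ContinuousAt (fun p : EQ × EX => α p fun i => (0, ev i)) p₀ :=
      ((ContinuousAlternatingMap.apply ℝ (EQ × EX) ℝ
        fun i => ((0 : EQ), ev i)).differentiableAt.comp p₀ hαd).continuousAt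
    have h0 : β p₀.2 ev ≠ 0 := by
      rw [hp₀, hβ0]
      exact hν0
    -- The signs were chosen pointwise; this quotient of continuous functions shows that they vary
    -- continuously near p₀.
    have h3 : (fun p : EQ × EX => (α p fun i => (0, ev i)) / β p.2 ev) =ᶠ[𝓝 p₀]
        fun p => c (cQ.symm p.1, cX.symm p.2) := by
      filter_upwards [ht, h1.eventually_ne h0] with p hp hp0
      rw [hαβ p hp.1 hp.2 (fun _ => 0) ev fun i => by rw [map_zero, map_zero],
        mul_div_cancel_right₀ _ hp0]
    have h4 := (h2.div h1 h0).congr h3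
    -- Radius 1 separates the values 1 and -1.
    have h5 := h4.eventually (Metric.ball_mem_nhds _ one_pos)
    filter_upwards [h5] with p hp
    have hp0 : c (cQ.symm p₀.1, cX.symm p₀.2) = c (q₀, x₀) := by simp only [hp₀, hQ0, hX0]
    rw [hp0, Real.dist_eq] at hp
    rcases hc (cQ.symm p.1, cX.symm p.2) with h6 | h6 <;> rcases hc (q₀, x₀) with h7 | h7 <;>
      rw [h6, h7] at hp ⊢ <;> norm_num at hp
  -- Vectors (0, v) have Φ-horizontal Q-component at every nearby point. Multiples of the constant
  -- vector a are only known to be horizontal at q₀, which suffices on the slice through q₀.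
  have key := extDeriv_prod_apply (c := c (q₀, x₀)) (a := a) hαd hβd
    (by
      filter_upwards [ht, hsign] with p hp hp' v
      rw [hαβ p hp.1 hp.2 (fun _ => 0) v fun i => by rw [map_zero, map_zero], hp'])
    (by
      have h1 : ContinuousAt (fun x : EX => (p₀.1, x)) p₀.2 := by fun_prop
      filter_upwards [h1.eventually hsign, hXt] with x hx hxt r v
      rw [hαβ (p₀.1, x) (mem_extChartAt_target q₀) hxt (fun i => r i • a) v, hx]
      intro i
      rw [hp₀, tmap_extChartAt_symm_self, hQ0]
      exact (map_smul (Φ.formT q₀) (r i) a).trans (by rw [ha, smul_zero])) h ev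
  have hT0 : ∀ w : EQ × EX, tmap 𝓘(ℝ, EQ × EX) (𝓘(ℝ, EM).prod 𝓘(ℝ, EX)) f p₀ w =
      P.assocT (q₀, x₀) w := by
    intro w
    rw [hT p₀ (mem_extChartAt_target q₀) (mem_extChartAt_target x₀) w]
    simp only [hp₀, hQ0, hX0]
    rw [tmap_extChartAt_symm_self, tmap_extChartAt_symm_self]
    rfl
  have hl : extDeriv α p₀ (Fin.cons (a, h) fun i => (0, ev i)) =
      νQ.d.val (P.assocMk (q₀, x₀)) (Fin.cons (P.assocT (q₀, x₀) (a, h))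
        fun i => P.assocT (q₀, x₀) (0, ev i)) := by
    rw [hα, Form.extDeriv_pull hνQ.smooth hfs, hf0]
    refine congrArg (νQ.d.val (P.assocMk (q₀, x₀))) (funext fun j => ?_)
    refine Fin.cases ?_ (fun j => ?_) j
    · exact hT0 _
    · exact hT0 _
  have hr : extDeriv β p₀.2 (Fin.cons h ev) = ν.d.val x₀ (Fin.cons h ev) := by
    have hs : ContMDiffAt 𝓘(ℝ, EX) 𝓘(ℝ, EX) ∞ cX.symm (cX x₀) :=
      (contMDiffOn_extChartAt_symm x₀).contMDiffAt
        ((isOpen_extChartAt_target x₀).mem_nhds (mem_extChartAt_target x₀))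
    rw [hβ, Form.inChart_eq_pull, Form.extDeriv_pull hν.smooth hs, hX0, tmap_extChartAt_symm_self]
    rfl
  have hdX := hk.d_cons (hb x₀) (hF x₀) (hD.metric_zero x₀) he h
  have hdQ := hkQ.d_cons (assocFamily_horBijectiveAt Φ hG hπ hb (P.assocMk (q₀, x₀)))
    (fun _ hw => assocFamily_frobeniusVanishes hπ hb hF _ hw)
    (assocFamily_metric_zero hD (q₀, x₀))
    (isOrthonormal_assocVert (z := (q₀, x₀)) hπ he) (P.assocT (EY := EX) (q₀, x₀) (a, h))
  have hνe := hcν (q₀, x₀) (fun _ => 0) ev fun _ => map_zero _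
  have h1 := (hdQ.symm.trans (hl.symm.trans (key.trans (congrArg _ (hr.trans hdX)))))
  have h2 : kQ (P.assocMk (q₀, x₀)) (P.assocT (q₀, x₀) (a, h) : EM × EX) *
      (c (q₀, x₀) * ν.val x₀ ev) = c (q₀, x₀) * (k x₀ h * ν.val x₀ ev) := by
    rw [← hνe]
    exact h1
  have hc0 : c (q₀, x₀) ≠ 0 := by
    rcases hc (q₀, x₀) with h | h <;> rw [h] <;> norm_num
  -- The sign occurs on both sides and cancels, so the choice of orientation for ν_Q does not affect
  -- k_Q.
  refine mul_right_cancel₀ (mul_ne_zero hc0 hν0) (h2.trans ?_)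
  ring

end AssocCurvature

end PrincipalBundle

/-- `horLift` is defined by `Function.invFun`, so its linearity has to be recovered: it is the
inverse of a linear bijection. -/
theorem FamilyData.HorBijectiveAt.exists_linear_horLift {E H E' H' X S : Type*}
    [NormedAddCommGroup E] [NormedSpace ℝ E]
    [TopologicalSpace H] {I : ModelWithCorners ℝ E H} [TopologicalSpace X] [ChartedSpace H X]
    [NormedAddCommGroup E'] [NormedSpace ℝ E'] [TopologicalSpace H'] {J : ModelWithCorners ℝ E' H'}
    [TopologicalSpace S] [ChartedSpace H' S] {D : FamilyData I J X S} {x : X}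
    (h : D.HorBijectiveAt x) : ∃ L : E' →ₗ[ℝ] E, ∀ w : E', D.horLift x w = L w := by
  let T : D.hor x →ₗ[ℝ] E' :=
    (tmap I J D.proj x).toLinearMap ∘ₗ ((D.hor x).subtype : D.hor x →ₗ[ℝ] E)
  refine ⟨((D.hor x).subtype : D.hor x →ₗ[ℝ] E) ∘ₗ (LinearEquiv.ofBijective T h).symm.toLinearMap,
    fun w => ?_⟩
  exact h.horLift_eq ((LinearEquiv.ofBijective T h).symm w).2
    ((LinearEquiv.ofBijective T h).apply_symm_apply w)

namespace PrincipalBundle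

/-! ### The formula on Q × X, its form on the base, and basicness -/

section MainFormula

variable {EG EQ EM EX ES G Q M X S F : Type*}
    [NormedAddCommGroup EG] [NormedSpace ℝ EG] [NormedAddCommGroup EQ] [NormedSpace ℝ EQ]
    [NormedAddCommGroup EM] [NormedSpace ℝ EM]
    [NormedAddCommGroup EX] [NormedSpace ℝ EX] [FiniteDimensional ℝ EX]
    [NormedAddCommGroup ES] [NormedSpace ℝ ES]
    [Group G] [TopologicalSpace G] [ChartedSpace EG G] [LieGroup 𝓘(ℝ, EG) ∞ G]
    [TopologicalSpace Q] [ChartedSpace EQ Q] [TopologicalSpace M] [ChartedSpace EM M]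
    [IsManifold 𝓘(ℝ, EQ) ∞ Q] [IsManifold 𝓘(ℝ, EM) ∞ M]
    [TopologicalSpace X] [ChartedSpace EX X] [IsManifold 𝓘(ℝ, EX) ∞ X]
    [TopologicalSpace S] [ChartedSpace ES S] [IsManifold 𝓘(ℝ, ES) ∞ S]
    [MulAction G X] [ContinuousSMul G X] [ContMDiffSMul 𝓘(ℝ, EG) 𝓘(ℝ, EX) ∞ G X]
    [MulAction G S] [ContinuousSMul G S] [ContMDiffSMul 𝓘(ℝ, EG) 𝓘(ℝ, ES) ∞ G S]
    [MulAction Gᵐᵒᵖ Q] {P : PrincipalBundle EG EQ EM G Q M} (Φ : P.Connection)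
    {ι : Type*} [Fintype ι] (e : Module.Basis ι ℝ (GroupLieAlgebra 𝓘(ℝ, EG) G))

/-- For a form pulled back from `Y`, `α - φᵃ ι_a α` is the value of `α` on the vector whose
`Q`-component has been made horizontal by the subtraction of a generator. -/
theorem Connection.subContract_snd {EY Y : Type*} [NormedAddCommGroup EY] [NormedSpace ℝ EY]
    [TopologicalSpace Y] [ChartedSpace EY Y] [IsManifold 𝓘(ℝ, EY) ∞ Y] [MulAction G Y]
        [ContinuousSMul G Y]
    [ContMDiffSMul 𝓘(ℝ, EG) 𝓘(ℝ, EY) ∞ G Y] (Φ : P.Connection)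
    (e : Module.Basis ι ℝ (GroupLieAlgebra 𝓘(ℝ, EG) G)) (z : Q × Y) (α : EY → ℝ) (A : EY →ₗ[ℝ] ℝ)
    (hα : ∀ v, α v = A v) (w : EQ × EY) :
    Φ.subContract e z
      (fun w => α (mfderiv (𝓘(ℝ, EQ).prod 𝓘(ℝ, EY)) 𝓘(ℝ, EY) Prod.snd z w)) w =
    A (w.2 - tmap 𝓘(ℝ, EG) 𝓘(ℝ, EY) (fun g : G => g⁻¹ • z.2) 1 (Φ.formT z.1 w.1)) := by
  have h1 : ∀ w : EQ × EY,
      α (mfderiv (𝓘(ℝ, EQ).prod 𝓘(ℝ, EY)) 𝓘(ℝ, EY) Prod.snd z w) = A w.2 := by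
    intro w
    rw [mfderiv_snd]
    exact hα w.2
  have h2 : Φ.form z.1 (mfderiv (𝓘(ℝ, EQ).prod 𝓘(ℝ, EY)) 𝓘(ℝ, EQ) Prod.fst z w) =
      Φ.formT z.1 w.1 := by
    rw [mfderiv_fst]
    rfl
  -- The contraction with generators is linear in the Lie algebra element, so the sum over the basis
  -- collapses to its value at Φ(w).
  let B : GroupLieAlgebra 𝓘(ℝ, EG) G →ₗ[ℝ] ℝ :=
    A ∘ₗ (tmap 𝓘(ℝ, EG) 𝓘(ℝ, EY) (fun g : G => g⁻¹ • z.2) 1).toLinearMap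
  have h3 : ∀ v : GroupLieAlgebra 𝓘(ℝ, EG) G,
      α (mfderiv (𝓘(ℝ, EQ).prod 𝓘(ℝ, EY)) 𝓘(ℝ, EY) Prod.snd z (generator EQ v z)) = B v := by
    intro v
    refine (h1 _).trans ?_
    exact congrArg (fun w : EQ × EY => A w.2) (P.generator_eq v z)
  have h4 : ∑ a, e.coord a (Φ.form z.1
      (mfderiv (𝓘(ℝ, EQ).prod 𝓘(ℝ, EY)) 𝓘(ℝ, EQ) Prod.fst z w)) *
      α (mfderiv (𝓘(ℝ, EQ).prod 𝓘(ℝ, EY)) 𝓘(ℝ, EY) Prod.snd z (generator EQ (e a) z)) =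
      B (Φ.formT z.1 w.1) := by
    rw [h2]
    conv_rhs => rw [← e.sum_repr (Φ.formT z.1 w.1), map_sum]
    refine Finset.sum_congr rfl fun a _ => ?_
    rw [h3, map_smul]
    rfl
  rw [map_sub]
  exact congrArg₂ (· - ·) (h1 w) h4

variable {Φ} {n : ℕ} [TopologicalSpace F] [ChartedSpace (EuclideanSpace ℝ (Fin n)) F]
    {D : FamilyData 𝓘(ℝ, EX) 𝓘(ℝ, ES) X S} {hG : D.IsInvariant G}

/-- Subtracting the generator of Φ(w) leaves the image in X_Q unchanged and makes the Q-component
horizontal, where `meanCurvature_assocT` applies. -/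
theorem meanCurvature_eq_subContract (hD : D.IsGeometricFamily n F)
    {ν : Form 𝓘(ℝ, EX) X n} (hν : D.IsVolumeForm ν) {k : OneForm 𝓘(ℝ, EX) X}
    (hk : D.IsMeanCurvature ν k)
    {νQ : Form (𝓘(ℝ, EM).prod 𝓘(ℝ, EX)) (P.Assoc X) n}
    (hνQ : (assocFamily Φ D hG).IsVolumeForm νQ) {kQ : OneForm (𝓘(ℝ, EM).prod 𝓘(ℝ, EX)) (P.Assoc X)}
    (hkQ : (assocFamily Φ D hG).IsMeanCurvature νQ kQ)
    (z : Q × X) (w : TangentSpace (𝓘(ℝ, EQ).prod 𝓘(ℝ, EX)) z) :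
    kQ (P.assocMk z) (P.assocDeriv z w) =
      Φ.subContract e z
        (fun w => k z.2 (mfderiv (𝓘(ℝ, EQ).prod 𝓘(ℝ, EX)) 𝓘(ℝ, EX) Prod.snd z w)) w := by
  refine Eq.trans ?_ (Φ.subContract_snd e z (fun v : EX => k z.2 v) (k z.2).toLinearMap
    (fun _ => rfl) w).symm
  refine Eq.trans (congrArg (kQ (P.assocMk z)) (Φ.assocT_eq z w.1 w.2)) ?_
  exact meanCurvature_assocT hD hν hk hνQ hkQ z.1 z.2 _ (Φ.formT_sub _ _)

theorem toBase_meanCurvature_eq_subContract (hD : D.IsGeometricFamily n F)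
    {ν : Form 𝓘(ℝ, EX) X n} (hν : D.IsVolumeForm ν) {k : OneForm 𝓘(ℝ, EX) X}
    (hk : D.IsMeanCurvature ν k)
    {νQ : Form (𝓘(ℝ, EM).prod 𝓘(ℝ, EX)) (P.Assoc X) n}
    (hνQ : (assocFamily Φ D hG).IsVolumeForm νQ) {kQ : OneForm (𝓘(ℝ, EM).prod 𝓘(ℝ, EX)) (P.Assoc X)}
    (hkQ : (assocFamily Φ D hG).IsMeanCurvature νQ kQ)
    (q : Q) (x : X) (w : TangentSpace (𝓘(ℝ, EQ).prod 𝓘(ℝ, ES)) ((q, D.proj x) : Q × S)) :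
    (assocFamily Φ D hG).toBase kQ (P.assocMk (q, x)) (P.assocDeriv (q, D.proj x) w) =
      Φ.subContract e (q, D.proj x)
        (fun w => D.toBase k x (mfderiv (𝓘(ℝ, EQ).prod 𝓘(ℝ, ES)) 𝓘(ℝ, ES) Prod.snd
          ((q, D.proj x) : Q × S) w)) w := by
  have hb := hD.horBijectiveAt
  have hπ := hD.contMDiff_proj
  obtain ⟨L, hL⟩ := (hb x).exists_linear_horLift
  refine Eq.trans ?_ (Φ.subContract_snd e (q, D.proj x) (fun v : ES => D.toBase k x v)
    ((k x).toLinearMap ∘ₗ L) (fun v => congrArg (k x) (hL v)) w).symm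
  set a : EQ := w.1 - tmap 𝓘(ℝ, EG) 𝓘(ℝ, EQ) (fun g : G => op g • q) 1 (Φ.formT q w.1) with ha
  set s : ES := w.2 - tmap 𝓘(ℝ, EG) 𝓘(ℝ, ES) (fun g : G => g⁻¹ • D.proj x) 1 (Φ.formT q w.1) with hs
  have ha0 : Φ.formT q a = 0 := Φ.formT_sub q w.1
  have hmem : P.assocT (EY := EX) (q, x) (a, L s) ∈ (assocFamily Φ D hG).hor (P.assocMk (q, x)) :=
    mem_assocFamily_hor.2 ⟨a, _, ha0, hL s ▸ (hb x).horLift_mem s, rfl⟩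
  -- With w corrected to (a, s), Φ(a) = 0, the vector q_{X*}(a, lift of s) lies in H_Q and maps to
  -- q_{S*}(a, s); uniqueness of horizontal lifts identifies it.
  have hlift : ((assocFamily Φ D hG).horLift (P.assocMk (q, x)) (P.assocDeriv (q, D.proj x) w) :
      EM × EX) = P.assocT (EY := EX) (q, x) (a, L s) := by
    refine (assocFamily_horBijectiveAt Φ hG hπ hb _).horLift_eq hmem ?_
    refine (tmap_assocMap hG hπ (q, x) a (L s)).trans ?_
    refine Eq.trans ?_ (Φ.assocT_eq (q, D.proj x) w.1 w.2).symm
    refine congrArg (fun s : ES => P.assocT (EY := ES) (q, D.proj x) (a, s)) ?_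
    exact (congrArg (tmap 𝓘(ℝ, EX) 𝓘(ℝ, ES) D.proj x) (hL s).symm).trans ((hb x).tmap_horLift s)
  exact (congrArg (kQ (P.assocMk (q, x))) hlift).trans
    (meanCurvature_assocT hD hν hk hνQ hkQ q x _ ha0)

/-- A form on `Q × S` which is pulled back from `S_Q` is basic. -/
theorem isBasic_toBase (hπ : ContMDiff 𝓘(ℝ, EX) 𝓘(ℝ, ES) ∞ D.proj)
    (hb : ∀ x, D.HorBijectiveAt x) (kQ : OneForm (𝓘(ℝ, EM).prod 𝓘(ℝ, EX)) (P.Assoc X))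
    (β : ∀ z : Q × X, TangentSpace (𝓘(ℝ, EQ).prod 𝓘(ℝ, ES)) ((z.1, D.proj z.2) : Q × S) → ℝ)
    (hβ : ∀ z w, β z w =
      (assocFamily Φ D hG).toBase kQ (P.assocMk z) (P.assocDeriv (z.1, D.proj z.2) w)) :
    IsBasic (G := G) EG D.proj β := by
  constructor
  · intro z v
    obtain ⟨L, hL⟩ := (assocFamily_horBijectiveAt Φ hG hπ hb (P.assocMk z)).exists_linear_horLift
    have h1 : (P.assocDeriv (z.1, D.proj z.2) (generator EQ v ((z.1, D.proj z.2) : Q × S)) :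
        EM × ES) = 0 :=
      (congrArg (P.assocT (EY := ES) (z.1, D.proj z.2)) (P.generator_eq v _)).trans
        (P.assocT_generator (EY := ES) v (z.1, D.proj z.2))
    refine (hβ z _).trans ?_
    refine (congrArg (kQ (P.assocMk z)) ((hL _).trans ((congrArg L h1).trans (map_zero L)))).trans
        ?_
    exact map_zero (kQ (P.assocMk z))
  · intro z g w
    have h1 := DFunLike.congr_fun (P.tmap_act (EY := ES) g (z.1, D.proj z.2)) w
    have h2 := (congrArg (P.assocT (EY := ES) (op g • z.1, g⁻¹ • D.proj z.2)) h1).trans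
      (P.assocT_act (EY := ES) g (z.1, D.proj z.2) w)
    -- The points π(g⁻¹ x) and g⁻¹ π(x), and the classes of a point and its translate, agree only
    -- propositionally; they become variables so that they can be substituted in the dependent
    -- types.
    have h3 : ∀ (y : P.Assoc X) (s : S) (u : EM × ES) (w' : EQ × ES), y = P.assocMk z →
        s = g⁻¹ • D.proj z.2 → u = P.assocT (EY := ES) (op g • z.1, s) w' →
        w' = tmap (𝓘(ℝ, EQ).prod 𝓘(ℝ, ES)) (𝓘(ℝ, EQ).prod 𝓘(ℝ, ES))
          (fun p : Q × S => ((op g • p.1, g⁻¹ • p.2) : Q × S)) (z.1, D.proj z.2) w →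
        (assocFamily Φ D hG).toBase kQ y u = (assocFamily Φ D hG).toBase kQ (P.assocMk z)
          (P.assocT (EY := ES) (z.1, D.proj z.2) w) := by
      rintro _ _ _ _ rfl rfl rfl rfl
      exact congrArg (fun u : EM × ES => (assocFamily Φ D hG).toBase kQ (P.assocMk z) u) h2
    refine (hβ _ _).trans (Eq.trans ?_ (hβ z w).symm)
    exact h3 _ (D.proj (g⁻¹ • z.2)) _ _ (P.assocMk_act g z) (hG.proj_smul g⁻¹ z.2) rfl rfl

end MainFormula

end PrincipalBundle

end Families

theorem mainTheorem5
    {EG EQ EM EX ES G Q M X S F : Type*}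
    [NormedAddCommGroup EG] [NormedSpace ℝ EG] [FiniteDimensional ℝ EG]
    [NormedAddCommGroup EQ] [NormedSpace ℝ EQ] [FiniteDimensional ℝ EQ]
    [NormedAddCommGroup EM] [NormedSpace ℝ EM] [FiniteDimensional ℝ EM]
    [NormedAddCommGroup EX] [NormedSpace ℝ EX] [FiniteDimensional ℝ EX]
    [NormedAddCommGroup ES] [NormedSpace ℝ ES] [FiniteDimensional ℝ ES]
    -- the Lie group `G`
    [Group G] [TopologicalSpace G] [ChartedSpace EG G] [LieGroup 𝓘(ℝ, EG) ∞ G]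
    -- the manifolds `Q`, `M`, `X`, `S`
    [TopologicalSpace Q] [ChartedSpace EQ Q] [IsManifold 𝓘(ℝ, EQ) ∞ Q]
    [TopologicalSpace M] [ChartedSpace EM M] [IsManifold 𝓘(ℝ, EM) ∞ M]
    [TopologicalSpace X] [ChartedSpace EX X] [IsManifold 𝓘(ℝ, EX) ∞ X]
    [TopologicalSpace S] [ChartedSpace ES S] [IsManifold 𝓘(ℝ, ES) ∞ S]
    -- the smooth actions of `G` on `X` and `S`
    [MulAction G X] [ContinuousSMul G X] [ContMDiffSMul 𝓘(ℝ, EG) 𝓘(ℝ, EX) ∞ G X]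
    [MulAction G S] [ContinuousSMul G S] [ContMDiffSMul 𝓘(ℝ, EG) 𝓘(ℝ, ES) ∞ G S]
    -- the principal bundle `Q → M` with its connection, and a basis of the Lie algebra
    [MulAction Gᵐᵒᵖ Q] (P : Families.PrincipalBundle EG EQ EM G Q M) (Φ : P.Connection)
    {ι : Type*} [Fintype ι] (e : Module.Basis ι ℝ (GroupLieAlgebra 𝓘(ℝ, EG) G))
    -- the geometric family `X → S`, with typical fibre `F`, preserved by `G`
    (n : ℕ) [TopologicalSpace F] [ChartedSpace (EuclideanSpace ℝ (Fin n)) F] [IsManifold (𝓡 n) ∞ F]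
    (D : Families.FamilyData 𝓘(ℝ, EX) 𝓘(ℝ, ES) X S) (hD : D.IsGeometricFamily n F)
    (hG : D.IsInvariant G)
    -- its `G`-invariant vertical volume form and its mean curvature form
    (ν : Families.Form 𝓘(ℝ, EX) X n) (hν : D.IsVolumeForm ν) (hνG : Families.Form.IsInvariant G ν)
    (k : Families.OneForm 𝓘(ℝ, EX) X) (hk : D.IsMeanCurvature ν k)
    -- the vertical volume form and the mean curvature form of `X_Q → S_Q`
    (νQ : Families.Form (𝓘(ℝ, EM).prod 𝓘(ℝ, EX)) (P.Assoc X) n)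
    (hνQ : (Families.PrincipalBundle.assocFamily Φ D hG).IsVolumeForm νQ)
    (kQ : Families.OneForm (𝓘(ℝ, EM).prod 𝓘(ℝ, EX)) (P.Assoc X))
    (hkQ : (Families.PrincipalBundle.assocFamily Φ D hG).IsMeanCurvature νQ kQ) :
    -- `k_Q = k - φᵃ ι_a k` as `1`-forms on `Q × S` with values in the functions on the fibres
    (∀ (q : Q) (x : X) (w : TangentSpace (𝓘(ℝ, EQ).prod 𝓘(ℝ, ES)) ((q, D.proj x) : Q × S)),
      (Families.PrincipalBundle.assocFamily Φ D hG).toBase kQ (P.assocMk (q, x))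
          (P.assocDeriv (q, D.proj x) w) =
        Φ.subContract e (q, D.proj x)
          (fun w => D.toBase k x (mfderiv (𝓘(ℝ, EQ).prod 𝓘(ℝ, ES)) 𝓘(ℝ, ES) Prod.snd
            ((q, D.proj x) : Q × S) w)) w) ∧
    -- the right-hand side is basic
    Families.PrincipalBundle.IsBasic (G := G) EG D.proj (fun z : Q × X =>
      Φ.subContract e ((z.1, D.proj z.2) : Q × S)
        (fun w => D.toBase k z.2 (mfderiv (𝓘(ℝ, EQ).prod 𝓘(ℝ, ES)) 𝓘(ℝ, ES) Prod.snd
          ((z.1, D.proj z.2) : Q × S) w))) ∧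
    -- `k_Q = k - φᵃ ι_a k` as `1`-forms on `Q × X`
    (∀ (z : Q × X) (w : TangentSpace (𝓘(ℝ, EQ).prod 𝓘(ℝ, EX)) z),
      kQ (P.assocMk z) (P.assocDeriv z w) =
        Φ.subContract e z
          (fun w => k z.2 (mfderiv (𝓘(ℝ, EQ).prod 𝓘(ℝ, EX)) 𝓘(ℝ, EX) Prod.snd z w)) w) := by
  have h1 := Families.PrincipalBundle.toBase_meanCurvature_eq_subContract e hD hν hk hνQ hkQ
  refine ⟨h1, ?_, Families.PrincipalBundle.meanCurvature_eq_subContract e hD hν hk hνQ hkQ⟩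
  -- By the first formula the right-hand side is pulled back along q_S, which kills generators and
  -- is G-invariant; basicness follows formally.
  exact Families.PrincipalBundle.isBasic_toBase hD.contMDiff_proj hD.horBijectiveAt kQ _
    fun z w => (h1 z.1 z.2 w).symm
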